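/- **Data.** Let $M,N\ge 0$ with $M+N>2$, $MN\neq 2$, $M\neq N$, and let $\varsigma_a\in\{\pm1\}$, $a\in Q_0:=\mathbb Z/(M+N)\mathbb Z$, be a cyclic sequence with $M$ entries $-1$ and $N$ entries $+1$ (a toric phase of the generalized conifold $xy=z^Mw^N$). A node $a$ is even ($|a|=0$) if $\varsigma_a=\varsigma_{a+1}$ and odd ($|a|=1$) otherwise. Let $(\alpha^{(a)},\alpha^{(a)})=-\varsigma_a-\varsigma_{a+1}$, $(\alpha^{(a)},\alpha^{(a+1)})=(\alpha^{(a+1)},\alpha^{(a)})=\varsigma_{a+1}$ and $(\alpha^{(a)},\alpha^{(b)})=0$ for all other pairs; extend bilinearly to the root lattice $\bigoplus_a\mathbb Z\alpha^{(a)}$. Let $\epsilon_1,\epsilon_2\in\mathbb C$ with $\epsilon_1+\epsilon_2\ne0$. Put $\sigma_1^{aa}=-\varsigma_a(\epsilon_1+\epsilon_2)$ for $a$ even and $\sigma_1^{aa}=0$ for $a$ odd; $(\sigma_1^{a,a+1},\sigma_1^{a+1,a})=(\epsilon_2,\epsilon_1)$ if $\varsigma_{a+1}=1$ and $(-\epsilon_1,-\epsilon_2)$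 if $\varsigma_{a+1}=-1$; $\sigma_1^{ab}=0$ otherwise. All brackets are super brackets, $[x,y]=xy-(-1)^{|x||y|}yx$. **Quiver Yangian.** $\mathsf Y$ is the associative superalgebra over $\mathbb C$ generated by $e^{(a)}_n,f^{(a)}_n$ (of parity $|a|$) and $\psi^{(a)}_n$ (even), $a\in Q_0$, $n\in\mathbb N$, with the relations, for all nodes and all mode numbers $\ge0$, * $[\psi^{(a)}_n,\psi^{(b)}_m]=0$, $[e^{(a)}_n,f^{(b)}_m]=\delta_{ab}\psi^{(a)}_{m+n}$, $[\psi^{(a)}_0,e^{(b)}_m]=(\alpha^{(a)},\alpha^{(b)})e^{(b)}_m$, $[\psi^{(a)}_0,f^{(b)}_m]=-(\alpha^{(a)},\alpha^{(b)})f^{(b)}_m$; * $[\psi^{(a)}_{n+1},e^{(b)}_m]-[\psi^{(a)}_n,e^{(b)}_{m+1}]=\sigma_1^{ba}\psi^{(a)}_ne^{(b)}_m+\sigma_1^{ab}e^{(b)}_m\psi^{(a)}_n$ and $[\psi^{(a)}_{n+1},f^{(b)}_m]-[\psi^{(a)}_n,f^{(b)}_{m+1}]=-\sigma_1^{ab}\psi^{(a)}_nf^{(b)}_m-\sigma_1^{ba}f^{(b)}_m\psi^{(a)}_n$;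 * if $\sigma_1^{ab}\ne0$: $[e^{(a)}_{n+1},e^{(b)}_m]-[e^{(a)}_n,e^{(b)}_{m+1}]=\sigma_1^{ba}e^{(a)}_ne^{(b)}_m+(-1)^{|a||b|}\sigma_1^{ab}e^{(b)}_me^{(a)}_n$ and $[f^{(a)}_{n+1},f^{(b)}_m]-[f^{(a)}_n,f^{(b)}_{m+1}]=-\sigma_1^{ab}f^{(a)}_nf^{(b)}_m-(-1)^{|a||b|}\sigma_1^{ba}f^{(b)}_mf^{(a)}_n$; if $\sigma_1^{ab}=0$: $[e^{(a)}_n,e^{(b)}_m]=[f^{(a)}_n,f^{(b)}_m]=0$; * Serre relations: $\mathrm{Sym}_{n_1,n_2}[e^{(a)}_{n_1},[e^{(a)}_{n_2},e^{(a\pm1)}_m]]=0$ for $a$ even, $\mathrm{Sym}_{n_1,n_2}[e^{(a)}_{n_1},[e^{(a+1)}_{m_1},[e^{(a)}_{n_2},e^{(a-1)}_{m_2}]]]=0$ for $a$ odd, where $\mathrm{Sym}_{n_1,n_2}$ is the sum over both orderings of $n_1,n_2$, and the same with $f$ in place of $e$. Let $\mathfrak g$ be the Kac–Moody superalgebra of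 type $A^{(1)}_{M-1,N-1}$ with simple roots $\alpha^{(a)}$, given by the Chevalley–Serre presentation (the relations above on $e_0,f_0,\psi_0$, without symmetrization), let $\iota:U(\mathfrak g)\to\mathsf Y$ send the Chevalley generators $x_+^{(a)},x_-^{(a)},h^{(a)}$ to $e^{(a)}_0,f^{(a)}_0,\psi^{(a)}_0$, and let $(\ ,\ )$ be the invariant form of $\mathfrak g$ with $(x^{(a)}_+,x^{(a)}_-)=1$. Let $\varDelta_+$ be the set of positive roots, choose a basis $x_+^{(\alpha,k)}$ of each root space $\mathfrak g_\alpha$, $\alpha\in\varDelta_+$, and let $x_-^{(\alpha,k)}\in\mathfrak g_{-\alpha}$ be the dual basis, $(x_+^{(\alpha,k)},x_-^{(\alpha,l)})=\delta_{kl}$; put $e^{(\alpha,k)}=\iota(x_+^{(\alpha,k)})$, $f^{(\alpha,k)}=\iota(x_-^{(\alpha,k)})$. Let $\widehat{\mathsf Y}$ be the completion $\varprojlim_n\mathsf Y/\mathsf Y\,\mathsf Y^+_{\ge n}$, where $\mathsf Y\,\mathsf Y^+_{\ge n}$ is the left ideal generated by the products of at least $n$ elements $e^{(a)}_k$. **$J$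 generators.** In $\widehat{\mathsf Y}$ put $J(\psi^{(a)}_0)=\psi^{(a)}_1+v^{(a)}$, $J(e^{(a)}_0)=e^{(a)}_1+w^{(a)}_+$, $J(f^{(a)}_0)=f^{(a)}_1+w^{(a)}_-$, where $$v^{(a)}=\tfrac{\epsilon_1+\epsilon_2}2\sum_{\alpha\in\varDelta_+}(\alpha,\alpha^{(a)})\sum_kf^{(\alpha,k)}e^{(\alpha,k)}-\tfrac{\epsilon_1+\epsilon_2}2(\psi^{(a)}_0)^2,$$ $$w^{(a)}_+=-\tfrac{\epsilon_1+\epsilon_2}2\sum_{\alpha\in\varDelta_+}\sum_kf^{(\alpha,k)}[e^{(\alpha,k)},e^{(a)}_0]-\tfrac{\epsilon_1+\epsilon_2}2\psi^{(a)}_0e^{(a)}_0,$$ $$w^{(a)}_-=-\tfrac{\epsilon_1+\epsilon_2}2\sum_{\alpha\in\varDelta_+}\sum_k[f^{(a)}_0,f^{(\alpha,k)}]e^{(\alpha,k)}-\tfrac{\epsilon_1+\epsilon_2}2f^{(a)}_0\psi^{(a)}_0.$$ For an even node $b$ let $s^{(b)}(\beta)=\beta-\frac{2(\alpha^{(b)},\beta)}{(\alpha^{(b)},\alpha^{(b)})}\alpha^{(b)}$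 and $\tau^{(b)}=\exp(\mathrm{ad}\,e^{(b)}_0)\exp\bigl(-\tfrac{2}{(\alpha^{(b)},\alpha^{(b)})}\mathrm{ad}\,f^{(b)}_0\bigr)\exp(\mathrm{ad}\,e^{(b)}_0)$. Let $\alpha$ be a positive real root and write $\alpha=s^{(b_1)}\cdots s^{(b_p)}(\alpha^{(i)})$ with $p\ge0$, even nodes $b_1,\dots,b_p$ and a node $i$. Put $e^{(\alpha)}=\tau^{(b_1)}\cdots\tau^{(b_p)}(e^{(i)}_0)$, $f^{(\alpha)}=\tau^{(b_1)}\cdots\tau^{(b_p)}(f^{(i)}_0)$, $J(e^{(\alpha)})=\tau^{(b_1)}\cdots\tau^{(b_p)}(J(e^{(i)}_0))$, $J(f^{(\alpha)})=\tau^{(b_1)}\cdots\tau^{(b_p)}(J(f^{(i)}_0))$. **Proposition.** These four elements are well defined (all the exponential series that occur are finite), and for every positive real root $\alpha$ so written and every node $a$ there is $c^{a\alpha}\in\frac{\epsilon_1-\epsilon_2}2\mathbb Z$ (which may depend on the chosen $i,b_1,\dots,b_p$) such that $$[J(\psi^{(a)}_0),e^{(\alpha)}]=[\psi^{(a)}_0,J(e^{(\alpha)})]+c^{a\alpha}e^{(\alpha)}=(\alpha^{(a)},\alpha)J(e^{(\alpha)})+c^{a\alpha}e^{(\alpha)},$$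 $$[J(\psi^{(a)}_0),f^{(\alpha)}]=[\psi^{(a)}_0,J(f^{(\alpha)})]-c^{a\alpha}f^{(\alpha)}=-(\alpha^{(a)},\alpha)J(f^{(\alpha)})-c^{a\alpha}f^{(\alpha)}.$$ -/

import Mathlib

noncomputable section

open scoped LaurentPolynomial

namespace QuiverYangian

/-- The super bracket `x y - (-1)^{|x||y|} y x` of two elements of parities `p` and `q`. -/
def sbr {R : Type*} [Ring R] (p q : ZMod 2) (x y : R) : R :=
  x * y - (if p = 1 ∧ q = 1 then (-1 : ℤ) else 1) • (y * x)

/-- A generalized conifold `x y = z^M w^N` with `M + N > 2`, `M N ≠ 2`, `M ≠ N`, in a toric phase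
given by a cyclic sequence of `M` signs `-1` and `N` signs `+1`. -/
structure Conifold where
  M : ℕ
  N : ℕ
  two_lt : 2 < M + N
  mul_ne_two : M * N ≠ 2
  ne : M ≠ N
  sign : ZMod (M + N) → ℤˣ
  ncard_neg : {a | sign a = -1}.ncard = M

namespace Conifold

variable (Q : Conifold)

/-- The nodes of the quiver. -/
abbrev Node : Type := ZMod (Q.M + Q.N)

instance neZero : NeZero (Q.M + Q.N) := ⟨by have := Q.two_lt; omega⟩

/-- A node is even (bosonic) if the two adjacent signs agree. -/
def IsEven (a : Q.Node) : Prop := Q.sign a = Q.sign (a + 1)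

instance (a : Q.Node) : Decidable (Q.IsEven a) := by unfold IsEven; infer_instance

/-- The parity `|a|` of a node. -/
def par (a : Q.Node) : ZMod 2 := if Q.IsEven a then 0 else 1

/-- The symmetrized Cartan matrix `(α⁽ᵃ⁾, α⁽ᵇ⁾)`. -/
def cartan (a b : Q.Node) : ℤ :=
  if a = b then -((Q.sign a : ℤ) + (Q.sign (a + 1) : ℤ))
  else if b = a + 1 then (Q.sign b : ℤ)
  else if a = b + 1 then (Q.sign a : ℤ)
  else 0

/-- `σ₁ᵃᵇ`, the sum of the charges of the arrows from `a` to `b`.  An even node `a` carries a loop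
of charge `ς_a ε₃`, where `ε₁ + ε₂ + ε₃ = 0`; the arrows `a → a + 1` and `a + 1 → a` have charges
`ε₂, ε₁` if `ς_{a+1} = 1` and `-ε₁, -ε₂` if `ς_{a+1} = -1`. -/
def sigma (ε₁ ε₂ : ℂ) (a b : Q.Node) : ℂ :=
  if a = b then (if Q.IsEven a then ((Q.sign a : ℤ) : ℂ) * (-ε₁ - ε₂) else 0)
  else if b = a + 1 then (if Q.sign b = 1 then ε₂ else -ε₁)
  else if a = b + 1 then (if Q.sign a = 1 then ε₁ else -ε₂)
  else 0

/-! ### The root lattice -/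

/-- The root lattice, with coordinates with respect to the simple roots. -/
abbrev Lattice : Type := Q.Node → ℤ

/-- The simple root `α⁽ᵃ⁾`. -/
def simpleRoot (a : Q.Node) : Q.Lattice := Pi.single a 1

/-- The bilinear form on the root lattice. -/
def rootForm (α β : Q.Lattice) : ℤ := ∑ a, ∑ b, α a * β b * Q.cartan a b

/-- The parity of an element of the root lattice. -/
def rootPar (α : Q.Lattice) : ZMod 2 := ∑ a, (α a : ZMod 2) * Q.par a

/-- The even reflection `s⁽ᵇ⁾`, for an even node `b` (so that `(α⁽ᵇ⁾, α⁽ᵇ⁾) = ±2`). -/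
def reflect (b : Q.Node) (β : Q.Lattice) : Q.Lattice :=
  β - (2 * Q.rootForm (Q.simpleRoot b) β / Q.cartan b b) • Q.simpleRoot b

/-- The composite reflection `s⁽ᵇ¹⁾ ⋯ s⁽ᵇᵖ⁾`. -/
def reflectWord (bs : List Q.Node) (β : Q.Lattice) : Q.Lattice := bs.foldr Q.reflect β

/-- The positive roots of the Lie superalgebra obtained by deleting the node `0`:
`α⁽ⁱ⁾ + ⋯ + α⁽ʲ⁾` for `1 ≤ i ≤ j ≤ M + N - 1`. -/
def finitePosRoots : Set Q.Lattice :=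
  {α | ∃ i j : ℕ, 1 ≤ i ∧ i ≤ j ∧ j < Q.M + Q.N ∧
    α = fun a => if i ≤ a.val ∧ a.val ≤ j then 1 else 0}

/-- The minimal positive imaginary root. -/
def delta : Q.Lattice := fun _ => 1

/-- The positive real roots: the positive roots of the finite part, and `m δ + β` for `m ≥ 1` and
`β` a root of the finite part. -/
def posRealRoots : Set Q.Lattice :=
  Q.finitePosRoots ∪
    {α | ∃ m : ℕ, 1 ≤ m ∧ ∃ β : Q.Lattice, (β ∈ Q.finitePosRoots ∨ -β ∈ Q.finitePosRoots) ∧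
      α = m • Q.delta + β}

/-! ### The affine Kac–Moody superalgebra -/

/-- Chevalley generators. -/
inductive ChevGen (V : Type) : Type
  | e (a : V)
  | f (a : V)
  | h (a : V)

/-- The Chevalley–Serre relations, as relations in the free associative algebra. -/
inductive ChevRel : FreeAlgebra ℂ (ChevGen Q.Node) → FreeAlgebra ℂ (ChevGen Q.Node) → Prop
  | hh (a b) : ChevRel (sbr 0 0 (.ι ℂ (.h a)) (.ι ℂ (.h b))) 0
  | ef (a b) : ChevRel (sbr (Q.par a) (Q.par b) (.ι ℂ (.e a)) (.ι ℂ (.f b)))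
      (if a = b then .ι ℂ (.h a) else 0)
  | he (a b) : ChevRel (sbr 0 (Q.par b) (.ι ℂ (.h a)) (.ι ℂ (.e b)))
      ((Q.cartan a b : ℂ) • .ι ℂ (.e b))
  | hf (a b) : ChevRel (sbr 0 (Q.par b) (.ι ℂ (.h a)) (.ι ℂ (.f b)))
      (-((Q.cartan a b : ℂ) • .ι ℂ (.f b)))
  | ee (a b) : Q.cartan a b = 0 →
      ChevRel (sbr (Q.par a) (Q.par b) (.ι ℂ (.e a)) (.ι ℂ (.e b))) 0
  | ff (a b) : Q.cartan a b = 0 →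
      ChevRel (sbr (Q.par a) (Q.par b) (.ι ℂ (.f a)) (.ι ℂ (.f b))) 0
  | serreE (a b) : Q.IsEven a → b = a + 1 ∨ b = a - 1 →
      ChevRel (sbr (Q.par a) (Q.par a + Q.par b) (.ι ℂ (.e a))
        (sbr (Q.par a) (Q.par b) (.ι ℂ (.e a)) (.ι ℂ (.e b)))) 0
  | serreF (a b) : Q.IsEven a → b = a + 1 ∨ b = a - 1 →
      ChevRel (sbr (Q.par a) (Q.par a + Q.par b) (.ι ℂ (.f a))
        (sbr (Q.par a) (Q.par b) (.ι ℂ (.f a)) (.ι ℂ (.f b)))) 0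
  | oddSerreE (a) : ¬ Q.IsEven a →
      ChevRel (sbr (Q.par a) (Q.par (a + 1) + (Q.par a + Q.par (a - 1))) (.ι ℂ (.e a))
        (sbr (Q.par (a + 1)) (Q.par a + Q.par (a - 1)) (.ι ℂ (.e (a + 1)))
          (sbr (Q.par a) (Q.par (a - 1)) (.ι ℂ (.e a)) (.ι ℂ (.e (a - 1)))))) 0
  | oddSerreF (a) : ¬ Q.IsEven a →
      ChevRel (sbr (Q.par a) (Q.par (a + 1) + (Q.par a + Q.par (a - 1))) (.ι ℂ (.f a))
        (sbr (Q.par (a + 1)) (Q.par a + Q.par (a - 1)) (.ι ℂ (.f (a + 1)))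
          (sbr (Q.par a) (Q.par (a - 1)) (.ι ℂ (.f a)) (.ι ℂ (.f (a - 1)))))) 0

/-- The enveloping algebra `U(𝔤)` of the Kac–Moody superalgebra `𝔤` of type `A⁽¹⁾_{M-1,N-1}`
with simple roots of the given parities; `𝔤` is the Lie sub-superalgebra generated by the
Chevalley generators. -/
abbrev UEnv : Type := RingQuot Q.ChevRel

/-- The Chevalley generators `x₊⁽ᵃ⁾`, `x₋⁽ᵃ⁾`, `h⁽ᵃ⁾` in `U(𝔤)`. -/
def uGen (x : ChevGen Q.Node) : Q.UEnv := RingQuot.mkAlgHom ℂ Q.ChevRel (.ι ℂ x)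

/-- The element `α⁽ᵃ¹⁾ + ⋯ + α⁽ᵃˡ⁾` of the root lattice, for a list of nodes. -/
def wt (w : List Q.Node) : Q.Lattice := (w.map Q.simpleRoot).sum

/-- The iterated super bracket `[x_{a₁}, [x_{a₂}, [⋯, x_{aₗ}]]]` of elements `x_a` having the
parities of the nodes. -/
def nest {R : Type*} [Ring R] (x : Q.Node → R) : List Q.Node → R
  | [] => 0
  | [a] => x a
  | a :: b :: w => sbr (Q.par a) (Q.rootPar (Q.wt (b :: w))) (x a) (nest x (b :: w))

/-- The root space `𝔤_α` of `𝔤`, for `α` a sum of simple roots. -/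
def rootSpacePos (α : Q.Lattice) : Submodule ℂ Q.UEnv :=
  Submodule.span ℂ {x | ∃ w, Q.wt w = α ∧ x = Q.nest (fun a => Q.uGen (.e a)) w}

/-- The root space `𝔤_{-α}` of `𝔤`, for `α` a sum of simple roots. -/
def rootSpaceNeg (α : Q.Lattice) : Submodule ℂ Q.UEnv :=
  Submodule.span ℂ {x | ∃ w, Q.wt w = α ∧ x = Q.nest (fun a => Q.uGen (.f a)) w}

/-- The positive roots of `𝔤`. -/
abbrev PosRoot : Type := {α : Q.Lattice // Q.rootSpacePos α ≠ ⊥}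

/-! ### The invariant form

The form is pulled back from the supertrace form of the loop superalgebra of `𝔤𝔩(M|N)`: the central
element lies in the kernel of the form on `𝔤`. -/

/-- Square matrices over `ℂ[T, T⁻¹]`; the index `j` is even if `ς_j = -1`, odd if `ς_j = 1`. -/
abbrev Loop : Type := Matrix Q.Node Q.Node ℂ[T;T⁻¹]

/-- The Chevalley generators of the loop superalgebra, the node `0` being the affine one. -/
def loopGen : ChevGen Q.Node → Q.Loop
  | .e a => Matrix.single a (a + 1) (if a = 0 then .T 1 else 1)
  | .f a => Matrix.single (a + 1) a (.C (-((Q.sign a : ℤ) : ℂ)) * if a = 0 then .T (-1) else 1)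
  | .h a => Matrix.single a a (.C (-((Q.sign a : ℤ) : ℂ))) +
      Matrix.single (a + 1) (a + 1) (.C ((Q.sign (a + 1) : ℤ) : ℂ))


theorem card_le : 3 ≤ Q.M + Q.N := Q.two_lt

theorem four_le {a : Q.Node} (ha : ¬ Q.IsEven a) : 4 ≤ Q.M + Q.N := by
  have h1 : 1 ≤ Q.M ∧ 1 ≤ Q.N := by
    have hM := Q.ncard_neg
    have hex : (∃ x, Q.sign x = -1) ∧ (∃ x, Q.sign x = 1) := by
      unfold IsEven at ha
      rcases Int.units_eq_one_or (Q.sign a) with h | h <;>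
        rcases Int.units_eq_one_or (Q.sign (a + 1)) with h' | h' <;>
        simp [h, h'] at ha
      · exact ⟨⟨_, h'⟩, ⟨_, h⟩⟩
      · exact ⟨⟨_, h⟩, ⟨_, h'⟩⟩
    obtain ⟨⟨x, hx⟩, ⟨y, hy⟩⟩ := hex
    constructor
    · rw [← hM]
      exact (Set.ncard_pos (Set.toFinite _)).2 ⟨x, hx⟩
    · have : {a | Q.sign a = -1}.ncard < Nat.card Q.Node :=
        Set.ncard_lt_card (fun h => by
          have : y ∈ {a | Q.sign a = -1} := h ▸ Set.mem_univ y
          simp [hy] at this)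
      rw [Nat.card_zmod] at this
      omega
  by_contra h
  have := Q.two_lt
  have := Q.mul_ne_two
  have h3 : (Q.M = 1 ∧ Q.N = 2) ∨ (Q.M = 2 ∧ Q.N = 1) := by omega
  rcases h3 with ⟨h, h'⟩ | ⟨h, h'⟩ <;> simp [h, h'] at this

theorem natCast_ne_zero {k : ℕ} (hk : 0 < k) (hk' : k < Q.M + Q.N) : (k : Q.Node) ≠ 0 := by
  intro h
  rw [ZMod.natCast_eq_zero_iff] at h
  exact absurd (Nat.le_of_dvd hk h) (by omega)

theorem one_ne : (1 : Q.Node) ≠ 0 := by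
  have := Q.two_lt
  exact_mod_cast Q.natCast_ne_zero (k := 1) (by omega) (by omega)

theorem two_ne : (2 : Q.Node) ≠ 0 := by
  have := Q.two_lt
  exact_mod_cast Q.natCast_ne_zero (k := 2) (by omega) (by omega)

theorem three_ne {a : Q.Node} (ha : ¬ Q.IsEven a) : (3 : Q.Node) ≠ 0 := by
  have := Q.four_le ha
  exact_mod_cast Q.natCast_ne_zero (k := 3) (by omega) (by omega)

theorem sign_cases (a : Q.Node) : Q.sign a = 1 ∨ Q.sign a = -1 := Int.units_eq_one_or _

theorem node_ne (a : Q.Node) : a + 1 ≠ a ∧ a + 1 + 1 ≠ a ∧ a - 1 ≠ a ∧ a - 1 ≠ a + 1 ∧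
    a - 1 + 1 = a :=
  ⟨fun h => Q.one_ne (by linear_combination h), fun h => Q.two_ne (by linear_combination h),
    fun h => Q.one_ne (by linear_combination -h), fun h => Q.two_ne (by linear_combination -h),
    by ring⟩

theorem cartan_eq_zero {a b : Q.Node} (h : Q.cartan a b = 0) : a + 1 ≠ b ∧ b + 1 ≠ a := by
  have h1 := Q.node_ne a
  have h2 := Q.node_ne b
  unfold cartan at h
  constructor
  · rintro rfl
    rw [if_neg h1.1.symm, if_pos rfl] at h
    simp at h
  · rintro rfl
    rw [if_neg h2.1, if_neg h2.2.1.symm, if_pos rfl] at h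
    simp at h

theorem loop_ef (a b : Q.Node) :
    sbr (Q.par a) (Q.par b) (Q.loopGen (.e a)) (Q.loopGen (.f b)) =
      if a = b then Q.loopGen (.h a) else 0 := by
  by_cases hab : a = b
  · subst hab
    have hT : (if a = 0 then (.T 1 : ℂ[T;T⁻¹]) else 1) * (if a = 0 then .T (-1) else 1) = 1 := by
      split_ifs
      · rw [← LaurentPolynomial.T_add]; simp
      · simp
    simp only [sbr, loopGen, Matrix.single_mul_single_same, if_true]
    have e1 : ∀ c : ℂ[T;T⁻¹], (if a = 0 then (.T 1 : ℂ[T;T⁻¹]) else 1) *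
        (c * (if a = 0 then .T (-1) else 1)) = c := fun c => by rw [mul_left_comm, hT, mul_one]
    have e2 : ∀ c : ℂ[T;T⁻¹], (c * (if a = 0 then .T (-1) else 1)) *
        (if a = 0 then (.T 1 : ℂ[T;T⁻¹]) else 1) = c := fun c => by
      rw [mul_comm, mul_left_comm, hT, mul_one]
    rw [e1, e2, sub_eq_add_neg, ← neg_smul, Matrix.smul_single]
    congr 2
    unfold par IsEven
    rcases Q.sign_cases a with h | h <;> rcases Q.sign_cases (a + 1) with h' | h' <;>
      simp [h, h']
  · have : b ≠ a := fun h => hab h.symm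
    simp [sbr, loopGen, hab, this]

theorem loopH (a : Q.Node) : Q.loopGen (.h a) = Matrix.diagonal
    (Pi.single a (.C (-((Q.sign a : ℤ) : ℂ))) + Pi.single (a + 1)
      (.C ((Q.sign (a + 1) : ℤ) : ℂ))) := by
  have := Matrix.diagonal_add (Pi.single a (.C (-((Q.sign a : ℤ) : ℂ))) : Q.Node → ℂ[T;T⁻¹])
    (Pi.single (a + 1) (.C ((Q.sign (a + 1) : ℤ) : ℂ)))
  rw [Matrix.diagonal_single, Matrix.diagonal_single] at this
  exact this

theorem loop_hh (a b : Q.Node) : sbr 0 0 (Q.loopGen (.h a)) (Q.loopGen (.h b)) = 0 := by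
  simp only [sbr, loopH, Matrix.diagonal_mul_diagonal']
  simp [mul_comm]

theorem diag_single {n R : Type*} [Fintype n] [DecidableEq n] [CommRing R] (d : n → R) (i j : n)
    (c : R) (p : ZMod 2) : sbr 0 p (Matrix.diagonal d) (Matrix.single i j c) =
      (d i - d j) • Matrix.single i j c := by
  rw [sbr, if_neg (by simp), one_smul]
  ext k l
  simp only [Matrix.sub_apply, Matrix.diagonal_mul, Matrix.mul_diagonal, Matrix.smul_apply,
    Matrix.single_apply, smul_eq_mul]
  split_ifs with h
  · rw [h.1, h.2]; ring
  · simp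

theorem cartan_diag (a b : Q.Node) :
    ((Pi.single a (.C (-((Q.sign a : ℤ) : ℂ))) + Pi.single (a + 1)
      (.C ((Q.sign (a + 1) : ℤ) : ℂ)) : Q.Node → ℂ[T;T⁻¹]) b) -
    ((Pi.single a (.C (-((Q.sign a : ℤ) : ℂ))) + Pi.single (a + 1)
      (.C ((Q.sign (a + 1) : ℤ) : ℂ)) : Q.Node → ℂ[T;T⁻¹]) (b + 1)) =
    .C (Q.cartan a b : ℂ) := by
  have h1 := Q.node_ne a
  have h2 := Q.node_ne b
  simp only [Pi.add_apply, Pi.single_apply, cartan]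
  by_cases hab : a = b
  · subst hab
    simp [h1.1.symm, h1.1]
    ring
  · have hba : ¬ b = a := fun h => hab h.symm
    have h3 : ¬ b + 1 = a + 1 := fun h => hba (add_right_cancel h)
    by_cases h4 : b = a + 1
    · subst h4
      simp [h1.1.symm, h1.1, h1.2.1, Q.one_ne]
    · by_cases h5 : a = b + 1
      · subst h5
        simp [h2.1.symm, h2.1, h2.2.1.symm, Q.one_ne]
      · have h6 : ¬ b + 1 = a := fun h => h5 h.symm
        simp [*]

theorem loop_he (a b : Q.Node) : sbr 0 (Q.par b) (Q.loopGen (.h a)) (Q.loopGen (.e b)) =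
    (Q.cartan a b : ℂ) • Q.loopGen (.e b) := by
  rw [loopH, loopGen, diag_single, cartan_diag, Matrix.smul_single, Matrix.smul_single,
    smul_eq_mul, LaurentPolynomial.smul_eq_C_mul]

theorem loop_hf (a b : Q.Node) : sbr 0 (Q.par b) (Q.loopGen (.h a)) (Q.loopGen (.f b)) =
    -((Q.cartan a b : ℂ) • Q.loopGen (.f b)) := by
  rw [loopH, loopGen, diag_single, ← neg_sub, cartan_diag, neg_smul, Matrix.smul_single,
    Matrix.smul_single, smul_eq_mul, LaurentPolynomial.smul_eq_C_mul]

theorem loop_ee (a b : Q.Node) (hab : Q.cartan a b = 0) :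
    sbr (Q.par a) (Q.par b) (Q.loopGen (.e a)) (Q.loopGen (.e b)) = 0 := by
  have := Q.cartan_eq_zero hab
  simp [sbr, loopGen, this]

theorem loop_ff (a b : Q.Node) (hab : Q.cartan a b = 0) :
    sbr (Q.par a) (Q.par b) (Q.loopGen (.f a)) (Q.loopGen (.f b)) = 0 := by
  have := Q.cartan_eq_zero hab
  simp [sbr, loopGen, this.1.symm, this.2.symm]

theorem sbr_serre {R : Type*} [Ring R] {x y : R} (p q r s : ZMod 2) (h : x * x = 0)
    (h' : x * (y * x) = 0) : sbr p q x (sbr r s x y) = 0 := by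
  have h1 : ∀ z, x * (x * z) = 0 := fun z => by rw [← mul_assoc, h, zero_mul]
  simp only [sbr, mul_sub, sub_mul, mul_smul_comm, smul_mul_assoc, mul_assoc, h, h', h1]
  simp

theorem sbr_oddSerre {R : Type*} [Ring R] {x y z : R} (p q r s t u : ZMod 2) (h : x * x = 0)
    (h' : (y * x = 0 ∧ x * z = 0 ∧ y * z = 0) ∨ (x * y = 0 ∧ z * x = 0 ∧ z * y = 0)) :
    sbr p q x (sbr r s y (sbr t u x z)) = 0 := by
  have key : ∀ v w : R, v * w = 0 → ∀ k, v * (w * k) = 0 := fun v w e k => by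
    rw [← mul_assoc, e, zero_mul]
  rcases h' with ⟨h1, h2, h3⟩ | ⟨h1, h2, h3⟩ <;>
  · simp only [sbr, mul_sub, sub_mul, mul_smul_comm, smul_mul_assoc, mul_assoc, h1, h2, h3,
      key _ _ h, key _ _ h1, key _ _ h2, key _ _ h3]
    simp

theorem loop_serreE (a b : Q.Node) (hb : b = a + 1 ∨ b = a - 1) (p q r s : ZMod 2) :
    sbr p q (Q.loopGen (.e a)) (sbr r s (Q.loopGen (.e a)) (Q.loopGen (.e b))) = 0 := by
  have h1 := Q.node_ne a
  apply sbr_serre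
  · simp [loopGen, h1.1]
  · rcases hb with rfl | rfl
    · simp [loopGen, h1.2.1]
    · simp [loopGen, h1.2.2.2.1.symm]

theorem loop_serreF (a b : Q.Node) (hb : b = a + 1 ∨ b = a - 1) (p q r s : ZMod 2) :
    sbr p q (Q.loopGen (.f a)) (sbr r s (Q.loopGen (.f a)) (Q.loopGen (.f b))) = 0 := by
  have h1 := Q.node_ne a
  apply sbr_serre
  · simp [loopGen, h1.1.symm]
  · rcases hb with rfl | rfl
    · simp [loopGen, h1.2.1.symm]
    · simp [loopGen, h1.2.2.2.1]

theorem loop_oddSerreE (a : Q.Node) (ha : ¬ Q.IsEven a) (p q r s t u : ZMod 2) :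
    sbr p q (Q.loopGen (.e a)) (sbr r s (Q.loopGen (.e (a + 1)))
      (sbr t u (Q.loopGen (.e a)) (Q.loopGen (.e (a - 1))))) = 0 := by
  have h1 := Q.node_ne a
  have h3 : a + 1 + 1 ≠ a - 1 := fun h => Q.three_ne ha (by linear_combination h)
  apply sbr_oddSerre
  · simp [loopGen, h1.1]
  · left
    simp [loopGen, h1.2.1, h1.2.2.2.1.symm, h3]

theorem loop_oddSerreF (a : Q.Node) (ha : ¬ Q.IsEven a) (p q r s t u : ZMod 2) :
    sbr p q (Q.loopGen (.f a)) (sbr r s (Q.loopGen (.f (a + 1)))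
      (sbr t u (Q.loopGen (.f a)) (Q.loopGen (.f (a - 1))))) = 0 := by
  have h1 := Q.node_ne a
  have h3 : a - 1 ≠ a + 1 + 1 := fun h => Q.three_ne ha (by linear_combination -h)
  apply sbr_oddSerre
  · simp [loopGen, h1.1.symm]
  · right
    simp [loopGen, h1.2.1.symm, h1.2.2.2.1, h3]

theorem map_sbr {R S : Type*} [Ring R] [Ring S] [Algebra ℂ R] [Algebra ℂ S] (φ : R →ₐ[ℂ] S)
    (p q : ZMod 2) (x y : R) : φ (sbr p q x y) = sbr p q (φ x) (φ y) := by
  simp only [sbr, map_sub, map_mul, map_zsmul]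

/-- The homomorphism from `U(𝔤)` to the matrices over `ℂ[T, T⁻¹]`, whose restriction to `𝔤` is the
quotient map by the centre onto the loop superalgebra of `𝔰𝔩(M|N)`. -/
def toLoop : Q.UEnv →ₐ[ℂ] Q.Loop :=
  RingQuot.liftAlgHom ℂ ⟨FreeAlgebra.lift ℂ Q.loopGen, by
    intro x y h
    cases h with
    | hh a b => simpa only [map_sbr, FreeAlgebra.lift_ι_apply, map_zero] using Q.loop_hh a b
    | ef a b =>
      have := Q.loop_ef a b
      split_ifs at this ⊢ with hab <;>
        simpa only [map_sbr, FreeAlgebra.lift_ι_apply, map_zero] using this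
    | he a b => simpa only [map_sbr, FreeAlgebra.lift_ι_apply, map_smul] using Q.loop_he a b
    | hf a b =>
      simpa only [map_sbr, FreeAlgebra.lift_ι_apply, map_smul, map_neg] using Q.loop_hf a b
    | ee a b h => simpa only [map_sbr, FreeAlgebra.lift_ι_apply, map_zero] using Q.loop_ee a b h
    | ff a b h => simpa only [map_sbr, FreeAlgebra.lift_ι_apply, map_zero] using Q.loop_ff a b h
    | serreE a b _ hb =>
      simpa only [map_sbr, FreeAlgebra.lift_ι_apply, map_zero] using Q.loop_serreE a b hb _ _ _ _
    | serreF a b _ hb =>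
      simpa only [map_sbr, FreeAlgebra.lift_ι_apply, map_zero] using Q.loop_serreF a b hb _ _ _ _
    | oddSerreE a ha =>
      simpa only [map_sbr, FreeAlgebra.lift_ι_apply, map_zero] using
        Q.loop_oddSerreE a ha _ _ _ _ _ _
    | oddSerreF a ha =>
      simpa only [map_sbr, FreeAlgebra.lift_ι_apply, map_zero] using
        Q.loop_oddSerreF a ha _ _ _ _ _ _⟩

/-- The invariant bilinear form on `𝔤`: the constant coefficient of the supertrace of the product
of the images in the loop superalgebra. -/
def invForm (x y : Q.UEnv) : ℂ :=
  (∑ j, ((-(Q.sign j : ℤ) : ℤ) : ℂ) • (Q.toLoop x * Q.toLoop y) j j).coeff 0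

theorem toLoop_uGen (x : ChevGen Q.Node) : Q.toLoop (Q.uGen x) = Q.loopGen x := by
  simp [toLoop, uGen]

/-- The normalization `(x₊⁽ᵃ⁾, x₋⁽ᵃ⁾) = 1`. -/
theorem invForm_ef (a : Q.Node) : Q.invForm (Q.uGen (.e a)) (Q.uGen (.f a)) = 1 := by
  have hT : (if a = 0 then (.T 1 : ℂ[T;T⁻¹]) else 1) * (if a = 0 then .T (-1) else 1) = 1 := by
    split_ifs
    · rw [← LaurentPolynomial.T_add]; simp
    · simp
  have hs : (((-(Q.sign a : ℤ) : ℤ) : ℂ)) * (-((Q.sign a : ℤ) : ℂ)) = 1 := by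
    rcases Q.sign_cases a with h | h <;> simp [h]
  simp only [invForm, toLoop_uGen, loopGen, Matrix.single_mul_single_same]
  rw [mul_left_comm, hT, mul_one, Finset.sum_eq_single a]
  · rw [Matrix.single_apply_same, LaurentPolynomial.smul_eq_C_mul, ← map_mul, hs, map_one]
    rw [AddMonoidAlgebra.one_def, AddMonoidAlgebra.coeff_single, Finsupp.single_eq_same]
  · intro j _ hj
    simp [hj.symm]
  · simp

/-! ### The quiver Yangian -/

/-- Generators `e⁽ᵃ⁾ₙ`, `f⁽ᵃ⁾ₙ`, `ψ⁽ᵃ⁾ₙ`. -/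
inductive Gen (V : Type) : Type
  | e (a : V) (n : ℕ)
  | f (a : V) (n : ℕ)
  | psi (a : V) (n : ℕ)

/-- The defining relations of the (reduced) quiver Yangian.  The relations `psiE₀`, `psiF₀` are the
case `n = -1` of `psiE`, `psiF` with `ψ⁽ᵃ⁾₋₁ = 1/(ε₁ + ε₂)`, since
`σ₁ᵃᵇ + σ₁ᵇᵃ = (ε₁ + ε₂) (α⁽ᵃ⁾, α⁽ᵇ⁾)`. -/
inductive Rel (ε₁ ε₂ : ℂ) :
    FreeAlgebra ℂ (Gen Q.Node) → FreeAlgebra ℂ (Gen Q.Node) → Prop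
  | psiPsi (a b n m) : Rel ε₁ ε₂ (sbr 0 0 (.ι ℂ (.psi a n)) (.ι ℂ (.psi b m))) 0
  | ef (a b n m) : Rel ε₁ ε₂ (sbr (Q.par a) (Q.par b) (.ι ℂ (.e a n)) (.ι ℂ (.f b m)))
      (if a = b then .ι ℂ (.psi a (m + n)) else 0)
  | psiE₀ (a b m) : Rel ε₁ ε₂ (sbr 0 (Q.par b) (.ι ℂ (.psi a 0)) (.ι ℂ (.e b m)))
      ((Q.cartan a b : ℂ) • .ι ℂ (.e b m))
  | psiF₀ (a b m) : Rel ε₁ ε₂ (sbr 0 (Q.par b) (.ι ℂ (.psi a 0)) (.ι ℂ (.f b m)))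
      (-((Q.cartan a b : ℂ) • .ι ℂ (.f b m)))
  | psiE (a b n m) : Rel ε₁ ε₂
      (sbr 0 (Q.par b) (.ι ℂ (.psi a (n + 1))) (.ι ℂ (.e b m)) -
        sbr 0 (Q.par b) (.ι ℂ (.psi a n)) (.ι ℂ (.e b (m + 1))))
      (Q.sigma ε₁ ε₂ b a • (.ι ℂ (.psi a n) * .ι ℂ (.e b m)) +
        Q.sigma ε₁ ε₂ a b • (.ι ℂ (.e b m) * .ι ℂ (.psi a n)))
  | psiF (a b n m) : Rel ε₁ ε₂
      (sbr 0 (Q.par b) (.ι ℂ (.psi a (n + 1))) (.ι ℂ (.f b m)) -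
        sbr 0 (Q.par b) (.ι ℂ (.psi a n)) (.ι ℂ (.f b (m + 1))))
      (-(Q.sigma ε₁ ε₂ a b • (.ι ℂ (.psi a n) * .ι ℂ (.f b m))) -
        Q.sigma ε₁ ε₂ b a • (.ι ℂ (.f b m) * .ι ℂ (.psi a n)))
  | ee₀ (a b n m) : Q.sigma ε₁ ε₂ a b = 0 →
      Rel ε₁ ε₂ (sbr (Q.par a) (Q.par b) (.ι ℂ (.e a n)) (.ι ℂ (.e b m))) 0
  | ff₀ (a b n m) : Q.sigma ε₁ ε₂ a b = 0 →
      Rel ε₁ ε₂ (sbr (Q.par a) (Q.par b) (.ι ℂ (.f a n)) (.ι ℂ (.f b m))) 0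
  | ee (a b n m) : Q.sigma ε₁ ε₂ a b ≠ 0 → Rel ε₁ ε₂
      (sbr (Q.par a) (Q.par b) (.ι ℂ (.e a (n + 1))) (.ι ℂ (.e b m)) -
        sbr (Q.par a) (Q.par b) (.ι ℂ (.e a n)) (.ι ℂ (.e b (m + 1))))
      (Q.sigma ε₁ ε₂ b a • (.ι ℂ (.e a n) * .ι ℂ (.e b m)) +
        ((if Q.par a = 1 ∧ Q.par b = 1 then -1 else 1) * Q.sigma ε₁ ε₂ a b) •
          (.ι ℂ (.e b m) * .ι ℂ (.e a n)))
  | ff (a b n m) : Q.sigma ε₁ ε₂ a b ≠ 0 → Rel ε₁ ε₂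
      (sbr (Q.par a) (Q.par b) (.ι ℂ (.f a (n + 1))) (.ι ℂ (.f b m)) -
        sbr (Q.par a) (Q.par b) (.ι ℂ (.f a n)) (.ι ℂ (.f b (m + 1))))
      (-(Q.sigma ε₁ ε₂ a b • (.ι ℂ (.f a n) * .ι ℂ (.f b m))) -
        ((if Q.par a = 1 ∧ Q.par b = 1 then -1 else 1) * Q.sigma ε₁ ε₂ b a) •
          (.ι ℂ (.f b m) * .ι ℂ (.f a n)))
  | serreE (a b n₁ n₂ m) : Q.IsEven a → b = a + 1 ∨ b = a - 1 → Rel ε₁ ε₂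
      (sbr (Q.par a) (Q.par a + Q.par b) (.ι ℂ (.e a n₁))
          (sbr (Q.par a) (Q.par b) (.ι ℂ (.e a n₂)) (.ι ℂ (.e b m))) +
        sbr (Q.par a) (Q.par a + Q.par b) (.ι ℂ (.e a n₂))
          (sbr (Q.par a) (Q.par b) (.ι ℂ (.e a n₁)) (.ι ℂ (.e b m)))) 0
  | serreF (a b n₁ n₂ m) : Q.IsEven a → b = a + 1 ∨ b = a - 1 → Rel ε₁ ε₂
      (sbr (Q.par a) (Q.par a + Q.par b) (.ι ℂ (.f a n₁))
          (sbr (Q.par a) (Q.par b) (.ι ℂ (.f a n₂)) (.ι ℂ (.f b m))) +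
        sbr (Q.par a) (Q.par a + Q.par b) (.ι ℂ (.f a n₂))
          (sbr (Q.par a) (Q.par b) (.ι ℂ (.f a n₁)) (.ι ℂ (.f b m)))) 0
  | oddSerreE (a n₁ n₂ m₁ m₂) : ¬ Q.IsEven a → Rel ε₁ ε₂
      (sbr (Q.par a) (Q.par (a + 1) + (Q.par a + Q.par (a - 1))) (.ι ℂ (.e a n₁))
          (sbr (Q.par (a + 1)) (Q.par a + Q.par (a - 1)) (.ι ℂ (.e (a + 1) m₁))
            (sbr (Q.par a) (Q.par (a - 1)) (.ι ℂ (.e a n₂)) (.ι ℂ (.e (a - 1) m₂)))) +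
        sbr (Q.par a) (Q.par (a + 1) + (Q.par a + Q.par (a - 1))) (.ι ℂ (.e a n₂))
          (sbr (Q.par (a + 1)) (Q.par a + Q.par (a - 1)) (.ι ℂ (.e (a + 1) m₁))
            (sbr (Q.par a) (Q.par (a - 1)) (.ι ℂ (.e a n₁)) (.ι ℂ (.e (a - 1) m₂))))) 0
  | oddSerreF (a n₁ n₂ m₁ m₂) : ¬ Q.IsEven a → Rel ε₁ ε₂
      (sbr (Q.par a) (Q.par (a + 1) + (Q.par a + Q.par (a - 1))) (.ι ℂ (.f a n₁))
          (sbr (Q.par (a + 1)) (Q.par a + Q.par (a - 1)) (.ι ℂ (.f (a + 1) m₁))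
            (sbr (Q.par a) (Q.par (a - 1)) (.ι ℂ (.f a n₂)) (.ι ℂ (.f (a - 1) m₂)))) +
        sbr (Q.par a) (Q.par (a + 1) + (Q.par a + Q.par (a - 1))) (.ι ℂ (.f a n₂))
          (sbr (Q.par (a + 1)) (Q.par a + Q.par (a - 1)) (.ι ℂ (.f (a + 1) m₁))
            (sbr (Q.par a) (Q.par (a - 1)) (.ι ℂ (.f a n₁)) (.ι ℂ (.f (a - 1) m₂))))) 0

variable (ε₁ ε₂ : ℂ)

/-- The quiver Yangian `Y`. -/
def Yangian : Type := RingQuot (Q.Rel ε₁ ε₂)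

instance : Ring (Q.Yangian ε₁ ε₂) := inferInstanceAs (Ring (RingQuot (Q.Rel ε₁ ε₂)))

instance : Algebra ℂ (Q.Yangian ε₁ ε₂) := inferInstanceAs (Algebra ℂ (RingQuot (Q.Rel ε₁ ε₂)))

/-- The quotient map from the free algebra. -/
def mkY : FreeAlgebra ℂ (Gen Q.Node) →ₐ[ℂ] Q.Yangian ε₁ ε₂ := RingQuot.mkAlgHom ℂ (Q.Rel ε₁ ε₂)

/-- `e⁽ᵃ⁾ₙ` -/
def e (a : Q.Node) (n : ℕ) : Q.Yangian ε₁ ε₂ := Q.mkY ε₁ ε₂ (.ι ℂ (.e a n))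

/-- `f⁽ᵃ⁾ₙ` -/
def f (a : Q.Node) (n : ℕ) : Q.Yangian ε₁ ε₂ := Q.mkY ε₁ ε₂ (.ι ℂ (.f a n))

/-- `ψ⁽ᵃ⁾ₙ` -/
def psi (a : Q.Node) (n : ℕ) : Q.Yangian ε₁ ε₂ := Q.mkY ε₁ ε₂ (.ι ℂ (.psi a n))

variable {ε₁ ε₂} in
theorem mkY_rel {x y} (h : Q.Rel ε₁ ε₂ x y) : Q.mkY ε₁ ε₂ x = Q.mkY ε₁ ε₂ y :=
  RingQuot.mkAlgHom_rel ℂ h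

theorem sigma_eq_zero {a b : Q.Node} (h : Q.cartan a b = 0) : Q.sigma ε₁ ε₂ a b = 0 := by
  have h1 := Q.cartan_eq_zero h
  unfold sigma
  unfold cartan at h
  rw [if_neg h1.1.symm, if_neg h1.2.symm] at h ⊢
  split_ifs at h ⊢ with h2 h3
  · exfalso
    unfold IsEven at h3
    rw [← h3] at h
    rcases Q.sign_cases a with h4 | h4 <;> simp [h4] at h
  · rfl
  · rfl

/-- The images of the Chevalley generators in the quiver Yangian. -/
def chevImage : ChevGen Q.Node → Q.Yangian ε₁ ε₂
  | .e a => Q.e ε₁ ε₂ a 0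
  | .f a => Q.f ε₁ ε₂ a 0
  | .h a => Q.psi ε₁ ε₂ a 0

theorem eq_zero_of_add_self {R : Type*} [Ring R] [Algebra ℂ R] {x : R} (h : x + x = 0) :
    x = 0 := by
  have h2 : (2 : ℂ) • x = 0 := by rw [two_smul, h]
  exact (smul_eq_zero_iff_right two_ne_zero).1 h2

/-- The homomorphism `ι : U(𝔤) → Y` onto the zero modes. -/
def iota : Q.UEnv →ₐ[ℂ] Q.Yangian ε₁ ε₂ :=
  RingQuot.liftAlgHom ℂ ⟨FreeAlgebra.lift ℂ (Q.chevImage ε₁ ε₂), by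
    intro x y h
    cases h with
    | hh a b =>
      simpa only [map_sbr, FreeAlgebra.lift_ι_apply, chevImage, e, f, psi, map_zero]
        using Q.mkY_rel (.psiPsi a b 0 0)
    | ef a b =>
      have := Q.mkY_rel (ε₁ := ε₁) (ε₂ := ε₂) (.ef a b 0 0)
      split_ifs at this ⊢ with hab <;>
        simpa only [map_sbr, FreeAlgebra.lift_ι_apply, chevImage, e, f, psi, map_zero]
        using this
    | he a b =>
      simpa only [map_sbr, FreeAlgebra.lift_ι_apply, chevImage, e, f, psi, map_smul] using Q.mkY_rel (.psiE₀ a b 0)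
    | hf a b =>
      simpa only [map_sbr, FreeAlgebra.lift_ι_apply, chevImage, e, f, psi, map_smul,
        map_neg] using
        Q.mkY_rel (.psiF₀ a b 0)
    | ee a b h =>
      simpa only [map_sbr, FreeAlgebra.lift_ι_apply, chevImage, e, f, psi, map_zero]
        using
        Q.mkY_rel (.ee₀ a b 0 0 (Q.sigma_eq_zero ε₁ ε₂ h))
    | ff a b h =>
      simpa only [map_sbr, FreeAlgebra.lift_ι_apply, chevImage, e, f, psi, map_zero]
        using
        Q.mkY_rel (.ff₀ a b 0 0 (Q.sigma_eq_zero ε₁ ε₂ h))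
    | serreE a b ha hb =>
      have := Q.mkY_rel (ε₁ := ε₁) (ε₂ := ε₂) (.serreE a b 0 0 0 ha hb)
      rw [map_add, map_zero] at this
      simpa only [map_sbr, FreeAlgebra.lift_ι_apply, chevImage, e, f, psi, map_zero]
        using eq_zero_of_add_self this
    | serreF a b ha hb =>
      have := Q.mkY_rel (ε₁ := ε₁) (ε₂ := ε₂) (.serreF a b 0 0 0 ha hb)
      rw [map_add, map_zero] at this
      simpa only [map_sbr, FreeAlgebra.lift_ι_apply, chevImage, e, f, psi, map_zero]
        using eq_zero_of_add_self this
    | oddSerreE a ha =>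
      have := Q.mkY_rel (ε₁ := ε₁) (ε₂ := ε₂) (.oddSerreE a 0 0 0 0 ha)
      rw [map_add, map_zero] at this
      simpa only [map_sbr, FreeAlgebra.lift_ι_apply, chevImage, e, f, psi, map_zero]
        using eq_zero_of_add_self this
    | oddSerreF a ha =>
      have := Q.mkY_rel (ε₁ := ε₁) (ε₂ := ε₂) (.oddSerreF a 0 0 0 0 ha)
      rw [map_add, map_zero] at this
      simpa only [map_sbr, FreeAlgebra.lift_ι_apply, chevImage, e, f, psi, map_zero]
        using eq_zero_of_add_self this⟩

/-! ### The completion -/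

/-- The left ideal `Y · Y⁺_{≥ n}`, generated by the monomials of length at least `n` in the
`e⁽ᵃ⁾ₖ`. -/
def leftIdeal (n : ℕ) : Submodule (Q.Yangian ε₁ ε₂) (Q.Yangian ε₁ ε₂) :=
  Submodule.span _ {x | ∃ w : List (Q.Node × ℕ), n ≤ w.length ∧
    x = (w.map fun p => Q.e ε₁ ε₂ p.1 p.2).prod}

theorem leftIdeal_anti {m n : ℕ} (h : m ≤ n) : Q.leftIdeal ε₁ ε₂ n ≤ Q.leftIdeal ε₁ ε₂ m :=
  Submodule.span_mono fun _ ⟨w, hw, e⟩ => ⟨w, h.trans hw, e⟩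

theorem leftIdeal_zero : Q.leftIdeal ε₁ ε₂ 0 = ⊤ := by
  rw [Submodule.eq_top_iff']
  intro x
  have : (1 : Q.Yangian ε₁ ε₂) ∈ Q.leftIdeal ε₁ ε₂ 0 :=
    Submodule.subset_span ⟨[], le_rfl, by simp⟩
  simpa using Submodule.smul_mem _ x this

theorem leftIdeal_mul_e {n : ℕ} {x : Q.Yangian ε₁ ε₂} (hx : x ∈ Q.leftIdeal ε₁ ε₂ n)
    (a : Q.Node) (k : ℕ) : x * Q.e ε₁ ε₂ a k ∈ Q.leftIdeal ε₁ ε₂ (n + 1) := by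
  induction hx using Submodule.span_induction with
  | mem x h =>
    obtain ⟨w, hw, rfl⟩ := h
    exact Submodule.subset_span ⟨w ++ [(a, k)], by simpa using hw, by simp⟩
  | zero => simp
  | add x y _ _ hx hy => rw [add_mul]; exact Submodule.add_mem _ hx hy
  | smul c x _ hx => rw [smul_mul_assoc]; exact Submodule.smul_mem _ c hx

/-- Every element of the `(n + 1)`-st ideal is a sum of products of an element of the `n`-th
ideal and a generator `e`. -/
theorem leftIdeal_induction {n : ℕ} {p : Q.Yangian ε₁ ε₂ → Prop} (h0 : p 0)
    (hadd : ∀ x y, p x → p y → p (x + y))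
    (hmul : ∀ x ∈ Q.leftIdeal ε₁ ε₂ n, ∀ a k, p (x * Q.e ε₁ ε₂ a k))
    {x : Q.Yangian ε₁ ε₂} (hx : x ∈ Q.leftIdeal ε₁ ε₂ (n + 1)) : p x := by
  rw [leftIdeal, ← Set.image_id {x | _}] at hx
  induction hx using Submodule.closure_induction with
  | zero => exact h0
  | add x y _ _ hx hy => exact hadd x y hx hy
  | smul_mem c x h =>
    obtain ⟨_, ⟨w, hw, rfl⟩, rfl⟩ := h
    rcases List.eq_nil_or_concat w with rfl | ⟨w, q, rfl⟩
    · simp at hw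
    · have : c * (w.map fun p => Q.e ε₁ ε₂ p.1 p.2).prod ∈ Q.leftIdeal ε₁ ε₂ n :=
        Submodule.smul_mem _ c (Submodule.subset_span ⟨w, by simpa using hw, rfl⟩)
      simpa [mul_assoc] using hmul _ this q.1 q.2

theorem leftIdeal_mul_psi (n : ℕ) : ∀ {x : Q.Yangian ε₁ ε₂}, x ∈ Q.leftIdeal ε₁ ε₂ n →
    ∀ a r, x * Q.psi ε₁ ε₂ a r ∈ Q.leftIdeal ε₁ ε₂ n := by
  induction n with
  | zero => intro x _ a r; rw [leftIdeal_zero]; trivial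
  | succ n ih =>
    have key : ∀ r, ∀ x ∈ Q.leftIdeal ε₁ ε₂ n, ∀ b k a,
        x * Q.e ε₁ ε₂ b k * Q.psi ε₁ ε₂ a r ∈ Q.leftIdeal ε₁ ε₂ (n + 1) := by
      intro r
      induction r with
      | zero =>
        intro x hx b k a
        have h := Q.mkY_rel (ε₁ := ε₁) (ε₂ := ε₂) (.psiE₀ a b k)
        rw [map_sbr, map_smul] at h
        change sbr 0 (Q.par b) (Q.psi ε₁ ε₂ a 0) (Q.e ε₁ ε₂ b k) = _ • Q.e ε₁ ε₂ b k at h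
        rw [sbr, if_neg (by simp), one_smul] at h
        have h' : x * Q.e ε₁ ε₂ b k * Q.psi ε₁ ε₂ a 0 = x * Q.psi ε₁ ε₂ a 0 * Q.e ε₁ ε₂ b k -
            (Q.cartan a b : ℂ) • (x * Q.e ε₁ ε₂ b k) := by
          rw [← mul_smul_comm, ← h]; noncomm_ring
        rw [h']
        refine Submodule.sub_mem _ (Q.leftIdeal_mul_e ε₁ ε₂ (ih hx _ _) _ _) ?_
        rw [← smul_mul_assoc, Algebra.smul_def]
        exact Q.leftIdeal_mul_e ε₁ ε₂ (Submodule.smul_mem _ _ hx) _ _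
      | succ r ihr =>
        intro x hx b k a
        have h := Q.mkY_rel (ε₁ := ε₁) (ε₂ := ε₂) (.psiE a b r k)
        simp only [map_sub, map_add, map_sbr, map_smul, map_mul] at h
        change sbr 0 (Q.par b) (Q.psi ε₁ ε₂ a (r + 1)) (Q.e ε₁ ε₂ b k) -
          sbr 0 (Q.par b) (Q.psi ε₁ ε₂ a r) (Q.e ε₁ ε₂ b (k + 1)) =
          _ • (Q.psi ε₁ ε₂ a r * Q.e ε₁ ε₂ b k) + _ • (Q.e ε₁ ε₂ b k * Q.psi ε₁ ε₂ a r) at h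
        simp only [sbr, if_neg (show ¬ ((0 : ZMod 2) = 1 ∧ Q.par b = 1) by simp), one_smul] at h
        have h' : x * Q.e ε₁ ε₂ b k * Q.psi ε₁ ε₂ a (r + 1) =
            x * Q.psi ε₁ ε₂ a (r + 1) * Q.e ε₁ ε₂ b k -
            (x * Q.psi ε₁ ε₂ a r * Q.e ε₁ ε₂ b (k + 1) -
              x * Q.e ε₁ ε₂ b (k + 1) * Q.psi ε₁ ε₂ a r) -
            (algebraMap ℂ _ (Q.sigma ε₁ ε₂ b a) * (x * Q.psi ε₁ ε₂ a r * Q.e ε₁ ε₂ b k) +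
              algebraMap ℂ _ (Q.sigma ε₁ ε₂ a b) * (x * Q.e ε₁ ε₂ b k * Q.psi ε₁ ε₂ a r)) := by
          have h2 := congrArg (x * ·) h
          simp only [mul_add, mul_sub, mul_smul_comm, ← mul_assoc] at h2
          rw [← Algebra.smul_def, ← Algebra.smul_def, ← h2]
          abel
        rw [h']
        have e1 := fun y hy b k => Q.leftIdeal_mul_e ε₁ ε₂ (n := n) (x := y) hy b k
        exact Submodule.sub_mem _ (Submodule.sub_mem _ (e1 _ (ih hx _ _) _ _)
          (Submodule.sub_mem _ (e1 _ (ih hx _ _) _ _) (ihr _ hx _ _ _)))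
          (Submodule.add_mem _ (Submodule.smul_mem _ _ (e1 _ (ih hx _ _) _ _))
            (Submodule.smul_mem _ _ (ihr _ hx _ _ _)))
    intro x hx a r
    refine Q.leftIdeal_induction ε₁ ε₂ (n := n)
      (p := fun x => x * Q.psi ε₁ ε₂ a r ∈ Q.leftIdeal ε₁ ε₂ (n + 1)) (by simp)
      (fun x y hx hy => ?_) (fun x hx b k => key r x hx b k a) hx
    simp only [add_mul]
    exact Submodule.add_mem _ hx hy

theorem leftIdeal_mul_f (n : ℕ) : ∀ {x : Q.Yangian ε₁ ε₂}, x ∈ Q.leftIdeal ε₁ ε₂ (n + 1) →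
    ∀ a r, x * Q.f ε₁ ε₂ a r ∈ Q.leftIdeal ε₁ ε₂ n := by
  induction n with
  | zero => intro x _ a r; rw [leftIdeal_zero]; trivial
  | succ n ih =>
    intro x hx a r
    refine Q.leftIdeal_induction ε₁ ε₂ (n := n + 1)
      (p := fun x => x * Q.f ε₁ ε₂ a r ∈ Q.leftIdeal ε₁ ε₂ (n + 1)) (by simp)
      (fun x y hx hy => ?_) (fun x hx b k => ?_) hx
    · simp only [add_mul]
      exact Submodule.add_mem _ hx hy
    · have h := Q.mkY_rel (ε₁ := ε₁) (ε₂ := ε₂) (.ef b a k r)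
      rw [map_sbr] at h
      change sbr _ _ (Q.e ε₁ ε₂ b k) (Q.f ε₁ ε₂ a r) = _ at h
      rw [sbr, sub_eq_iff_eq_add] at h
      rw [mul_assoc, h, mul_add, mul_smul_comm, ← mul_assoc]
      refine Submodule.add_mem _ ?_ ?_
      · split_ifs
        · exact Q.leftIdeal_mul_psi ε₁ ε₂ _ hx _ _
        · simp
      · exact zsmul_mem (Q.leftIdeal_mul_e ε₁ ε₂ (ih hx _ _) _ _) _

/-- Right multiplication is continuous for the topology defined by the left ideals. -/
theorem leftIdeal_mul_right (y : Q.Yangian ε₁ ε₂) : ∀ n, ∃ m, ∀ x ∈ Q.leftIdeal ε₁ ε₂ m,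
    x * y ∈ Q.leftIdeal ε₁ ε₂ n := by
  obtain ⟨y, rfl⟩ := RingQuot.mkAlgHom_surjective ℂ (Q.Rel ε₁ ε₂) y
  change ∀ n, ∃ m, ∀ x ∈ Q.leftIdeal ε₁ ε₂ m, x * Q.mkY ε₁ ε₂ y ∈ Q.leftIdeal ε₁ ε₂ n
  induction y using FreeAlgebra.induction with
  | grade0 c =>
    intro n
    refine ⟨n, fun x hx => ?_⟩
    rw [AlgHom.commutes, ← Algebra.commutes]
    exact Submodule.smul_mem _ _ hx
  | grade1 g =>
    intro n
    cases g with
    | e a k => exact ⟨n, fun x hx =>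
        Q.leftIdeal_anti ε₁ ε₂ (Nat.le_succ n) (Q.leftIdeal_mul_e ε₁ ε₂ hx a k)⟩
    | f a k => exact ⟨n + 1, fun x hx => Q.leftIdeal_mul_f ε₁ ε₂ n hx a k⟩
    | psi a k => exact ⟨n, fun x hx => Q.leftIdeal_mul_psi ε₁ ε₂ n hx a k⟩
  | mul y z hy hz =>
    intro n
    obtain ⟨m, hm⟩ := hz n
    obtain ⟨l, hl⟩ := hy m
    refine ⟨l, fun x hx => ?_⟩
    rw [map_mul, ← mul_assoc]
    exact hm _ (hl _ hx)
  | add y z hy hz =>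
    intro n
    obtain ⟨m, hm⟩ := hz n
    obtain ⟨l, hl⟩ := hy n
    refine ⟨max l m, fun x hx => ?_⟩
    rw [map_add, mul_add]
    exact Submodule.add_mem _ (hl _ (Q.leftIdeal_anti ε₁ ε₂ (le_max_left _ _) hx))
      (hm _ (Q.leftIdeal_anti ε₁ ε₂ (le_max_right _ _) hx))

theorem leftIdeal_basis :
    RingSubgroupsBasis fun n => (Q.leftIdeal ε₁ ε₂ n).toAddSubgroup where
  inter i j := ⟨max i j, le_inf (Q.leftIdeal_anti ε₁ ε₂ (le_max_left _ _))
    (Q.leftIdeal_anti ε₁ ε₂ (le_max_right _ _))⟩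
  mul i := ⟨i, by
    rintro _ ⟨x, _, y, hy, rfl⟩
    exact Submodule.smul_mem (Q.leftIdeal ε₁ ε₂ i) x hy⟩
  leftMul x i := ⟨i, fun y hy => Submodule.smul_mem (Q.leftIdeal ε₁ ε₂ i) x hy⟩
  rightMul y i := Q.leftIdeal_mul_right ε₁ ε₂ y i

/-- The linear topology of `Y` in which the left ideals `Y · Y⁺_{≥ n}` are a basis of
neighbourhoods of `0`. -/
instance : TopologicalSpace (Q.Yangian ε₁ ε₂) := (Q.leftIdeal_basis ε₁ ε₂).topology

instance : IsTopologicalRing (Q.Yangian ε₁ ε₂) :=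
  (Q.leftIdeal_basis ε₁ ε₂).toRingFilterBasis.isTopologicalRing

instance : NonarchimedeanRing (Q.Yangian ε₁ ε₂) := (Q.leftIdeal_basis ε₁ ε₂).nonarchimedean

instance : UniformSpace (Q.Yangian ε₁ ε₂) := IsTopologicalAddGroup.rightUniformSpace _

instance : IsUniformAddGroup (Q.Yangian ε₁ ε₂) := isUniformAddGroup_of_addCommGroup

instance : UniformContinuousConstSMul ℂ (Q.Yangian ε₁ ε₂) where
  uniformContinuous_const_smul c := by
    have : (fun x : Q.Yangian ε₁ ε₂ => c • x) =
        AddMonoidHom.mulLeft (algebraMap ℂ (Q.Yangian ε₁ ε₂) c) := by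
      ext x; simp [Algebra.smul_def]
    rw [this]
    exact uniformContinuous_addMonoidHom_of_continuous (by
      simpa using continuous_const_mul (algebraMap ℂ (Q.Yangian ε₁ ε₂) c))

/-- The completed quiver Yangian `Ŷ = lim Y / (Y · Y⁺_{≥ n})`. -/
abbrev Completed : Type := UniformSpace.Completion (Q.Yangian ε₁ ε₂)

/-! ### The `J` generators -/

/-- For each positive root `α`, a basis `x₊⁽ᵅ'ᵏ⁾` of the root space `𝔤_α` and the dual basis
`x₋⁽ᵅ'ᵏ⁾` of `𝔤_{-α}`, normalized by `(x₊⁽ᵅ'ᵏ⁾, x₋⁽ᵅ'ˡ⁾) = δ_{kl}`. -/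
structure DualRootBases where
  pos (α : Q.PosRoot) : Module.Basis (Fin (Module.finrank ℂ (Q.rootSpacePos α))) ℂ (Q.rootSpacePos α)
  neg (α : Q.PosRoot) : Module.Basis (Fin (Module.finrank ℂ (Q.rootSpacePos α))) ℂ (Q.rootSpaceNeg α)
  dual (α : Q.PosRoot) (k l) : Q.invForm (pos α k) (neg α l) = if k = l then 1 else 0

variable {Q} in
/-- `e⁽ᵅ'ᵏ⁾ = ι(x₊⁽ᵅ'ᵏ⁾)` -/
def DualRootBases.e (X : Q.DualRootBases) (α : Q.PosRoot)
    (k : Fin (Module.finrank ℂ (Q.rootSpacePos α))) : Q.Yangian ε₁ ε₂ :=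
  Q.iota ε₁ ε₂ (X.pos α k)

variable {Q} in
/-- `f⁽ᵅ'ᵏ⁾ = ι(x₋⁽ᵅ'ᵏ⁾)` -/
def DualRootBases.f (X : Q.DualRootBases) (α : Q.PosRoot)
    (k : Fin (Module.finrank ℂ (Q.rootSpacePos α))) : Q.Yangian ε₁ ε₂ :=
  Q.iota ε₁ ε₂ (X.neg α k)

variable (X : Q.DualRootBases)

/-- The term of `α` in the sum defining `v⁽ᵃ⁾`. -/
def vTerm (a : Q.Node) (α : Q.PosRoot) : Q.Yangian ε₁ ε₂ :=
  (Q.rootForm α (Q.simpleRoot a) : ℂ) • ∑ k, X.f ε₁ ε₂ α k * X.e ε₁ ε₂ α k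

/-- The term of `α` in the sum defining `w₊⁽ᵃ⁾`. -/
def wPosTerm (a : Q.Node) (α : Q.PosRoot) : Q.Yangian ε₁ ε₂ :=
  ∑ k, X.f ε₁ ε₂ α k * sbr (Q.rootPar α) (Q.par a) (X.e ε₁ ε₂ α k) (Q.e ε₁ ε₂ a 0)

/-- The term of `α` in the sum defining `w₋⁽ᵃ⁾`. -/
def wNegTerm (a : Q.Node) (α : Q.PosRoot) : Q.Yangian ε₁ ε₂ :=
  ∑ k, sbr (Q.par a) (Q.rootPar α) (Q.f ε₁ ε₂ a 0) (X.f ε₁ ε₂ α k) * X.e ε₁ ε₂ α k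

theorem nest_mem_leftIdeal (w : List Q.Node) :
    Q.nest (fun a => Q.e ε₁ ε₂ a 0) w ∈ Q.leftIdeal ε₁ ε₂ w.length := by
  have key : ∀ w : List Q.Node, ∀ n, ∀ x ∈ Q.leftIdeal ε₁ ε₂ n,
      x * Q.nest (fun a => Q.e ε₁ ε₂ a 0) w ∈ Q.leftIdeal ε₁ ε₂ (n + w.length) := by
    intro w
    induction w with
    | nil => intro n x _; simp [nest]
    | cons a w ih =>
      intro n x hx
      cases w with
      | nil => exact Q.leftIdeal_mul_e ε₁ ε₂ hx a 0
      | cons b w =>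
        rw [nest, sbr, mul_sub, mul_smul_comm, ← mul_assoc, ← mul_assoc]
        refine Submodule.sub_mem _ ?_ (zsmul_mem ?_ _)
        · have := ih _ _ (Q.leftIdeal_mul_e ε₁ ε₂ hx a 0)
          rwa [add_assoc, add_comm 1] at this
        · exact Q.leftIdeal_mul_e ε₁ ε₂ (ih _ _ hx) a 0
  have := key w 0 1 (by rw [leftIdeal_zero]; trivial)
  simpa using this

theorem map_nest {R S : Type*} [Ring R] [Ring S] [Algebra ℂ R] [Algebra ℂ S] (φ : R →ₐ[ℂ] S)
    (x : Q.Node → R) (w : List Q.Node) : φ (Q.nest x w) = Q.nest (fun a => φ (x a)) w := by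
  induction w with
  | nil => simp [nest]
  | cons a w ih =>
    cases w with
    | nil => rfl
    | cons b w => rw [nest, nest, map_sbr, ih]

theorem iota_uGen (x : ChevGen Q.Node) : Q.iota ε₁ ε₂ (Q.uGen x) = Q.chevImage ε₁ ε₂ x := by
  simp [iota, uGen]

theorem sum_wt (w : List Q.Node) : ∑ a, Q.wt w a = w.length := by
  induction w with
  | nil => simp [wt]
  | cons b w ih =>
    have : Q.wt (b :: w) = Q.simpleRoot b + Q.wt w := by simp [wt]
    rw [this]
    simp [Finset.sum_add_distrib, ih, simpleRoot]
    ring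

theorem wt_nonneg (w : List Q.Node) : 0 ≤ Q.wt w := by
  induction w with
  | nil => simp [wt]
  | cons b w ih =>
    have : Q.wt (b :: w) = Q.simpleRoot b + Q.wt w := by simp [wt]
    rw [this]
    refine add_nonneg ?_ ih
    simp [simpleRoot]

theorem e_mem_leftIdeal (α : Q.PosRoot) (k) {n : ℕ} (hn : (n : ℤ) ≤ ∑ a, α.1 a) :
    X.e ε₁ ε₂ α k ∈ Q.leftIdeal ε₁ ε₂ n := by
  have key : ∀ x ∈ Q.rootSpacePos α, Q.iota ε₁ ε₂ x ∈ Q.leftIdeal ε₁ ε₂ n := by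
    intro x hx
    induction hx using Submodule.span_induction with
    | mem x h =>
      obtain ⟨w, hw, rfl⟩ := h
      rw [map_nest]
      simp only [iota_uGen]
      refine Q.leftIdeal_anti ε₁ ε₂ ?_ (Q.nest_mem_leftIdeal ε₁ ε₂ w)
      have := Q.sum_wt w
      rw [hw] at this
      omega
    | zero => simp
    | add x y _ _ hx hy => rw [map_add]; exact Submodule.add_mem _ hx hy
    | smul c x _ hx =>
      rw [map_smul, Algebra.smul_def]; exact Submodule.smul_mem _ _ hx
  exact key _ (X.pos α k).2

theorem posRoot_finite (n : ℕ) : {α : Q.PosRoot | ¬ (n : ℤ) ≤ ∑ a, α.1 a}.Finite := by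
  have hfin : (Set.Icc (0 : Q.Lattice) (fun _ => (n : ℤ))).Finite := Set.finite_Icc _ _
  refine Set.Finite.of_finite_image (f := Subtype.val) (hfin.subset ?_)
    Subtype.val_injective.injOn
  rintro _ ⟨α, hα, rfl⟩
  have hα0 : 0 ≤ α.1 := by
    by_contra hneg
    apply α.2
    rw [rootSpacePos, Submodule.span_eq_bot]
    rintro x ⟨w, hw, -⟩
    exact absurd (hw ▸ Q.wt_nonneg w) hneg
  refine ⟨hα0, fun a => ?_⟩
  have h1 : α.1 a ≤ ∑ a, α.1 a := Finset.single_le_sum (fun i _ => hα0 i) (Finset.mem_univ a)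
  simp only [Set.mem_ofPred_eq, not_le] at hα
  exact (h1.trans hα.le)

/-- A family indexed by the positive roots whose terms lie in the ideals given by the heights is
summable in the completion. -/
theorem summable_of_mem (t : Q.PosRoot → Q.Yangian ε₁ ε₂)
    (ht : ∀ α, ∀ n : ℕ, (n : ℤ) ≤ ∑ a, α.1 a → t α ∈ Q.leftIdeal ε₁ ε₂ n) :
    Summable fun α => (t α : Q.Completed ε₁ ε₂) := by
  apply NonarchimedeanAddGroup.summable_of_tendsto_cofinite_zero
  have h0 : Filter.Tendsto t Filter.cofinite (nhds 0) := by
    refine (Q.leftIdeal_basis ε₁ ε₂).hasBasis_nhds_zero.tendsto_right_iff.2 fun n _ => ?_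
    rw [Filter.eventually_cofinite]
    refine (Q.posRoot_finite n).subset fun α hα h => hα (ht α n h)
  have := (UniformSpace.Completion.continuous_coe (Q.Yangian ε₁ ε₂)).tendsto 0
  rw [UniformSpace.Completion.coe_zero] at this
  exact this.comp h0

theorem summable_vTerm (a : Q.Node) :
    Summable fun α => (Q.vTerm ε₁ ε₂ X a α : Q.Completed ε₁ ε₂) :=
  Q.summable_of_mem ε₁ ε₂ _ fun α n hn => by
    rw [vTerm, Algebra.smul_def]
    exact Submodule.smul_mem _ _ (Submodule.sum_mem _ fun k _ =>
      Submodule.smul_mem _ _ (Q.e_mem_leftIdeal ε₁ ε₂ X α k hn))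

theorem summable_wPosTerm (a : Q.Node) :
    Summable fun α => (Q.wPosTerm ε₁ ε₂ X a α : Q.Completed ε₁ ε₂) :=
  Q.summable_of_mem ε₁ ε₂ _ fun α n hn => by
    refine Submodule.sum_mem _ fun k _ => Submodule.smul_mem _ _ ?_
    have h := Q.e_mem_leftIdeal ε₁ ε₂ X α k hn
    exact Submodule.sub_mem _
      (Q.leftIdeal_anti ε₁ ε₂ n.le_succ (Q.leftIdeal_mul_e ε₁ ε₂ h a 0))
      (zsmul_mem (Submodule.smul_mem (Q.leftIdeal ε₁ ε₂ n) _ h) _)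

theorem summable_wNegTerm (a : Q.Node) :
    Summable fun α => (Q.wNegTerm ε₁ ε₂ X a α : Q.Completed ε₁ ε₂) :=
  Q.summable_of_mem ε₁ ε₂ _ fun α n hn => Submodule.sum_mem _ fun k _ =>
    Submodule.smul_mem _ _ (Q.e_mem_leftIdeal ε₁ ε₂ X α k hn)

/-- `v⁽ᵃ⁾ = (ε₁ + ε₂)/2 ∑_α (α, α⁽ᵃ⁾) ∑_k f⁽ᵅ'ᵏ⁾ e⁽ᵅ'ᵏ⁾ - (ε₁ + ε₂)/2 (ψ⁽ᵃ⁾₀)²` -/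
def v (a : Q.Node) : Q.Completed ε₁ ε₂ :=
  ((ε₁ + ε₂) / 2) • (∑' α, (Q.vTerm ε₁ ε₂ X a α : Q.Completed ε₁ ε₂)) -
    ((ε₁ + ε₂) / 2) • ((Q.psi ε₁ ε₂ a 0 ^ 2 : Q.Yangian ε₁ ε₂) : Q.Completed ε₁ ε₂)

/-- `w₊⁽ᵃ⁾ = -(ε₁ + ε₂)/2 ∑_α ∑_k f⁽ᵅ'ᵏ⁾ [e⁽ᵅ'ᵏ⁾, e⁽ᵃ⁾₀] - (ε₁ + ε₂)/2 ψ⁽ᵃ⁾₀ e⁽ᵃ⁾₀` -/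
def wPos (a : Q.Node) : Q.Completed ε₁ ε₂ :=
  -(((ε₁ + ε₂) / 2) • ∑' α, (Q.wPosTerm ε₁ ε₂ X a α : Q.Completed ε₁ ε₂)) -
    ((ε₁ + ε₂) / 2) •
      ((Q.psi ε₁ ε₂ a 0 * Q.e ε₁ ε₂ a 0 : Q.Yangian ε₁ ε₂) : Q.Completed ε₁ ε₂)

/-- `w₋⁽ᵃ⁾ = -(ε₁ + ε₂)/2 ∑_α ∑_k [f⁽ᵃ⁾₀, f⁽ᵅ'ᵏ⁾] e⁽ᵅ'ᵏ⁾ - (ε₁ + ε₂)/2 f⁽ᵃ⁾₀ ψ⁽ᵃ⁾₀` -/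
def wNeg (a : Q.Node) : Q.Completed ε₁ ε₂ :=
  -(((ε₁ + ε₂) / 2) • ∑' α, (Q.wNegTerm ε₁ ε₂ X a α : Q.Completed ε₁ ε₂)) -
    ((ε₁ + ε₂) / 2) •
      ((Q.f ε₁ ε₂ a 0 * Q.psi ε₁ ε₂ a 0 : Q.Yangian ε₁ ε₂) : Q.Completed ε₁ ε₂)

/-- `J(ψ⁽ᵃ⁾₀)` -/
def Jpsi (a : Q.Node) : Q.Completed ε₁ ε₂ := (Q.psi ε₁ ε₂ a 1 : Q.Completed ε₁ ε₂) + Q.v ε₁ ε₂ X a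

/-- `J(e⁽ᵃ⁾₀)` -/
def Je (a : Q.Node) : Q.Completed ε₁ ε₂ := (Q.e ε₁ ε₂ a 1 : Q.Completed ε₁ ε₂) + Q.wPos ε₁ ε₂ X a

/-- `J(f⁽ᵃ⁾₀)` -/
def Jf (a : Q.Node) : Q.Completed ε₁ ε₂ := (Q.f ε₁ ε₂ a 1 : Q.Completed ε₁ ε₂) + Q.wNeg ε₁ ε₂ X a

/-! ### The operators `τ⁽ᵇ⁾` -/

/-- `exp(ad x)(y) = ∑ₙ (ad x)ⁿ(y) / n!`, a finite sum when `ad x` acts nilpotently on `y`. -/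
def expAd {R : Type*} [Ring R] [Algebra ℂ R] (x y : R) : R :=
  ∑ᶠ n : ℕ, ((n.factorial : ℂ)⁻¹) • (fun z => x * z - z * x)^[n] y

/-- `ad x` acts nilpotently on `y`. -/
def AdNilpotent {R : Type*} [Ring R] (x y : R) : Prop := ∃ n : ℕ, (fun z => x * z - z * x)^[n] y = 0

/-- The element `e⁽ᵇ⁾₀` of the completion. -/
def tauE (b : Q.Node) : Q.Completed ε₁ ε₂ := (Q.e ε₁ ε₂ b 0 : Q.Completed ε₁ ε₂)

/-- The element `-(2 / (α⁽ᵇ⁾, α⁽ᵇ⁾)) f⁽ᵇ⁾₀` of the completion. -/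
def tauF (b : Q.Node) : Q.Completed ε₁ ε₂ :=
  (-(2 / (Q.cartan b b : ℂ))) • (Q.f ε₁ ε₂ b 0 : Q.Completed ε₁ ε₂)

/-- `τ⁽ᵇ⁾ = exp(ad e⁽ᵇ⁾₀) exp(-(2 / (α⁽ᵇ⁾, α⁽ᵇ⁾)) ad f⁽ᵇ⁾₀) exp(ad e⁽ᵇ⁾₀)` for an even node `b`. -/
def tau (b : Q.Node) (y : Q.Completed ε₁ ε₂) : Q.Completed ε₁ ε₂ :=
  expAd (Q.tauE ε₁ ε₂ b) (expAd (Q.tauF ε₁ ε₂ b) (expAd (Q.tauE ε₁ ε₂ b) y))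

/-- `τ⁽ᵇ⁾` is defined at `y`: the three exponential series are finite sums. -/
def TauDefined (b : Q.Node) (y : Q.Completed ε₁ ε₂) : Prop :=
  AdNilpotent (Q.tauE ε₁ ε₂ b) y ∧
  AdNilpotent (Q.tauF ε₁ ε₂ b) (expAd (Q.tauE ε₁ ε₂ b) y) ∧
  AdNilpotent (Q.tauE ε₁ ε₂ b) (expAd (Q.tauF ε₁ ε₂ b) (expAd (Q.tauE ε₁ ε₂ b) y))

/-- `τ⁽ᵇ¹⁾ ⋯ τ⁽ᵇᵖ⁾` -/
def tauWord (bs : List Q.Node) (y : Q.Completed ε₁ ε₂) : Q.Completed ε₁ ε₂ :=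
  bs.foldr (Q.tau ε₁ ε₂) y

/-- `τ⁽ᵇ¹⁾ ⋯ τ⁽ᵇᵖ⁾` is defined at `y`. -/
def TauWordDefined : List Q.Node → Q.Completed ε₁ ε₂ → Prop
  | [], _ => True
  | b :: bs, y => TauWordDefined bs y ∧ Q.TauDefined ε₁ ε₂ b (Q.tauWord ε₁ ε₂ bs y)

end Conifold

end QuiverYangian

end

noncomputable section
open scoped LaurentPolynomial
namespace QuiverYangian
namespace Conifold

/-! ### Locally finite exponentials of inner derivations -/

section ExpAd

attribute [local instance] LieRing.ofAssociativeRing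

variable {R : Type*} [Ring R] [Algebra ℂ R]

/-! The proposition is proved for simple roots and then transported by the operators `tau b`. The
elements whose brackets have to be computed there, namely ψ, J(ψ) and the e, f of even nodes, are
even, so ordinary commutators suffice in the completion.

For a simple root, the relation for ψ₁ gives [ψ₁⁽ᵃ⁾, e⁽ᵇ⁾₀] up to quadratic terms in ψ⁽ᵃ⁾₀ and
e⁽ᵇ⁾₀. The correction v⁽ᵃ⁾ is a sum of Casimir terms of the root spaces, weighted by (α, α⁽ᵃ⁾).
Invariance of the form makes the commutator of this sum with e⁽ᵇ⁾₀ telescope along α ↦ α + α⁽ᵇ⁾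
(`casimir_adR_e`, `tsum_telescope`): since the weight grows by (α⁽ᵃ⁾, α⁽ᵇ⁾) at each step, (α⁽ᵃ⁾,
α⁽ᵇ⁾) times the sum in w₊⁽ᵇ⁾ remains. The term -(ψ⁽ᵃ⁾₀)² cancels the symmetric part of the quadratic
terms, and the antisymmetric part collapses to the constant `shift a b` (`lie_Jpsi_e`,
`lie_Jpsi_f`).

The same telescoping gives, for b even, [e⁽ᵇ⁾₀, J(e⁽ᵇ⁾₀)] = 0, [f⁽ᵇ⁾₀, J(f⁽ᵇ⁾₀)] = 0 and [f⁽ᵇ⁾₀,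
J(e⁽ᵇ⁾₀)] = -J(ψ⁽ᵇ⁾₀). So J(ψ⁽ᵇ⁾₀) behaves as the zero weight vector of a three-dimensional module
and is negated by `tau b` (`expAd_reflection`).

The elements on which e⁽ᵇ⁾₀ and f⁽ᵇ⁾₀ act ad-nilpotently for all even b form a Lie subalgebra,
`integrable`, containing the zero modes and all J generators. On it the exponential series are
finite, and `tau b` is linear and preserves brackets. Applying `tau b` to the relation for a root γ
yields the relation for its reflection (`IsRootPair.tau`). The constants change by integral
multiples of earlier constants and of shifts, because 2/(α⁽ᵇ⁾, α⁽ᵇ⁾) = ±1. Induction on the word of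
reflections finishes the proof. -/

omit [Algebra ℂ R] in
theorem AdNilpotent.eventually {x y : R} (h : AdNilpotent x y) :
    ∃ N : ℕ, ∀ n, N ≤ n → (fun z => x * z - z * x)^[n] y = 0 := by
  obtain ⟨N, hN⟩ := h
  refine ⟨N, fun n hn => ?_⟩
  obtain ⟨k, rfl⟩ := Nat.exists_eq_add_of_le' hn
  rw [Function.iterate_add_apply, hN]
  exact Function.iterate_fixed (by simp) k

theorem iterate_ad_eq (x y : R) (n : ℕ) :
    (fun z => x * z - z * x)^[n] y = ((LieAlgebra.ad ℂ R x) ^ n) y := by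
  rw [Module.End.pow_apply]
  rfl

/-- A `finsum` over an infinite support would silently be 0. Nilpotency bounds the support, so here
it is the genuine truncated exponential, for any bound `N` that is large enough. -/
theorem expAd_eq_sum {x y : R} {N : ℕ}
    (h : ∀ n, N ≤ n → (fun z => x * z - z * x)^[n] y = 0) :
    expAd x y = ∑ n ∈ Finset.range N, ((n.factorial : ℂ)⁻¹) • (LieAlgebra.ad ℂ R x ^ n) y := by
  rw [expAd, finsum_eq_sum_of_support_subset (s := Finset.range N)]
  · exact Finset.sum_congr rfl fun n _ => by rw [iterate_ad_eq]
  · intro n hn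
    by_contra hN
    simp only [Finset.coe_range, Set.mem_Iio, not_lt] at hN
    exact hn (by simp only [h n hN, smul_zero])

theorem ad_pow_lie (x y z : R) (n : ℕ) : (LieAlgebra.ad ℂ R x ^ n) ⁅y, z⁆ =
    ∑ p ∈ Finset.HasAntidiagonal.antidiagonal n,
      n.choose p.1 • ⁅(LieAlgebra.ad ℂ R x ^ p.1) y, (LieAlgebra.ad ℂ R x ^ p.2) z⁆ := by
  have hD : ⇑(LieDerivation.ad ℂ R x) = ⇑(LieAlgebra.ad ℂ R x) := by
    ext w
    rw [LieDerivation.ad_apply_apply, LieAlgebra.ad_apply]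
  have h := LieDerivation.iterate_apply_lie (LieDerivation.ad ℂ R x) n y z
  simp only [hD] at h
  simpa only [Module.End.pow_apply] using h

/-- The elements on which `ad x` acts nilpotently form a Lie subalgebra. -/
def adNilpotents (x : R) : LieSubalgebra ℂ R where
  carrier := {y | AdNilpotent x y}
  zero_mem' := ⟨0, rfl⟩
  add_mem' := by
    intro y z hy hz
    obtain ⟨N, hN⟩ := hy.eventually
    obtain ⟨K, hK⟩ := hz.eventually
    refine ⟨N + K, ?_⟩
    have h1 := hN (N + K) (by omega)
    have h2 := hK (N + K) (by omega)
    rw [iterate_ad_eq] at h1 h2 ⊢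
    rw [map_add, h1, h2, add_zero]
  smul_mem' := by
    rintro c y ⟨N, hN⟩
    refine ⟨N, ?_⟩
    rw [iterate_ad_eq] at hN ⊢
    rw [map_smul, hN, smul_zero]
  lie_mem' := by
    intro y z hy hz
    obtain ⟨N, hN⟩ := AdNilpotent.eventually hy
    obtain ⟨K, hK⟩ := AdNilpotent.eventually hz
    refine ⟨N + K, ?_⟩
    rw [iterate_ad_eq, ad_pow_lie]
    refine Finset.sum_eq_zero fun p hp => ?_
    rw [Finset.HasAntidiagonal.mem_antidiagonal] at hp
    rw [← iterate_ad_eq, ← iterate_ad_eq]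
    -- The two exponents add up to `N + K`, so one of them reaches its own nilpotency bound.
    by_cases h1 : N ≤ p.1
    · rw [hN _ h1, zero_lie, smul_zero]
    · rw [hK _ (by omega), lie_zero, smul_zero]

theorem expAd_add {x y z : R} (hy : AdNilpotent x y) (hz : AdNilpotent x z) :
    expAd x (y + z) = expAd x y + expAd x z := by
  obtain ⟨N, hN⟩ := hy.eventually
  obtain ⟨K, hK⟩ := hz.eventually
  have h : ∀ n, N + K ≤ n → (fun w => x * w - w * x)^[n] (y + z) = 0 := fun n hn => by
    have h1 := hN n (by omega)
    have h2 := hK n (by omega)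
    rw [iterate_ad_eq] at h1 h2 ⊢
    rw [map_add, h1, h2, add_zero]
  rw [expAd_eq_sum h, expAd_eq_sum (N := N + K) fun n hn => hN n (by omega),
    expAd_eq_sum (N := N + K) fun n hn => hK n (by omega), ← Finset.sum_add_distrib]
  simp only [map_add, smul_add]

theorem expAd_smul {x y : R} (c : ℂ) (hy : AdNilpotent x y) :
    expAd x (c • y) = c • expAd x y := by
  obtain ⟨N, hN⟩ := hy.eventually
  have h : ∀ n, N ≤ n → (fun w => x * w - w * x)^[n] (c • y) = 0 := fun n hn => by
    have h1 := hN n hn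
    rw [iterate_ad_eq] at h1 ⊢
    rw [map_smul, h1, smul_zero]
  rw [expAd_eq_sum h, expAd_eq_sum hN, Finset.smul_sum]
  simp only [map_smul, smul_comm c]

/-- The exponential of a derivation respects the bracket. Only nilpotency on the two given elements
is needed, since all sums involved are then finite. -/
theorem expAd_lie {x y z : R} (hy : AdNilpotent x y) (hz : AdNilpotent x z) :
    expAd x ⁅y, z⁆ = ⁅expAd x y, expAd x z⁆ := by
  obtain ⟨N, hN⟩ := hy.eventually
  obtain ⟨K, hK⟩ := hz.eventually
  set D := LieAlgebra.ad ℂ R x with hD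
  set g : ℕ × ℕ → R := fun p =>
    ⁅((p.1.factorial : ℂ)⁻¹) • (D ^ p.1) y, ((p.2.factorial : ℂ)⁻¹) • (D ^ p.2) z⁆ with hg
  have hg0 : ∀ p : ℕ × ℕ, N ≤ p.1 ∨ K ≤ p.2 → g p = 0 := by
    rintro p (h | h)
    · have := hN _ h
      rw [iterate_ad_eq, ← hD] at this
      simp only [hg, this, smul_zero, zero_lie]
    · have := hK _ h
      rw [iterate_ad_eq, ← hD] at this
      simp only [hg, this, smul_zero, lie_zero]
  -- Dividing the powers by factorials absorbs the binomial coefficients of the Leibniz formula.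
  have hdp : ∀ n, ((n.factorial : ℂ)⁻¹) • (D ^ n) ⁅y, z⁆ =
      ∑ p ∈ Finset.HasAntidiagonal.antidiagonal n, g p := by
    intro n
    rw [hD, ad_pow_lie, Finset.smul_sum]
    refine Finset.sum_congr rfl fun p hp => ?_
    rw [Finset.HasAntidiagonal.mem_antidiagonal] at hp
    simp only [hg, smul_lie, lie_smul, smul_smul]
    rw [← Nat.cast_smul_eq_nsmul ℂ, smul_smul]
    congr 1
    rw [← hp, Nat.choose_symm_add, Nat.add_choose, Nat.cast_div (Nat.factorial_mul_factorial_dvd_factorial_add _ _)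
      (by exact_mod_cast mul_ne_zero (Nat.factorial_ne_zero _) (Nat.factorial_ne_zero _))]
    have h1 : ((p.1 + p.2).factorial : ℂ) ≠ 0 := by exact_mod_cast Nat.factorial_ne_zero _
    have h2 : (p.1.factorial : ℂ) ≠ 0 := by exact_mod_cast Nat.factorial_ne_zero _
    have h3 : (p.2.factorial : ℂ) ≠ 0 := by exact_mod_cast Nat.factorial_ne_zero _
    push_cast
    field_simp
  have hlie : ∀ n, N + K ≤ n → (fun w => x * w - w * x)^[n] ⁅y, z⁆ = 0 := by
    intro n hn
    have h1 : ((n.factorial : ℂ)⁻¹) • (D ^ n) ⁅y, z⁆ = 0 := by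
      rw [hdp]
      refine Finset.sum_eq_zero fun p hp => hg0 p ?_
      rw [Finset.HasAntidiagonal.mem_antidiagonal] at hp
      omega
    rw [iterate_ad_eq]
    exact (smul_eq_zero_iff_right (inv_ne_zero (by exact_mod_cast Nat.factorial_ne_zero n))).1 h1
  rw [expAd_eq_sum hlie, expAd_eq_sum hN, expAd_eq_sum hK, sum_lie]
  simp only [lie_sum]
  rw [← Finset.sum_product', Finset.sum_congr rfl fun n _ => hdp n,
    ← Finset.sum_fiberwise_of_maps_to (s := Finset.range N ×ˢ Finset.range K)
      (t := Finset.range (N + K)) (g := fun p => p.1 + p.2)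
      (fun p hp => by simp only [Finset.mem_product, Finset.mem_range] at hp ⊢; omega)]
  refine Finset.sum_congr rfl fun n _ => ?_
  symm
  -- The antidiagonal of `n` and its part inside the `N × K` rectangle differ only by vanishing
  -- terms.
  refine Finset.sum_subset_zero_on_sdiff (fun p hp => ?_) (fun p hp => hg0 p ?_) fun p _ => ?_
  · simp only [Finset.mem_filter, Finset.HasAntidiagonal.mem_antidiagonal] at hp ⊢
    exact hp.2
  · simp only [Finset.mem_sdiff, Finset.mem_filter, Finset.HasAntidiagonal.mem_antidiagonal, Finset.mem_product,
      Finset.mem_range] at hp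
    by_contra hc
    push Not at hc
    exact hp.2 ⟨hc, hp.1⟩
  · rfl

theorem expAd_of_lie_eq_zero {x y : R} (h : ⁅x, y⁆ = 0) : expAd x y = y := by
  rw [expAd_eq_sum (N := 1) fun n hn => ?_]
  · simp
  · obtain ⟨k, rfl⟩ := Nat.exists_eq_add_of_le' hn
    rw [iterate_ad_eq, pow_succ, Module.End.mul_apply, LieAlgebra.ad_apply, h, map_zero]

theorem expAd_of_lie_lie_eq_zero {x y : R} (h : ⁅x, ⁅x, y⁆⁆ = 0) : expAd x y = y + ⁅x, y⁆ := by
  rw [expAd_eq_sum (N := 2) fun n hn => ?_]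
  · simp [Finset.sum_range_succ]
  · obtain ⟨k, rfl⟩ := Nat.exists_eq_add_of_le' hn
    rw [iterate_ad_eq, pow_add, Module.End.mul_apply, pow_two, Module.End.mul_apply,
      LieAlgebra.ad_apply, LieAlgebra.ad_apply, h, map_zero]

theorem expAd_of_lie_lie_lie_eq_zero {x y : R} (h : ⁅x, ⁅x, ⁅x, y⁆⁆⁆ = 0) :
    expAd x y = y + ⁅x, y⁆ + (2 : ℂ)⁻¹ • ⁅x, ⁅x, y⁆⁆ := by
  rw [expAd_eq_sum (N := 3) fun n hn => ?_]
  · simp [Finset.sum_range_succ, pow_two]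
  · obtain ⟨k, rfl⟩ := Nat.exists_eq_add_of_le' hn
    rw [iterate_ad_eq, pow_add, Module.End.mul_apply, pow_succ, pow_two, Module.End.mul_apply,
      Module.End.mul_apply, LieAlgebra.ad_apply, LieAlgebra.ad_apply, LieAlgebra.ad_apply, h,
      map_zero]

omit [Algebra ℂ R] in
theorem adNilpotent_of_lie_eq_zero {x y : R} (h : ⁅x, y⁆ = 0) : AdNilpotent x y := ⟨1, h⟩

omit [Algebra ℂ R] in
theorem adNilpotent_of_lie_lie_eq_zero {x y : R} (h : ⁅x, ⁅x, y⁆⁆ = 0) : AdNilpotent x y :=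
  ⟨2, h⟩

omit [Algebra ℂ R] in
theorem adNilpotent_of_lie_lie_lie_eq_zero {x y : R} (h : ⁅x, ⁅x, ⁅x, y⁆⁆⁆ = 0) :
    AdNilpotent x y := ⟨3, h⟩

/-- A Lie subalgebra of elements on which `ad x` is nilpotent is stable under `exp (ad x)` if it
contains `x`. -/
theorem expAd_mem {S : LieSubalgebra ℂ R} {x y : R} (hx : x ∈ S) (hy : y ∈ S)
    (h : AdNilpotent x y) : expAd x y ∈ S := by
  obtain ⟨N, hN⟩ := h.eventually
  rw [expAd_eq_sum hN]
  refine sum_mem fun n hn => S.smul_mem _ ?_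
  clear hn
  induction n with
  | zero => simpa using hy
  | succ n ih =>
    rw [pow_succ', Module.End.mul_apply, LieAlgebra.ad_apply]
    exact S.lie_mem hx ih

/-- The reflection `exp(ad e) exp(-(2/κ) ad f) exp(ad e)` maps the zero weight vector of a
three-dimensional irreducible module to its negative. -/
theorem expAd_reflection {e f x p m : R} {κ : ℂ} (hκ : κ ≠ 0) (h1 : ⁅e, x⁆ = -(κ • p))
    (h2 : ⁅e, p⁆ = 0) (h3 : ⁅f, x⁆ = κ • m) (h4 : ⁅f, m⁆ = 0) (h5 : ⁅f, p⁆ = -x) :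
    expAd e (expAd ((-(2 / κ)) • f) (expAd e x)) = -x := by
  have hx : ⁅(-(2 / κ)) • f, x⁆ = -((2 : ℂ) • m) := by
    rw [smul_lie, h3, smul_smul, ← neg_smul]
    congr 1
    field_simp
  have hm : ⁅(-(2 / κ)) • f, m⁆ = 0 := by rw [smul_lie, h4, smul_zero]
  have hp : ⁅(-(2 / κ)) • f, p⁆ = (2 / κ) • x := by
    rw [smul_lie, h5, smul_neg, neg_smul, neg_neg]
  have hxx : ⁅(-(2 / κ)) • f, ⁅(-(2 / κ)) • f, x⁆⁆ = 0 := by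
    rw [hx, lie_neg, lie_smul, hm, smul_zero, neg_zero]
  have hppp : ⁅(-(2 / κ)) • f, ⁅(-(2 / κ)) • f, ⁅(-(2 / κ)) • f, p⁆⁆⁆ = 0 := by
    rw [hp, lie_smul, lie_smul, hxx, smul_zero]
  have hee : ⁅e, ⁅e, x⁆⁆ = 0 := by rw [h1, lie_neg, lie_smul, h2, smul_zero, neg_zero]
  have hnx := adNilpotent_of_lie_lie_eq_zero hxx
  have hnp := adNilpotent_of_lie_lie_lie_eq_zero hppp
  have s1 : expAd e x = x + (-κ) • p := by rw [expAd_of_lie_lie_eq_zero hee, h1, neg_smul]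
  -- The factor `-(2 / κ)` is tuned so that the two contributions along `m` cancel and `x` changes
  -- sign, while the component along `p` is unchanged.
  have s2 : expAd ((-(2 / κ)) • f) (x + (-κ) • p) = -x + (-κ) • p := by
    rw [expAd_add hnx ((adNilpotents _).smul_mem _ hnp), expAd_smul _ hnp,
      expAd_of_lie_lie_eq_zero hxx, expAd_of_lie_lie_lie_eq_zero hppp, hp, lie_smul, hx]
    match_scalars <;> field_simp <;> ring
  have hep : AdNilpotent e p := adNilpotent_of_lie_eq_zero h2
  have hex : AdNilpotent e x := adNilpotent_of_lie_lie_eq_zero hee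
  rw [s1, s2, expAd_add ((adNilpotents e).neg_mem hex) ((adNilpotents e).smul_mem _ hep),
    expAd_smul _ hep, expAd_of_lie_eq_zero h2, show -x = (-1 : ℂ) • x by rw [neg_one_smul],
    expAd_smul _ hex, s1]
  match_scalars <;> ring

end ExpAd

end Conifold
end QuiverYangian
end

noncomputable section
open scoped LaurentPolynomial
namespace QuiverYangian

/-! ### Signs and super brackets -/

/-- The sign `(-1)^{pq}`. -/
def sg (p q : ZMod 2) : ℤ := if p = 1 ∧ q = 1 then -1 else 1

theorem sg_mul_self (p q : ZMod 2) : sg p q * sg p q = 1 := by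
  unfold sg; split_ifs <;> rfl

theorem sg_comm (p q : ZMod 2) : sg p q = sg q p := by
  simp only [sg, and_comm]

theorem sg_zero_left (q : ZMod 2) : sg 0 q = 1 := by simp [sg]

theorem sg_zero_right (p : ZMod 2) : sg p 0 = 1 := by simp [sg]

theorem sg_add_right (p q r : ZMod 2) : sg p (q + r) = sg p q * sg p r := by
  revert p q r; decide

section Ring

variable {R : Type*} [Ring R]

theorem sbr_def (p q : ZMod 2) (x y : R) : sbr p q x y = x * y - sg p q • (y * x) := rfl

theorem sbr_zero_left (q : ZMod 2) (x y : R) : sbr 0 q x y = x * y - y * x := by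
  rw [sbr_def, sg_zero_left, one_smul]

theorem sbr_zero_right (p : ZMod 2) (x y : R) : sbr p 0 x y = x * y - y * x := by
  rw [sbr_def, sg_zero_right, one_smul]

theorem commutator_eq_neg (x y : R) : x * y - y * x = -(-x * y - y * -x) := by noncomm_ring

theorem sbr_symm (p q : ZMod 2) (x y : R) : sbr p q x y = -(sg p q • sbr q p y x) := by
  rw [sbr_def, sbr_def, smul_sub, sg_comm q p, smul_smul, sg_mul_self, one_smul, neg_sub]

/-- The sign is a bicharacter of the parities, so the super Jacobi identity is formal in the labels
`p`, `q`, `r`. No grading of the ring and no homogeneity of the elements is required. -/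
theorem sbr_jacobi (p q r : ZMod 2) (x y z : R) :
    sbr p (q + r) x (sbr q r y z) =
      sbr (p + q) r (sbr p q x y) z + sg p q • sbr q (p + r) y (sbr p r x z) := by
  simp only [sbr_def, sg_add_right, sg_comm (p + q) r, mul_sub, sub_mul, smul_sub,
    mul_smul_comm, smul_mul_assoc, smul_smul, mul_assoc, sg_comm r p, sg_comm r q, sg_comm q p]
  rcases (show sg p q = 1 ∨ sg p q = -1 by unfold sg; split_ifs <;> simp) with h | h <;>
    rw [h] <;> match_scalars <;> ring

theorem sbr_zsmul_left (p q : ZMod 2) (k : ℤ) (x y : R) :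
    sbr p q (k • x) y = k • sbr p q x y := by
  rw [sbr_def, sbr_def, smul_mul_assoc, mul_smul_comm, smul_sub, smul_comm]

theorem sbr_zsmul_right (p q : ZMod 2) (k : ℤ) (x y : R) :
    sbr p q x (k • y) = k • sbr p q x y := by
  rw [sbr_def, sbr_def, smul_mul_assoc, mul_smul_comm, smul_sub, smul_comm]

theorem sbr_neg_left (p q : ZMod 2) (x y : R) : sbr p q (-x) y = -sbr p q x y := by
  rw [← neg_one_zsmul, sbr_zsmul_left, neg_one_zsmul]

theorem sbr_neg_right (p q : ZMod 2) (x y : R) : sbr p q x (-y) = -sbr p q x y := by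
  rw [← neg_one_zsmul, sbr_zsmul_right, neg_one_zsmul]

variable [Algebra ℂ R]

/-- The super bracket as a bilinear map. -/
def sbrₗ (p q : ZMod 2) : R →ₗ[ℂ] R →ₗ[ℂ] R :=
  LinearMap.mul ℂ R - sg p q • (LinearMap.mul ℂ R).flip

theorem sbrₗ_apply (p q : ZMod 2) (x y : R) : sbrₗ p q x y = sbr p q x y := rfl

end Ring

namespace Conifold

variable (Q : Conifold)

/-! ### The form on the root lattice -/

theorem rootForm_add_left (α β γ : Q.Lattice) :
    Q.rootForm (α + β) γ = Q.rootForm α γ + Q.rootForm β γ := by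
  simp [rootForm, add_mul, Finset.sum_add_distrib]

theorem rootForm_add_right (α β γ : Q.Lattice) :
    Q.rootForm α (β + γ) = Q.rootForm α β + Q.rootForm α γ := by
  simp [rootForm, mul_add, add_mul, Finset.sum_add_distrib]

theorem rootForm_smul_right (k : ℤ) (α β : Q.Lattice) :
    Q.rootForm α (k • β) = k * Q.rootForm α β := by
  simp only [rootForm, Pi.smul_apply, smul_eq_mul, Finset.mul_sum]
  exact Finset.sum_congr rfl fun _ _ => Finset.sum_congr rfl fun _ _ => by ring

theorem rootForm_simpleRoot (a b : Q.Node) :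
    Q.rootForm (Q.simpleRoot a) (Q.simpleRoot b) = Q.cartan a b := by
  simp [rootForm, simpleRoot, Pi.single_apply]

theorem cartan_comm (a b : Q.Node) : Q.cartan a b = Q.cartan b a := by
  unfold cartan
  by_cases h : a = b
  · rw [h]
  · rw [if_neg h, if_neg (Ne.symm h)]
    by_cases h1 : b = a + 1
    · subst h1
      rw [if_pos rfl, if_neg (Q.node_ne a).2.1.symm, if_pos rfl]
    · rw [if_neg h1, if_neg h1]

theorem rootForm_comm (α β : Q.Lattice) : Q.rootForm α β = Q.rootForm β α := by
  unfold rootForm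
  rw [Finset.sum_comm]
  refine Finset.sum_congr rfl fun a _ => Finset.sum_congr rfl fun b _ => ?_
  rw [Q.cartan_comm b a]
  ring

theorem rootForm_zero_right (α : Q.Lattice) : Q.rootForm α 0 = 0 := by simp [rootForm]

theorem rootPar_add (α β : Q.Lattice) : Q.rootPar (α + β) = Q.rootPar α + Q.rootPar β := by
  simp [rootPar, add_mul, Finset.sum_add_distrib]

theorem rootPar_simpleRoot (a : Q.Node) : Q.rootPar (Q.simpleRoot a) = Q.par a := by
  simp [rootPar, simpleRoot, Pi.single_apply]

theorem wt_cons (a : Q.Node) (w : List Q.Node) : Q.wt (a :: w) = Q.simpleRoot a + Q.wt w := by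
  simp [wt]

theorem wt_singleton (a : Q.Node) : Q.wt [a] = Q.simpleRoot a := by simp [wt]

theorem nest_cons {R : Type*} [Ring R] (x : Q.Node → R) (a : Q.Node) {w : List Q.Node}
    (hw : w ≠ []) :
    Q.nest x (a :: w) = sbr (Q.par a) (Q.rootPar (Q.wt w)) (x a) (Q.nest x w) := by
  cases w with
  | nil => exact absurd rfl hw
  | cons b w => rfl

/-- A weight of height one leaves room for a single letter. Hence the root space of a simple root is
spanned by one Chevalley generator, which fixes the boundary terms of the telescoping sums. -/
theorem wt_eq_simpleRoot {w : List Q.Node} {b : Q.Node} (h : Q.wt w = Q.simpleRoot b) :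
    w = [b] := by
  have h1 := Q.sum_wt w
  rw [h] at h1
  have h2 : w.length = 1 := by
    have : ∑ a, Q.simpleRoot b a = 1 := by simp [simpleRoot]
    omega
  obtain ⟨c, rfl⟩ := List.length_eq_one_iff.1 h2
  rw [wt_singleton] at h
  have h3 := congrFun h b
  simp only [simpleRoot, Pi.single_eq_same, Pi.single_apply] at h3
  split_ifs at h3 with h4
  · rw [h4]
  · simp at h3

/-! ### Relations in `U(𝔤)` -/

/-! The integer multiples and negatives in `U(𝔤)` are taken to be those of its additive group. -/

local instance (priority := 2000) : SMul ℤ Q.UEnv :=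
  (AddCommGroup.toIntModule Q.UEnv).toSMul

local instance (priority := 2000) : Module ℤ Q.UEnv := AddCommGroup.toIntModule _

local instance (priority := 2000) : Neg Q.UEnv := NegZeroClass.toNeg

theorem uGen_rel {x y : FreeAlgebra ℂ (ChevGen Q.Node)} (h : Q.ChevRel x y) :
    RingQuot.mkAlgHom ℂ Q.ChevRel x = RingQuot.mkAlgHom ℂ Q.ChevRel y :=
  RingQuot.mkAlgHom_rel ℂ h

theorem u_ef (a b : Q.Node) : sbr (Q.par a) (Q.par b) (Q.uGen (.e a)) (Q.uGen (.f b)) =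
    if a = b then Q.uGen (.h a) else 0 := by
  have h := Q.uGen_rel (.ef a b)
  rw [map_sbr] at h
  refine h.trans ?_
  split_ifs
  · rfl
  · exact map_zero _

theorem u_he (a b : Q.Node) : Q.uGen (.h a) * Q.uGen (.e b) - Q.uGen (.e b) * Q.uGen (.h a) =
    (Q.cartan a b : ℂ) • Q.uGen (.e b) := by
  have h := Q.uGen_rel (.he a b)
  rw [map_sbr, map_smul, sbr_zero_left] at h
  exact h

theorem u_hf (a b : Q.Node) : Q.uGen (.h a) * Q.uGen (.f b) - Q.uGen (.f b) * Q.uGen (.h a) =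
    -((Q.cartan a b : ℂ) • Q.uGen (.f b)) := by
  have h := Q.uGen_rel (.hf a b)
  rw [map_sbr, map_neg, map_smul, sbr_zero_left] at h
  exact h

theorem u_hh (a b : Q.Node) : sbr 0 0 (Q.uGen (.h a)) (Q.uGen (.h b)) = 0 := by
  have h := Q.uGen_rel (.hh a b)
  rwa [map_sbr, map_zero] at h

/-- The images of the generators under the Chevalley automorphism. -/
def chevalleyGen : ChevGen Q.Node → Q.UEnv
  | .e a => Q.uGen (.f a)
  | .f a => sg (Q.par a) (Q.par a) • Q.uGen (.e a)
  | .h a => -Q.uGen (.h a)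

/-- The Chevalley automorphism of `U(𝔤)`, which exchanges the `e⁽ᵃ⁾` and `f⁽ᵃ⁾` up to sign. -/
def chevalley : Q.UEnv →ₐ[ℂ] Q.UEnv :=
  RingQuot.liftAlgHom ℂ ⟨FreeAlgebra.lift ℂ Q.chevalleyGen, by
    intro x y h
    cases h with
    | hh a b =>
      simp only [map_sbr, FreeAlgebra.lift_ι_apply, chevalleyGen, map_zero, sbr_neg_left,
        sbr_neg_right, neg_neg, u_hh]
    | ef a b =>
      have h := Q.u_ef b a
      simp only [map_sbr, FreeAlgebra.lift_ι_apply, chevalleyGen, sbr_zsmul_right]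
      rw [sbr_symm, h]
      by_cases hab : a = b
      · subst hab
        -- The sign built into the image of `f a` cancels the sign from reversing the bracket.
        simp only [if_true, FreeAlgebra.lift_ι_apply, chevalleyGen, smul_neg, smul_smul,
          sg_mul_self, one_smul]
      · rw [if_neg (Ne.symm hab), if_neg hab, map_zero, smul_zero, neg_zero, smul_zero]
    | he a b =>
      simp only [map_sbr, FreeAlgebra.lift_ι_apply, chevalleyGen, map_smul, sbr_neg_left]
      rw [sbr_zero_left, u_hf, neg_neg]
    | hf a b =>
      simp only [map_sbr, FreeAlgebra.lift_ι_apply, chevalleyGen, map_smul, map_neg,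
        sbr_neg_left, sbr_zsmul_right]
      rw [sbr_zero_left, u_he, smul_neg, smul_comm]
    | ee a b h =>
      have := Q.uGen_rel (.ff a b h)
      simp only [map_sbr, map_zero] at this
      simpa only [map_sbr, FreeAlgebra.lift_ι_apply, chevalleyGen, map_zero, uGen] using this
    | ff a b h =>
      have := Q.uGen_rel (.ee a b h)
      simp only [map_sbr, map_zero] at this
      simp only [map_sbr, FreeAlgebra.lift_ι_apply, chevalleyGen, map_zero, sbr_zsmul_left,
        sbr_zsmul_right, uGen, this, smul_zero]
    | serreE a b ha hb =>
      have := Q.uGen_rel (.serreF a b ha hb)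
      simp only [map_sbr, map_zero] at this
      simpa only [map_sbr, FreeAlgebra.lift_ι_apply, chevalleyGen, map_zero, uGen] using this
    | serreF a b ha hb =>
      have := Q.uGen_rel (.serreE a b ha hb)
      simp only [map_sbr, map_zero] at this
      simp only [map_sbr, FreeAlgebra.lift_ι_apply, chevalleyGen, map_zero, sbr_zsmul_left,
        sbr_zsmul_right, uGen, this, smul_zero]
    | oddSerreE a ha =>
      have := Q.uGen_rel (.oddSerreF a ha)
      simp only [map_sbr, map_zero] at this
      simpa only [map_sbr, FreeAlgebra.lift_ι_apply, chevalleyGen, map_zero, uGen] using this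
    | oddSerreF a ha =>
      have := Q.uGen_rel (.oddSerreE a ha)
      simp only [map_sbr, map_zero] at this
      simp only [map_sbr, FreeAlgebra.lift_ι_apply, chevalleyGen, map_zero, sbr_zsmul_left,
        sbr_zsmul_right, uGen, this, smul_zero]⟩

theorem chevalley_uGen (x : ChevGen Q.Node) : Q.chevalley (Q.uGen x) = Q.chevalleyGen x := by
  simp [chevalley, uGen]

/-- The automorphism turns nested brackets of the `e` into those of the `f` word by word, so facts
about negative root spaces can be read off from the positive ones. -/
theorem rootSpaceNeg_eq_map (α : Q.Lattice) :
    Q.rootSpaceNeg α = (Q.rootSpacePos α).map Q.chevalley.toLinearMap := by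
  rw [rootSpaceNeg, rootSpacePos, Submodule.map_span]
  congr 1
  have h : ∀ w, Q.chevalley (Q.nest (fun a => Q.uGen (.e a)) w) =
      Q.nest (fun a => Q.uGen (.f a)) w := fun w => by
    rw [map_nest]
    simp only [chevalley_uGen, chevalleyGen]
  ext x
  constructor
  · rintro ⟨w, hw, rfl⟩
    exact ⟨_, ⟨w, hw, rfl⟩, h w⟩
  · rintro ⟨_, ⟨w, hw, rfl⟩, rfl⟩
    exact ⟨w, hw, h w⟩

/-! ### Brackets of root vectors and Chevalley generators -/

theorem nest_mem_rootSpacePos (w : List Q.Node) :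
    Q.nest (fun a => Q.uGen (.e a)) w ∈ Q.rootSpacePos (Q.wt w) :=
  Submodule.subset_span ⟨w, rfl, rfl⟩

/-- The bracket with a Chevalley generator of the parity of the node `b`, on elements of the
parity of `α`. -/
def adR (α : Q.Lattice) (b : Q.Node) (z : Q.UEnv) : Q.UEnv →ₗ[ℂ] Q.UEnv :=
  (sbrₗ (Q.rootPar α) (Q.par b)).flip z

theorem adR_apply (α : Q.Lattice) (b : Q.Node) (z x : Q.UEnv) :
    Q.adR α b z x = sbr (Q.rootPar α) (Q.par b) x z := rfl

theorem h_nest (a : Q.Node) (w : List Q.Node) :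
    Q.uGen (.h a) * Q.nest (fun a => Q.uGen (.e a)) w -
      Q.nest (fun a => Q.uGen (.e a)) w * Q.uGen (.h a) =
    (Q.rootForm (Q.simpleRoot a) (Q.wt w) : ℂ) • Q.nest (fun a => Q.uGen (.e a)) w := by
  induction w with
  | nil => simp [nest]
  | cons b w ih =>
    by_cases hw : w = []
    · subst hw
      rw [wt_singleton, rootForm_simpleRoot]
      exact Q.u_he a b
    · have hj := sbr_jacobi 0 (Q.par b) (Q.rootPar (Q.wt w)) (Q.uGen (.h a)) (Q.uGen (.e b))
        (Q.nest (fun a => Q.uGen (.e a)) w)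
      rw [sbr_zero_left, sbr_zero_left, sbr_zero_left, sg_zero_left, u_he, ih, one_smul,
        zero_add, zero_add] at hj
      rw [nest_cons Q _ b hw, hj, wt_cons, rootForm_add_right, rootForm_simpleRoot]
      simp only [← sbrₗ_apply, map_smul, LinearMap.smul_apply]
      push_cast
      rw [add_smul]

theorem h_rootSpacePos (a : Q.Node) {α : Q.Lattice} {x : Q.UEnv} (hx : x ∈ Q.rootSpacePos α) :
    Q.uGen (.h a) * x - x * Q.uGen (.h a) = (Q.rootForm (Q.simpleRoot a) α : ℂ) • x := by
  induction hx using Submodule.span_induction with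
  | mem x h => obtain ⟨w, rfl, rfl⟩ := h; exact Q.h_nest a w
  | zero => simp
  | add x y _ _ hx hy => rw [mul_add, add_mul, smul_add, ← hx, ← hy]; abel
  | smul c x _ hx => rw [smul_comm, ← hx, mul_smul_comm, smul_mul_assoc, smul_sub]

theorem h_rootSpaceNeg (a : Q.Node) {α : Q.Lattice} {x : Q.UEnv} (hx : x ∈ Q.rootSpaceNeg α) :
    Q.uGen (.h a) * x - x * Q.uGen (.h a) = -((Q.rootForm (Q.simpleRoot a) α : ℂ) • x) := by
  rw [rootSpaceNeg_eq_map] at hx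
  obtain ⟨y, hy, rfl⟩ := hx
  have h := congrArg Q.chevalley (Q.h_rootSpacePos a hy)
  rw [map_sub, map_mul, map_mul, map_smul, chevalley_uGen, chevalleyGen] at h
  rw [AlgHom.toLinearMap_apply, ← h]
  exact commutator_eq_neg _ _

/-- Only the empty word has weight zero, and its nested bracket is 0 by convention. Cartan elements
are thus not counted as root vectors; this is why α = 0 is exceptional in the transfer of Casimir
terms. -/
theorem rootSpacePos_zero : Q.rootSpacePos 0 = ⊥ := by
  rw [rootSpacePos, Submodule.span_eq_bot]
  rintro x ⟨w, hw, rfl⟩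
  have h := Q.sum_wt w
  rw [hw] at h
  have : w = [] := List.length_eq_zero_iff.1 (by simpa using h.symm)
  rw [this, nest]

theorem sbr_e_rootSpacePos (b : Q.Node) {α : Q.Lattice} {x : Q.UEnv}
    (hx : x ∈ Q.rootSpacePos α) :
    sbr (Q.par b) (Q.rootPar α) (Q.uGen (.e b)) x ∈ Q.rootSpacePos (α + Q.simpleRoot b) := by
  rw [← sbrₗ_apply]
  induction hx using Submodule.span_induction with
  | mem x h =>
    obtain ⟨w, rfl, rfl⟩ := h
    by_cases hw : w = []
    · subst hw; simp [nest]
    · rw [sbrₗ_apply, ← nest_cons Q (fun a => Q.uGen (.e a)) b hw, add_comm, ← wt_cons]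
      exact Q.nest_mem_rootSpacePos _
  | zero => rw [map_zero]; exact zero_mem _
  | add x y _ _ hx hy => rw [map_add]; exact add_mem hx hy
  | smul c x _ hx => rw [map_smul]; exact Submodule.smul_mem _ _ hx

theorem adR_e_rootSpacePos (b : Q.Node) {α : Q.Lattice} {x : Q.UEnv}
    (hx : x ∈ Q.rootSpacePos α) :
    Q.adR α b (Q.uGen (.e b)) x ∈ Q.rootSpacePos (α + Q.simpleRoot b) := by
  rw [adR_apply, sbr_symm]
  exact neg_mem (zsmul_mem (Q.sbr_e_rootSpacePos b hx) _)

/-- Induction on the word by the Jacobi identity: a Cartan element produced inside the word acts on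
its neighbours by a scalar. The excluded weight is the one for which the result would be a multiple
of `h b` itself. -/
theorem sbr_f_nest (b : Q.Node) (w : List Q.Node) (hw : Q.wt w ≠ Q.simpleRoot b) :
    sbr (Q.par b) (Q.rootPar (Q.wt w)) (Q.uGen (.f b)) (Q.nest (fun a => Q.uGen (.e a)) w) ∈
      Q.rootSpacePos (Q.wt w - Q.simpleRoot b) := by
  induction w with
  | nil => rw [nest, ← sbrₗ_apply, map_zero]; exact zero_mem _
  | cons a w ih =>
    have hfe : sbr (Q.par b) (Q.par a) (Q.uGen (.f b)) (Q.uGen (.e a)) =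
        -(sg (Q.par b) (Q.par a) • if a = b then Q.uGen (.h a) else 0) := by
      rw [sbr_symm, u_ef]
    by_cases hnil : w = []
    · subst hnil
      have hab : a ≠ b := fun h => hw (by rw [wt_singleton, h])
      rw [wt_singleton, rootPar_simpleRoot]
      change sbr (Q.par b) (Q.par a) (Q.uGen (.f b)) (Q.uGen (.e a)) ∈ _
      rw [hfe, if_neg hab, smul_zero, neg_zero]
      exact zero_mem _
    · rw [nest_cons Q _ a hnil, wt_cons, rootPar_add, rootPar_simpleRoot, sbr_jacobi, hfe]
      refine add_mem ?_ (zsmul_mem ?_ _)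
      · by_cases hab : a = b
        · subst hab
          have hp : Q.par a + Q.par a = 0 := CharTwo.add_self_eq_zero _
          rw [if_pos rfl, sbr_neg_left, sbr_zsmul_left, hp, sbr_zero_left, h_nest,
            add_sub_cancel_left]
          exact neg_mem (zsmul_mem (Submodule.smul_mem _ _ (Q.nest_mem_rootSpacePos _)) _)
        · rw [if_neg hab, smul_zero, neg_zero, ← sbrₗ_apply, map_zero, LinearMap.zero_apply]
          exact zero_mem _
      -- If the tail is the single letter `b`, its bracket with `f b` is a multiple of `h b` and the
      -- induction hypothesis does not apply; the outer `e a` turns it back into a root vector.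
      · by_cases hb : Q.wt w = Q.simpleRoot b
        · obtain rfl := Q.wt_eq_simpleRoot hb
          have hp : Q.par b + Q.par b = 0 := CharTwo.add_self_eq_zero _
          have hh : sbr (Q.par b) (Q.par b) (Q.uGen (.f b)) (Q.uGen (.e b)) =
              -(sg (Q.par b) (Q.par b) • Q.uGen (.h b)) := by
            rw [sbr_symm, u_ef, if_pos rfl]
          rw [wt_singleton, rootPar_simpleRoot]
          change sbr (Q.par a) (Q.par b + Q.par b) (Q.uGen (.e a))
            (sbr (Q.par b) (Q.par b) (Q.uGen (.f b)) (Q.uGen (.e b))) ∈ _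
          rw [hh, hp, sbr_neg_right, sbr_zsmul_right, sbr_zero_right,
            ← neg_sub (Q.uGen (.h b) * _), u_he, add_sub_cancel_right, ← wt_singleton]
          exact neg_mem (zsmul_mem (neg_mem (Submodule.smul_mem _ _
            (Q.nest_mem_rootSpacePos [a]))) _)
        · have h := Q.sbr_e_rootSpacePos a (ih hb)
          have hp : Q.rootPar (Q.wt w - Q.simpleRoot b) = Q.par b + Q.rootPar (Q.wt w) := by
            have := Q.rootPar_add (Q.wt w - Q.simpleRoot b) (Q.simpleRoot b)
            rw [sub_add_cancel, rootPar_simpleRoot] at this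
            rw [this, add_comm, add_assoc, CharTwo.add_self_eq_zero, add_zero]
          rw [hp] at h
          convert h using 2
          abel

theorem adR_f_rootSpacePos (b : Q.Node) {α : Q.Lattice} (hα : α ≠ Q.simpleRoot b) {x : Q.UEnv}
    (hx : x ∈ Q.rootSpacePos α) :
    Q.adR α b (Q.uGen (.f b)) x ∈ Q.rootSpacePos (α - Q.simpleRoot b) := by
  induction hx using Submodule.span_induction with
  | mem x h =>
    obtain ⟨w, rfl, rfl⟩ := h
    rw [adR_apply, sbr_symm]
    exact neg_mem (zsmul_mem (Q.sbr_f_nest b w hα) _)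
  | zero => rw [map_zero]; exact zero_mem _
  | add x y _ _ hx hy => rw [map_add]; exact add_mem hx hy
  | smul c x _ hx => rw [map_smul]; exact Submodule.smul_mem _ _ hx

theorem adR_f_rootSpaceNeg (b : Q.Node) {α : Q.Lattice} {x : Q.UEnv}
    (hx : x ∈ Q.rootSpaceNeg α) :
    Q.adR α b (Q.uGen (.f b)) x ∈ Q.rootSpaceNeg (α + Q.simpleRoot b) := by
  rw [rootSpaceNeg_eq_map] at hx ⊢
  obtain ⟨y, hy, rfl⟩ := hx
  refine ⟨_, Q.adR_e_rootSpacePos b hy, ?_⟩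
  rw [adR_apply, adR_apply, AlgHom.toLinearMap_apply, AlgHom.toLinearMap_apply, map_sbr,
    chevalley_uGen, chevalleyGen]

theorem adR_e_rootSpaceNeg (b : Q.Node) {α : Q.Lattice} (hα : α ≠ Q.simpleRoot b) {x : Q.UEnv}
    (hx : x ∈ Q.rootSpaceNeg α) :
    Q.adR α b (Q.uGen (.e b)) x ∈ Q.rootSpaceNeg (α - Q.simpleRoot b) := by
  rw [rootSpaceNeg_eq_map] at hx ⊢
  obtain ⟨y, hy, rfl⟩ := hx
  -- The scalar undoes the sign in the image of `f b` under the Chevalley automorphism.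
  refine ⟨_, zsmul_mem (Q.adR_f_rootSpacePos b hα hy) (sg (Q.par b) (Q.par b)), ?_⟩
  rw [adR_apply, adR_apply, AlgHom.toLinearMap_apply, AlgHom.toLinearMap_apply, map_zsmul,
    map_sbr, chevalley_uGen, chevalleyGen, sbr_zsmul_right, smul_smul, sg_mul_self, one_smul]

theorem rootSpaceNeg_eq_bot {α : Q.Lattice} (h : Q.rootSpacePos α = ⊥) :
    Q.rootSpaceNeg α = ⊥ := by
  rw [rootSpaceNeg_eq_map, h, Submodule.map_bot]

/-! ### Invariance of the form -/

/-- The form as a bilinear map. -/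
def invFormₗ : Q.UEnv →ₗ[ℂ] Q.UEnv →ₗ[ℂ] ℂ :=
  LinearMap.mk₂ ℂ Q.invForm
    (fun x y z => by
      simp only [invForm, map_add, add_mul, Matrix.add_apply, smul_add, Finset.sum_add_distrib,
        AddMonoidAlgebra.coeff_add, Finsupp.add_apply])
    (fun c x y => by
      simp only [invForm, map_smul, smul_mul_assoc, Matrix.smul_apply, smul_comm _ c,
        ← Finset.smul_sum]
      rfl)
    (fun x y z => by
      simp only [invForm, map_add, mul_add, Matrix.add_apply, smul_add, Finset.sum_add_distrib,
        AddMonoidAlgebra.coeff_add, Finsupp.add_apply])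
    (fun c x y => by
      simp only [invForm, map_smul, mul_smul_comm, Matrix.smul_apply, smul_comm _ c,
        ← Finset.smul_sum]
      rfl)

theorem invFormₗ_apply (x y : Q.UEnv) : Q.invFormₗ x y = Q.invForm x y := rfl

/-- The supertrace. -/
def supertrace : Q.Loop →ₗ[ℂ] ℂ[T;T⁻¹] where
  toFun m := ∑ j, ((-(Q.sign j : ℤ) : ℤ) : ℂ) • m j j
  map_add' x y := by simp [smul_add, Finset.sum_add_distrib]
  map_smul' c x := by
    simp only [Matrix.smul_apply, smul_comm _ c, ← Finset.smul_sum, RingHom.id_apply]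

/-- Both products see only the entry `m j i`, with the weights of the indices `i` and `j`. So
supercyclicity against a matrix unit holds for every `m`, homogeneous or not. -/
theorem supertrace_single_mul (i j : Q.Node) (c : ℂ[T;T⁻¹]) (m : Q.Loop) :
    Q.supertrace (Matrix.single i j c * m) =
      (((Q.sign i : ℤ) * (Q.sign j : ℤ) : ℤ) : ℂ) • Q.supertrace (m * Matrix.single i j c) := by
  have hs : ((((Q.sign i : ℤ) * (Q.sign j : ℤ) : ℤ) : ℂ)) * (((-(Q.sign j : ℤ) : ℤ) : ℂ)) =
      (((-(Q.sign i : ℤ) : ℤ) : ℂ)) := by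
    rcases Q.sign_cases i with h | h <;> rcases Q.sign_cases j with h' | h' <;> simp [h, h']
  simp only [supertrace, LinearMap.coe_mk, AddHom.coe_mk]
  rw [Finset.sum_eq_single i, Finset.sum_eq_single j, smul_smul, hs]
  · simp [mul_comm]
  · intro k _ hk
    simp [hk]
  · simp
  · intro k _ hk
    simp [hk]
  · simp

/-- A node is odd exactly when the adjacent signs differ; this matches the sign of the supertrace
with the parity of the Chevalley generators. -/
theorem sign_mul_sign (b : Q.Node) :
    ((Q.sign b : ℤ) * (Q.sign (b + 1) : ℤ)) = sg (Q.par b) (Q.par b) := by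
  unfold par IsEven
  rcases Q.sign_cases b with h | h <;> rcases Q.sign_cases (b + 1) with h' | h' <;>
    simp [h, h', sg]

/-- Invariance of the form under the Chevalley generators. -/
theorem invForm_sbr {x y : Q.UEnv} {z : ChevGen Q.Node} {b : Q.Node} {p q : ZMod 2}
    (hz : z = .e b ∨ z = .f b) (hpq : q = p + Q.par b) :
    Q.invForm (sbr p (Q.par b) x (Q.uGen z)) y =
      -((sg q (Q.par b) : ℂ) * Q.invForm x (sbr q (Q.par b) y (Q.uGen z))) := by
  have key : ∀ m, Q.supertrace (Q.loopGen z * m) =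
      (sg (Q.par b) (Q.par b) : ℂ) • Q.supertrace (m * Q.loopGen z) := by
    intro m
    rcases hz with rfl | rfl
    · rw [loopGen, supertrace_single_mul, sign_mul_sign]
    · rw [loopGen, supertrace_single_mul, mul_comm, sign_mul_sign]
  have hform : ∀ x y, Q.invForm x y = (Q.supertrace (Q.toLoop x * Q.toLoop y)).coeff 0 :=
    fun _ _ => rfl
  -- Moving `z` past `x` contributes the label `p`, moving it around the supertrace contributes its
  -- own parity; together they give the label `q`.
  have hsg : sg p (Q.par b) * sg (Q.par b) (Q.par b) = sg q (Q.par b) := by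
    rw [hpq, sg_comm (p + _), sg_add_right, sg_comm p]
  have e1 : Q.supertrace (Q.toLoop (sbr p (Q.par b) x (Q.uGen z)) * Q.toLoop y) =
      Q.supertrace (Q.toLoop x * Q.loopGen z * Q.toLoop y) -
        sg q (Q.par b) • Q.supertrace (Q.toLoop x * Q.toLoop y * Q.loopGen z) := by
    rw [map_sbr, toLoop_uGen, sbr_def, sub_mul, map_sub, smul_mul_assoc, map_zsmul, mul_assoc
      (Q.loopGen z), key, ← hsg, mul_smul, Int.cast_smul_eq_zsmul]
  have e2 : Q.supertrace (Q.toLoop x * Q.toLoop (sbr q (Q.par b) y (Q.uGen z))) =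
      Q.supertrace (Q.toLoop x * Q.toLoop y * Q.loopGen z) -
        sg q (Q.par b) • Q.supertrace (Q.toLoop x * Q.loopGen z * Q.toLoop y) := by
    rw [map_sbr, toLoop_uGen, sbr_def, mul_sub, map_sub, mul_smul_comm, map_zsmul, mul_assoc,
      mul_assoc]
  have e3 : Q.supertrace (Q.toLoop (sbr p (Q.par b) x (Q.uGen z)) * Q.toLoop y) =
      -(sg q (Q.par b) • Q.supertrace (Q.toLoop x * Q.toLoop (sbr q (Q.par b) y (Q.uGen z)))) := by
    rw [e1, e2, smul_sub, smul_smul, sg_mul_self, one_smul, neg_sub]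
  rw [hform, hform, e3, ← Int.cast_smul_eq_zsmul ℂ]
  rfl

end Conifold
end QuiverYangian
end

noncomputable section
open scoped LaurentPolynomial
namespace QuiverYangian
namespace Conifold

variable (Q : Conifold)

/-! ### Casimir elements -/

section Casimir

variable {Q} (X : Q.DualRootBases)

/-- Pairing with the dual basis reads off coordinates. The duality of the two given bases is the
only form of nondegeneracy that enters. -/
theorem DualRootBases.pos_expand (α : Q.PosRoot) {x : Q.UEnv} (hx : x ∈ Q.rootSpacePos α) :
    x = ∑ k, Q.invForm x (X.neg α k) • (X.pos α k : Q.UEnv) := by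
  have h := (X.pos α).sum_repr ⟨x, hx⟩
  have h' := congrArg (Q.rootSpacePos α).subtype h
  simp only [map_sum, map_smul, Submodule.subtype_apply] at h'
  conv_lhs => rw [← h']
  refine Finset.sum_congr rfl fun k _ => ?_
  congr 1
  conv_rhs => rw [← h', ← invFormₗ_apply]
  simp only [map_sum, map_smul, LinearMap.sum_apply, LinearMap.smul_apply, invFormₗ_apply,
    X.dual, smul_eq_mul, mul_ite, mul_one, mul_zero, Finset.sum_ite_eq', Finset.mem_univ, if_true]

theorem DualRootBases.neg_expand (α : Q.PosRoot) {y : Q.UEnv} (hy : y ∈ Q.rootSpaceNeg α) :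
    y = ∑ k, Q.invForm (X.pos α k) y • (X.neg α k : Q.UEnv) := by
  have h := (X.neg α).sum_repr ⟨y, hy⟩
  have h' := congrArg (Q.rootSpaceNeg α).subtype h
  simp only [map_sum, map_smul, Submodule.subtype_apply] at h'
  conv_lhs => rw [← h']
  refine Finset.sum_congr rfl fun k _ => ?_
  congr 1
  conv_rhs => rw [← h', ← invFormₗ_apply]
  simp only [map_sum, map_smul, invFormₗ_apply,
    X.dual, smul_eq_mul, mul_ite, mul_one, mul_zero, Finset.sum_ite_eq, Finset.mem_univ, if_true]

variable (ε₁ ε₂ : ℂ)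

open Classical in
/-- The image of `(φ ⊗ g) (∑ₖ x₋⁽ᵅ'ᵏ⁾ ⊗ x₊⁽ᵅ'ᵏ⁾)` in `Y`; it is zero if `α` is not a positive root. -/
def casimir (α : Q.Lattice) (φ g : Q.UEnv →ₗ[ℂ] Q.UEnv) : Q.Yangian ε₁ ε₂ :=
  if h : Q.rootSpacePos α ≠ ⊥ then
    ∑ k, Q.iota ε₁ ε₂ (φ (X.neg ⟨α, h⟩ k)) * Q.iota ε₁ ε₂ (g (X.pos ⟨α, h⟩ k))
  else 0

theorem casimir_posRoot (α : Q.PosRoot) (φ g : Q.UEnv →ₗ[ℂ] Q.UEnv) :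
    casimir X ε₁ ε₂ α φ g =
      ∑ k, Q.iota ε₁ ε₂ (φ (X.neg α k)) * Q.iota ε₁ ε₂ (g (X.pos α k)) := by
  rw [casimir, dif_pos α.2]

theorem casimir_of_eq_bot {α : Q.Lattice} (h : Q.rootSpacePos α = ⊥)
    (φ g : Q.UEnv →ₗ[ℂ] Q.UEnv) : casimir X ε₁ ε₂ α φ g = 0 := by
  rw [casimir, dif_neg (not_not.2 h)]

theorem casimir_zero (φ g : Q.UEnv →ₗ[ℂ] Q.UEnv) : casimir X ε₁ ε₂ 0 φ g = 0 :=
  casimir_of_eq_bot X ε₁ ε₂ Q.rootSpacePos_zero φ g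

theorem casimir_congr {α : Q.Lattice} {φ φ' g g' : Q.UEnv →ₗ[ℂ] Q.UEnv}
    (hφ : ∀ y ∈ Q.rootSpaceNeg α, φ y = φ' y) (hg : ∀ x ∈ Q.rootSpacePos α, g x = g' x) :
    casimir X ε₁ ε₂ α φ g = casimir X ε₁ ε₂ α φ' g' := by
  by_cases h : Q.rootSpacePos α = ⊥
  · rw [casimir_of_eq_bot X ε₁ ε₂ h, casimir_of_eq_bot X ε₁ ε₂ h]
  · change casimir X ε₁ ε₂ (⟨α, h⟩ : Q.PosRoot).1 φ g = casimir X ε₁ ε₂ (⟨α, h⟩ : Q.PosRoot).1 φ' g'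
    rw [casimir_posRoot, casimir_posRoot]
    refine Finset.sum_congr rfl fun k _ => ?_
    rw [hφ _ (X.neg ⟨α, h⟩ k).2, hg _ (X.pos ⟨α, h⟩ k).2]

theorem casimir_smul_right (α : Q.Lattice) (c : ℂ) (φ g : Q.UEnv →ₗ[ℂ] Q.UEnv) :
    casimir X ε₁ ε₂ α φ (c • g) = c • casimir X ε₁ ε₂ α φ g := by
  unfold casimir
  split_ifs
  · simp only [LinearMap.smul_apply, map_smul, mul_smul_comm, Finset.smul_sum]
  · rw [smul_zero]

theorem casimir_add_right (α : Q.Lattice) (φ g g' : Q.UEnv →ₗ[ℂ] Q.UEnv) :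
    casimir X ε₁ ε₂ α φ (g + g') = casimir X ε₁ ε₂ α φ g + casimir X ε₁ ε₂ α φ g' := by
  unfold casimir
  split_ifs
  · simp only [LinearMap.add_apply, map_add, mul_add, Finset.sum_add_distrib]
  · rw [add_zero]

/-- The root space is the line through `e b`, and `e b`, `f b` pair to 1, so the Casimir tensor is f
⊗ e whatever dual bases were chosen. -/
theorem casimir_simpleRoot (b : Q.Node) (φ g : Q.UEnv →ₗ[ℂ] Q.UEnv) :
    casimir X ε₁ ε₂ (Q.simpleRoot b) φ g =
      Q.iota ε₁ ε₂ (φ (Q.uGen (.f b))) * Q.iota ε₁ ε₂ (g (Q.uGen (.e b))) := by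
  have he : Q.uGen (.e b) ∈ Q.rootSpacePos (Q.simpleRoot b) :=
    Submodule.subset_span ⟨[b], Q.wt_singleton b, rfl⟩
  have hf : Q.uGen (.f b) ∈ Q.rootSpaceNeg (Q.simpleRoot b) :=
    Submodule.subset_span ⟨[b], Q.wt_singleton b, rfl⟩
  have hspan : ∀ x ∈ Q.rootSpacePos (Q.simpleRoot b), ∃ c : ℂ, x = c • Q.uGen (.e b) := by
    intro x hx
    have hle : Q.rootSpacePos (Q.simpleRoot b) ≤ Submodule.span ℂ {Q.uGen (.e b)} := by
      refine Submodule.span_le.2 ?_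
      rintro _ ⟨w, hw, rfl⟩
      rw [Q.wt_eq_simpleRoot hw]
      exact Submodule.subset_span rfl
    obtain ⟨c, hc⟩ := Submodule.mem_span_singleton.1 (hle hx)
    exact ⟨c, hc.symm⟩
  have hne : Q.rootSpacePos (Q.simpleRoot b) ≠ ⊥ := fun h => by
    rw [h, Submodule.mem_bot] at he
    have := Q.invForm_ef b
    rw [← invFormₗ_apply, he, map_zero, LinearMap.zero_apply] at this
    exact zero_ne_one this
  set α : Q.PosRoot := ⟨Q.simpleRoot b, hne⟩ with hαdef
  change casimir X ε₁ ε₂ α.1 φ g = _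
  rw [casimir_posRoot]
  have hfe := X.neg_expand α hf
  conv_rhs => rw [hfe]
  rw [map_sum, map_sum, Finset.sum_mul]
  refine Finset.sum_congr rfl fun k _ => ?_
  -- The basis vector is `c` times `e b`, and `c` is also the coefficient of its dual vector in the
  -- expansion of `f b`.
  obtain ⟨c, hc⟩ := hspan _ (X.pos α k).2
  have hval : Q.invForm (c • Q.uGen (.e b)) (Q.uGen (.f b)) = c := by
    rw [← invFormₗ_apply, map_smul, LinearMap.smul_apply, invFormₗ_apply, invForm_ef,
      smul_eq_mul, mul_one]
  rw [hc, hval]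
  simp only [map_smul, mul_smul_comm, smul_mul_assoc]

/-- Adjoint maps between root spaces can be moved across a Casimir element. -/
theorem casimir_transfer {α β : Q.Lattice} {P R : Q.UEnv →ₗ[ℂ] Q.UEnv} {c : ℤ}
    (hP : ∀ x ∈ Q.rootSpacePos α, P x ∈ Q.rootSpacePos β)
    (hR : ∀ y ∈ Q.rootSpaceNeg β, R y ∈ Q.rootSpaceNeg α)
    (hc : ∀ x y, Q.invForm (P x) y = (c : ℂ) * Q.invForm x (R y))
    (φ g : Q.UEnv →ₗ[ℂ] Q.UEnv) :
    casimir X ε₁ ε₂ α φ (g ∘ₗ P) = c • casimir X ε₁ ε₂ β (φ ∘ₗ R) g := by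
  -- Casimir terms are 0 by definition off the positive roots. If one of the two root spaces
  -- vanishes, the map into it, or its adjoint, is zero and both sides vanish.
  by_cases hα : Q.rootSpacePos α = ⊥
  · have h0 : casimir X ε₁ ε₂ β (φ ∘ₗ R) g = casimir X ε₁ ε₂ β 0 g := by
      refine casimir_congr X ε₁ ε₂ (fun y hy => ?_) fun _ _ => rfl
      have := hR y hy
      rw [Q.rootSpaceNeg_eq_bot hα, Submodule.mem_bot] at this
      rw [LinearMap.comp_apply, this, map_zero, LinearMap.zero_apply]
    rw [casimir_of_eq_bot X ε₁ ε₂ hα, h0, casimir]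
    split_ifs <;> simp
  by_cases hβ : Q.rootSpacePos β = ⊥
  · have h0 : casimir X ε₁ ε₂ α φ (g ∘ₗ P) = casimir X ε₁ ε₂ α φ 0 := by
      refine casimir_congr X ε₁ ε₂ (fun _ _ => rfl) fun y hy => ?_
      have := hP y hy
      rw [hβ, Submodule.mem_bot] at this
      rw [LinearMap.comp_apply, this, map_zero, LinearMap.zero_apply]
    rw [casimir_of_eq_bot X ε₁ ε₂ hβ, h0, casimir]
    split_ifs <;> simp
  set a : Q.PosRoot := ⟨α, hα⟩ with ha
  set b : Q.PosRoot := ⟨β, hβ⟩ with hb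
  change casimir X ε₁ ε₂ a.1 φ (g ∘ₗ P) = c • casimir X ε₁ ε₂ b.1 (φ ∘ₗ R) g
  -- In dual bases the matrix of `P` is `c` times the transpose of that of `R`; `h1` and `h2` write
  -- out both matrices, and exchanging the two sums finishes.
  have h1 : ∀ k, g (P (X.pos a k)) =
      ∑ l, (c * Q.invForm (X.pos a k) (R (X.neg b l)) : ℂ) • g (X.pos b l) := fun k => by
    conv_lhs => rw [X.pos_expand b (hP _ (X.pos a k).2)]
    simp only [map_sum, map_smul, hc]
  have h2 : ∀ l, φ (R (X.neg b l)) =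
      ∑ k, Q.invForm (X.pos a k) (R (X.neg b l)) • φ (X.neg a k) := fun l => by
    conv_lhs => rw [X.neg_expand a (hR _ (X.neg b l).2)]
    simp only [map_sum, map_smul]
  rw [casimir_posRoot, casimir_posRoot, ← Int.cast_smul_eq_zsmul ℂ, Finset.smul_sum]
  simp only [LinearMap.comp_apply, h1, h2, map_sum, map_smul, Finset.mul_sum, Finset.sum_mul,
    mul_smul_comm, smul_mul_assoc, Finset.smul_sum, smul_smul]
  exact Finset.sum_comm

/-- By invariance, bracketing with `e b` from the root space of α to that of α + α⁽ᵇ⁾ is adjoint, up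
to sign, to the same bracket on the opposite negative root spaces. At α = 0 the latter lands in the
Cartan subalgebra, and the term of the simple root survives as a boundary term. -/
theorem casimir_adR_e (b : Q.Node) (α : Q.Lattice) (φ g : Q.UEnv →ₗ[ℂ] Q.UEnv) :
    sg (Q.rootPar (α + Q.simpleRoot b)) (Q.par b) • casimir X ε₁ ε₂ (α + Q.simpleRoot b)
      (φ ∘ₗ Q.adR (α + Q.simpleRoot b) b (Q.uGen (.e b))) g =
    -casimir X ε₁ ε₂ α φ (g ∘ₗ Q.adR α b (Q.uGen (.e b))) + if α = 0 then
      sg (Q.par b) (Q.par b) • (Q.iota ε₁ ε₂ (φ (Q.adR (Q.simpleRoot b) b (Q.uGen (.e b))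
        (Q.uGen (.f b)))) * Q.iota ε₁ ε₂ (g (Q.uGen (.e b)))) else 0 := by
  by_cases hα : α = 0
  · subst hα
    rw [zero_add, casimir_zero, neg_zero, zero_add, if_pos rfl, casimir_simpleRoot,
      rootPar_simpleRoot, LinearMap.comp_apply]
  · rw [if_neg hα, add_zero]
    have h := casimir_transfer X ε₁ ε₂ (α := α) (β := α + Q.simpleRoot b)
      (P := Q.adR α b (Q.uGen (.e b))) (R := Q.adR (α + Q.simpleRoot b) b (Q.uGen (.e b)))
      (c := -sg (Q.rootPar (α + Q.simpleRoot b)) (Q.par b))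
      (fun x hx => Q.adR_e_rootSpacePos b hx)
      (fun y hy => by
        simpa using Q.adR_e_rootSpaceNeg b (fun h => hα (by simpa using h)) hy)
      (fun x y => by
        rw [adR_apply, adR_apply, Q.invForm_sbr (Or.inl rfl)
          (q := Q.rootPar (α + Q.simpleRoot b)) (by rw [rootPar_add, rootPar_simpleRoot])]
        push_cast
        ring) φ g
    rw [h, neg_smul, neg_neg]

/-- The same adjunction for the lowering operator. At the simple root it is now the positive vector
`e b` that is sent into the Cartan subalgebra. -/
theorem casimir_adR_f (b : Q.Node) (α : Q.Lattice) (φ g : Q.UEnv →ₗ[ℂ] Q.UEnv) :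
    casimir X ε₁ ε₂ (α + Q.simpleRoot b) φ
      (g ∘ₗ Q.adR (α + Q.simpleRoot b) b (Q.uGen (.f b))) =
    -(sg (Q.rootPar α) (Q.par b) • casimir X ε₁ ε₂ α (φ ∘ₗ Q.adR α b (Q.uGen (.f b))) g) +
      if α = 0 then Q.iota ε₁ ε₂ (φ (Q.uGen (.f b))) *
        Q.iota ε₁ ε₂ (g (Q.adR (Q.simpleRoot b) b (Q.uGen (.f b)) (Q.uGen (.e b)))) else 0 := by
  by_cases hα : α = 0
  · subst hα
    rw [zero_add, casimir_zero, smul_zero, neg_zero, zero_add, if_pos rfl, casimir_simpleRoot,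
      LinearMap.comp_apply]
  · rw [if_neg hα, add_zero, ← neg_smul]
    refine casimir_transfer X ε₁ ε₂ (fun x hx => by
        simpa using Q.adR_f_rootSpacePos b (fun h => hα (by simpa using h)) hx)
      (fun y hy => Q.adR_f_rootSpaceNeg b hy)
      (fun x y => ?_) φ g
    rw [adR_apply, adR_apply, Q.invForm_sbr (Or.inr rfl) (q := Q.rootPar α)]
    · push_cast
      ring
    · rw [rootPar_add, rootPar_simpleRoot, add_assoc, CharTwo.add_self_eq_zero, add_zero]

/-- In a Casimir term both factors have the parity `p`, so their product is even and its ordinary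
commutator with `z` splits into two super brackets. -/
theorem commutator_mul {R : Type*} [Ring R] (p q : ZMod 2) (x y z : R) :
    x * y * z - z * (x * y) = x * sbr p q y z + sg p q • (sbr p q x z * y) := by
  simp only [sbr_def, mul_sub, sub_mul, smul_sub, mul_smul_comm, smul_mul_assoc, smul_smul,
    sg_mul_self, one_smul, mul_assoc]
  abel

theorem casimir_commutator (α β : Q.Lattice) (b : Q.Node) (z : Q.UEnv)
    (φ g : Q.UEnv →ₗ[ℂ] Q.UEnv) :
    casimir X ε₁ ε₂ α φ g * Q.iota ε₁ ε₂ z - Q.iota ε₁ ε₂ z * casimir X ε₁ ε₂ α φ g =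
      casimir X ε₁ ε₂ α φ (Q.adR β b z ∘ₗ g) +
        sg (Q.rootPar β) (Q.par b) • casimir X ε₁ ε₂ α (Q.adR β b z ∘ₗ φ) g := by
  unfold casimir
  split_ifs
  · rw [Finset.sum_mul, Finset.mul_sum, Finset.smul_sum, ← Finset.sum_sub_distrib,
      ← Finset.sum_add_distrib]
    refine Finset.sum_congr rfl fun k _ => ?_
    rw [LinearMap.comp_apply, LinearMap.comp_apply, adR_apply, adR_apply, map_sbr, map_sbr]
    exact commutator_mul _ _ _ _ _
  · simp

/-- The two factors have opposite weights. -/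
theorem casimir_commute_h (α : Q.Lattice) (a : Q.Node) :
    Q.psi ε₁ ε₂ a 0 * casimir X ε₁ ε₂ α .id .id = casimir X ε₁ ε₂ α .id .id * Q.psi ε₁ ε₂ a 0 := by
  by_cases h : Q.rootSpacePos α = ⊥
  · rw [casimir_of_eq_bot X ε₁ ε₂ h, mul_zero, zero_mul]
  have hι : Q.iota ε₁ ε₂ (Q.uGen (.h a)) = Q.psi ε₁ ε₂ a 0 := Q.iota_uGen ε₁ ε₂ _
  change _ * casimir X ε₁ ε₂ (⟨α, h⟩ : Q.PosRoot).1 .id .id =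
    casimir X ε₁ ε₂ (⟨α, h⟩ : Q.PosRoot).1 .id .id * _
  rw [casimir_posRoot, Finset.mul_sum, Finset.sum_mul]
  refine Finset.sum_congr rfl fun k _ => ?_
  have h1 := congrArg (Q.iota ε₁ ε₂) (Q.h_rootSpacePos a (X.pos ⟨α, h⟩ k).2)
  have h2 := congrArg (Q.iota ε₁ ε₂) (Q.h_rootSpaceNeg a (X.neg ⟨α, h⟩ k).2)
  simp only [map_sub, map_mul, map_smul, map_neg, hι] at h1 h2
  simp only [LinearMap.id_apply]
  rw [sub_eq_iff_eq_add] at h1 h2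
  rw [← mul_assoc, h2, add_mul, mul_assoc, h1, mul_add, neg_mul, smul_mul_assoc, mul_smul_comm,
    mul_assoc, neg_add_cancel_left]

end Casimir

end Conifold
end QuiverYangian
end

noncomputable section
open scoped LaurentPolynomial
namespace QuiverYangian
namespace Conifold

variable (Q : Conifold)

/-! ### Sums over the positive roots -/

section Sums

/-- Telescoping of a sum over a group along translation by `b`. -/
theorem tsum_telescope {G A : Type*} [AddGroup G] [AddCommGroup A] [Module ℂ A]
    [TopologicalSpace A] [IsTopologicalAddGroup A] [ContinuousConstSMul ℂ A] [T2Space A]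
    {F H : G → A} {D : A} {b : G} {c : G → ℂ} {d : ℂ} [DecidableEq G]
    (hF : Summable F) (hcF : Summable fun x => c x • F x) (hcH : Summable fun x => c x • H x)
    (hH : ∀ x, H (x + b) = -F x + if x = 0 then D else 0) (hc : ∀ x, c (x + b) = c x + d) :
    ∑' x, c x • (F x + H x) = -(d • ∑' x, F x) + (c 0 + d) • D := by
  have hdF : Summable fun x => d • F x := hF.const_smul d
  have h0 : Summable fun x : G => if x = 0 then (c 0 + d) • D else 0 :=
    (hasSum_ite_eq 0 _).summable
  have h1 : ∑' x, c x • H x = -(∑' x, c x • F x) - d • ∑' x, F x + (c 0 + d) • D := by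
    -- Translation is a bijection of the whole group, though not of the set of positive roots; for
    -- this reason Casimir sums are extended by zero to the root lattice.
    rw [← (Equiv.addRight b).tsum_eq fun x => c x • H x]
    have h2 : ∀ x, c (Equiv.addRight b x) • H (Equiv.addRight b x) =
        (-(c x • F x) - d • F x) + if x = 0 then (c 0 + d) • D else 0 := by
      intro x
      rw [Equiv.coe_addRight, hH, hc]
      split_ifs with hx
      · rw [hx]; module
      · module
    simp only [h2]
    rw [(hcF.neg.sub hdF).tsum_add h0, hcF.neg.tsum_sub hdF, tsum_neg, hF.tsum_const_smul,
      tsum_ite_eq]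
  simp only [smul_add]
  rw [hcF.tsum_add hcH, h1]
  abel

variable {Q} (X : Q.DualRootBases) (ε₁ ε₂ : ℂ)

/-- The elements of the root spaces are mapped by `ι ∘ G` to elements of ideals that shrink to zero
as the root grows. -/
def Vanishing (G : Q.Lattice → Q.UEnv →ₗ[ℂ] Q.UEnv) : Prop :=
  ∀ n, {α : Q.PosRoot | ¬ ∀ x ∈ Q.rootSpacePos α,
    Q.iota ε₁ ε₂ (G α x) ∈ Q.leftIdeal ε₁ ε₂ n}.Finite

variable {ε₁ ε₂} in
include X in
theorem vanishing_id : Vanishing ε₁ ε₂ fun _ : Q.Lattice => (.id : Q.UEnv →ₗ[ℂ] Q.UEnv) := by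
  intro n
  refine (Q.posRoot_finite n).subset fun α hα h => hα fun x hx => ?_
  rw [LinearMap.id_apply, X.pos_expand α hx, map_sum]
  refine Submodule.sum_mem _ fun k _ => ?_
  rw [map_smul, Algebra.smul_def]
  exact Submodule.smul_mem _ _ (Q.e_mem_leftIdeal ε₁ ε₂ X α k h)

variable {ε₁ ε₂} in
theorem Vanishing.adR {G : Q.Lattice → Q.UEnv →ₗ[ℂ] Q.UEnv} (hG : Vanishing ε₁ ε₂ G)
    (β : Q.Lattice → Q.Lattice) (b : Q.Node) (z : Q.UEnv) :
    Vanishing ε₁ ε₂ fun α => Q.adR (β α) b z ∘ₗ G α := by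
  intro n
  -- Left multiplication preserves the `n`-th ideal, whereas right multiplication by a fixed element
  -- is only continuous and may cost some depth.
  obtain ⟨m, hm⟩ := Q.leftIdeal_mul_right ε₁ ε₂ (Q.iota ε₁ ε₂ z) n
  refine ((hG m).union (hG n)).subset fun α hα => ?_
  by_contra h
  simp only [Set.mem_union, Set.mem_ofPred_eq, not_or, not_not] at h
  refine hα fun x hx => ?_
  rw [LinearMap.comp_apply, adR_apply, map_sbr]
  exact sub_mem (hm _ (h.1 x hx)) (zsmul_mem (Submodule.smul_mem _ _ (h.2 x hx)) _)

/-- In a nonarchimedean group it suffices that the terms tend to zero. Neighbourhoods are left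
ideals, so the right factors alone decide, and the left factors and the coefficients are arbitrary.
-/
theorem summable_casimir {G : Q.Lattice → Q.UEnv →ₗ[ℂ] Q.UEnv} (hG : Vanishing ε₁ ε₂ G)
    (φ : Q.Lattice → Q.UEnv →ₗ[ℂ] Q.UEnv) (c : Q.Lattice → ℂ) :
    Summable fun α : Q.Lattice => c α • (casimir X ε₁ ε₂ α (φ α) (G α) : Q.Completed ε₁ ε₂) := by
  have hinj : Function.Injective (Subtype.val : Q.PosRoot → Q.Lattice) := Subtype.val_injective
  rw [← hinj.summable_iff]
  · apply NonarchimedeanAddGroup.summable_of_tendsto_cofinite_zero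
    have h0 : Filter.Tendsto (fun α : Q.PosRoot => c α • casimir X ε₁ ε₂ α (φ α) (G α))
        Filter.cofinite (nhds 0) := by
      refine (Q.leftIdeal_basis ε₁ ε₂).hasBasis_nhds_zero.tendsto_right_iff.2 fun n _ => ?_
      rw [Filter.eventually_cofinite]
      refine (hG n).subset fun α hα h => hα ?_
      rw [casimir_posRoot, Algebra.smul_def]
      exact Submodule.smul_mem _ _ (Submodule.sum_mem _ fun k _ =>
        Submodule.smul_mem _ _ (h _ (X.pos α k).2))
    have := (UniformSpace.Completion.continuous_coe (Q.Yangian ε₁ ε₂)).tendsto 0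
    rw [UniformSpace.Completion.coe_zero] at this
    refine (this.comp h0).congr fun α => ?_
    exact UniformSpace.Completion.coe_smul _ _
  · intro α hα
    have : Q.rootSpacePos α = ⊥ := by
      by_contra h
      exact hα ⟨⟨α, h⟩, rfl⟩
    rw [casimir_of_eq_bot X ε₁ ε₂ this, UniformSpace.Completion.coe_zero, smul_zero]

theorem tsum_posRoot_casimir (φ G : Q.Lattice → Q.UEnv →ₗ[ℂ] Q.UEnv) (c : Q.Lattice → ℂ) :
    ∑' α : Q.PosRoot, c α • (casimir X ε₁ ε₂ α (φ α) (G α) : Q.Completed ε₁ ε₂) =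
      ∑' α : Q.Lattice, c α • (casimir X ε₁ ε₂ α (φ α) (G α) : Q.Completed ε₁ ε₂) := by
  refine (Subtype.val_injective : Function.Injective (Subtype.val : Q.PosRoot → Q.Lattice)).tsum_eq
    (f := fun α => c α • (casimir X ε₁ ε₂ α (φ α) (G α) : Q.Completed ε₁ ε₂)) fun α hα => ?_
  by_contra h
  refine hα ?_
  have : Q.rootSpacePos α = ⊥ := by
    by_contra h'
    exact h ⟨⟨α, h'⟩, rfl⟩
  simp only [casimir_of_eq_bot X ε₁ ε₂ this, UniformSpace.Completion.coe_zero, smul_zero]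

theorem tsum_commutator {ι A : Type*} [Ring A] [TopologicalSpace A] [IsTopologicalRing A]
    [T2Space A] {t : ι → A} (ht : Summable t) (z : A) :
    (∑' i, t i) * z - z * ∑' i, t i = ∑' i, (t i * z - z * t i) := by
  rw [(ht.mul_right z).tsum_sub (ht.mul_left z), ht.tsum_mul_right, ht.tsum_mul_left]

end Sums

/-! ### Relations in the Yangian -/

section Relations

variable (ε₁ ε₂ : ℂ)

/-- The symmetric part of the charges is proportional to the Cartan matrix. The corrections in the J
generators remove this part, and only the antisymmetric part is left in `shift`. -/
theorem sigma_add_sigma (a b : Q.Node) :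
    Q.sigma ε₁ ε₂ a b + Q.sigma ε₁ ε₂ b a = (ε₁ + ε₂) * (Q.cartan a b : ℂ) := by
  unfold sigma cartan
  by_cases h : a = b
  · subst h
    simp only [if_true]
    unfold IsEven
    rcases Q.sign_cases a with h | h <;> rcases Q.sign_cases (a + 1) with h' | h' <;>
      simp [h, h'] <;> ring
  · rw [if_neg h, if_neg (Ne.symm h), if_neg h]
    by_cases h1 : b = a + 1
    · subst h1
      rw [if_pos rfl, if_neg (Q.node_ne a).2.1.symm, if_pos rfl, if_pos rfl]
      rcases Q.sign_cases (a + 1) with h' | h' <;> simp [h'] <;> ring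
    · rw [if_neg h1, if_neg h1, if_neg h1]
      by_cases h2 : a = b + 1
      · subst h2
        rw [if_pos rfl, if_pos rfl, if_pos rfl]
        rcases Q.sign_cases (b + 1) with h' | h' <;> simp [h']
      · rw [if_neg h2, if_neg h2, if_neg h2]
        simp

/-- The constant `c⁽ᵃᵇ⁾` for a pair of simple roots. -/
def shift (a b : Q.Node) : ℂ :=
  (Q.cartan a b : ℂ) * (Q.sigma ε₁ ε₂ b a - Q.sigma ε₁ ε₂ a b) / 2

/-- Only adjacent nodes contribute. For `b = a + 1` the difference of the charges is ε₁ - ε₂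
whatever the sign, so the integer is the Cartan entry; exchanging the nodes negates it. -/
theorem shift_eq (a b : Q.Node) : ∃ k : ℤ, Q.shift ε₁ ε₂ a b = (ε₁ - ε₂) / 2 * k := by
  unfold shift sigma cartan
  by_cases h : a = b
  · subst h
    exact ⟨0, by simp⟩
  · rw [if_neg h, if_neg (Ne.symm h), if_neg h]
    by_cases h1 : b = a + 1
    · subst h1
      rw [if_pos rfl, if_neg (Q.node_ne a).2.1.symm, if_pos rfl, if_pos rfl]
      refine ⟨Q.sign (a + 1), ?_⟩
      rcases Q.sign_cases (a + 1) with h' | h' <;> simp [h'] <;> ring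
    · rw [if_neg h1, if_neg h1, if_neg h1]
      by_cases h2 : a = b + 1
      · subst h2
        rw [if_pos rfl, if_pos rfl, if_pos rfl]
        refine ⟨-Q.sign (b + 1), ?_⟩
        rcases Q.sign_cases (b + 1) with h' | h' <;> simp [h'] <;> ring
      · rw [if_neg h2, if_neg h2, if_neg h2]
        exact ⟨0, by simp⟩

theorem par_of_isEven {b : Q.Node} (hb : Q.IsEven b) : Q.par b = 0 := if_pos hb

theorem psi_psi (a b : Q.Node) (n m : ℕ) :
    Q.psi ε₁ ε₂ a n * Q.psi ε₁ ε₂ b m = Q.psi ε₁ ε₂ b m * Q.psi ε₁ ε₂ a n := by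
  have h := Q.mkY_rel (ε₁ := ε₁) (ε₂ := ε₂) (.psiPsi a b n m)
  rw [map_sbr, map_zero, sbr_zero_left, sub_eq_zero] at h
  exact h

theorem psi_zero_e (a b : Q.Node) (m : ℕ) :
    Q.psi ε₁ ε₂ a 0 * Q.e ε₁ ε₂ b m - Q.e ε₁ ε₂ b m * Q.psi ε₁ ε₂ a 0 =
      (Q.cartan a b : ℂ) • Q.e ε₁ ε₂ b m := by
  have h := Q.mkY_rel (ε₁ := ε₁) (ε₂ := ε₂) (.psiE₀ a b m)
  rw [map_sbr, map_smul, sbr_zero_left] at h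
  exact h

theorem psi_zero_f (a b : Q.Node) (m : ℕ) :
    Q.psi ε₁ ε₂ a 0 * Q.f ε₁ ε₂ b m - Q.f ε₁ ε₂ b m * Q.psi ε₁ ε₂ a 0 =
      -((Q.cartan a b : ℂ) • Q.f ε₁ ε₂ b m) := by
  have h := Q.mkY_rel (ε₁ := ε₁) (ε₂ := ε₂) (.psiF₀ a b m)
  rw [map_sbr, map_neg, map_smul, sbr_zero_left] at h
  exact h

theorem psi_one_e (a b : Q.Node) :
    Q.psi ε₁ ε₂ a 1 * Q.e ε₁ ε₂ b 0 - Q.e ε₁ ε₂ b 0 * Q.psi ε₁ ε₂ a 1 =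
      (Q.cartan a b : ℂ) • Q.e ε₁ ε₂ b 1 +
        (Q.sigma ε₁ ε₂ b a • (Q.psi ε₁ ε₂ a 0 * Q.e ε₁ ε₂ b 0) +
          Q.sigma ε₁ ε₂ a b • (Q.e ε₁ ε₂ b 0 * Q.psi ε₁ ε₂ a 0)) := by
  have h := Q.mkY_rel (ε₁ := ε₁) (ε₂ := ε₂) (.psiE a b 0 0)
  simp only [map_sub, map_add, map_smul, map_mul, sbr_zero_left] at h
  rw [sub_eq_iff_eq_add'] at h
  rw [← psi_zero_e]
  exact h

theorem psi_one_f (a b : Q.Node) :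
    Q.psi ε₁ ε₂ a 1 * Q.f ε₁ ε₂ b 0 - Q.f ε₁ ε₂ b 0 * Q.psi ε₁ ε₂ a 1 =
      -((Q.cartan a b : ℂ) • Q.f ε₁ ε₂ b 1) +
        (-(Q.sigma ε₁ ε₂ a b • (Q.psi ε₁ ε₂ a 0 * Q.f ε₁ ε₂ b 0)) -
          Q.sigma ε₁ ε₂ b a • (Q.f ε₁ ε₂ b 0 * Q.psi ε₁ ε₂ a 0)) := by
  have h := Q.mkY_rel (ε₁ := ε₁) (ε₂ := ε₂) (.psiF a b 0 0)
  simp only [map_sub, map_neg, map_smul, map_mul, sbr_zero_left] at h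
  rw [sub_eq_iff_eq_add'] at h
  rw [← psi_zero_f]
  exact h

theorem e_f_ne {a b : Q.Node} (hb : Q.IsEven b) (h : a ≠ b) (n m : ℕ) :
    Q.e ε₁ ε₂ a n * Q.f ε₁ ε₂ b m - Q.f ε₁ ε₂ b m * Q.e ε₁ ε₂ a n = 0 := by
  have h' := Q.mkY_rel (ε₁ := ε₁) (ε₂ := ε₂) (.ef a b n m)
  rw [map_sbr, if_neg h, map_zero, Q.par_of_isEven hb, sbr_zero_right] at h'
  exact h'

theorem f_e_ne {a b : Q.Node} (hb : Q.IsEven b) (h : a ≠ b) (n m : ℕ) :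
    Q.e ε₁ ε₂ b n * Q.f ε₁ ε₂ a m - Q.f ε₁ ε₂ a m * Q.e ε₁ ε₂ b n = 0 := by
  have h' := Q.mkY_rel (ε₁ := ε₁) (ε₂ := ε₂) (.ef b a n m)
  rw [map_sbr, if_neg h.symm, map_zero, Q.par_of_isEven hb, sbr_zero_left] at h'
  exact h'

theorem e_f_self {b : Q.Node} (hb : Q.IsEven b) (n m : ℕ) :
    Q.e ε₁ ε₂ b n * Q.f ε₁ ε₂ b m - Q.f ε₁ ε₂ b m * Q.e ε₁ ε₂ b n = Q.psi ε₁ ε₂ b (m + n) := by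
  have h' := Q.mkY_rel (ε₁ := ε₁) (ε₂ := ε₂) (.ef b b n m)
  rw [map_sbr, if_pos rfl, Q.par_of_isEven hb, sbr_zero_right] at h'
  exact h'

/-- For equal nodes the two brackets of the quadratic relation are negatives of each other, so the
relation is twice the claim. -/
theorem e_one_e_zero {b : Q.Node} (hb : Q.IsEven b) :
    Q.e ε₁ ε₂ b 1 * Q.e ε₁ ε₂ b 0 - Q.e ε₁ ε₂ b 0 * Q.e ε₁ ε₂ b 1 =
      Q.sigma ε₁ ε₂ b b • (Q.e ε₁ ε₂ b 0 * Q.e ε₁ ε₂ b 0) := by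
  by_cases hσ : Q.sigma ε₁ ε₂ b b = 0
  · have h := Q.mkY_rel (.ee₀ b b 1 0 hσ)
    rw [map_sbr, map_zero, Q.par_of_isEven hb, sbr_zero_left] at h
    rw [hσ, zero_smul]
    exact h
  · have h := Q.mkY_rel (.ee b b 0 0 hσ)
    simp only [map_sub, map_add, map_smul, map_mul, Q.par_of_isEven hb,
      sbr_zero_left] at h
    rw [if_neg (by simp), one_mul] at h
    change (Q.e ε₁ ε₂ b 1 * Q.e ε₁ ε₂ b 0 - Q.e ε₁ ε₂ b 0 * Q.e ε₁ ε₂ b 1) -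
      (Q.e ε₁ ε₂ b 0 * Q.e ε₁ ε₂ b 1 - Q.e ε₁ ε₂ b 1 * Q.e ε₁ ε₂ b 0) =
      Q.sigma ε₁ ε₂ b b • (Q.e ε₁ ε₂ b 0 * Q.e ε₁ ε₂ b 0) +
      Q.sigma ε₁ ε₂ b b • (Q.e ε₁ ε₂ b 0 * Q.e ε₁ ε₂ b 0) at h
    refine sub_eq_zero.1 (eq_zero_of_add_self ?_)
    rw [← sub_eq_zero] at h
    rw [← h]
    abel

theorem f_one_f_zero {b : Q.Node} (hb : Q.IsEven b) :
    Q.f ε₁ ε₂ b 1 * Q.f ε₁ ε₂ b 0 - Q.f ε₁ ε₂ b 0 * Q.f ε₁ ε₂ b 1 =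
      -(Q.sigma ε₁ ε₂ b b • (Q.f ε₁ ε₂ b 0 * Q.f ε₁ ε₂ b 0)) := by
  by_cases hσ : Q.sigma ε₁ ε₂ b b = 0
  · have h := Q.mkY_rel (.ff₀ b b 1 0 hσ)
    rw [map_sbr, map_zero, Q.par_of_isEven hb, sbr_zero_left] at h
    rw [hσ, zero_smul, neg_zero]
    exact h
  · have h := Q.mkY_rel (.ff b b 0 0 hσ)
    simp only [map_sub, map_neg, map_smul, map_mul, Q.par_of_isEven hb,
      sbr_zero_left] at h
    rw [if_neg (by simp), one_mul] at h
    change (Q.f ε₁ ε₂ b 1 * Q.f ε₁ ε₂ b 0 - Q.f ε₁ ε₂ b 0 * Q.f ε₁ ε₂ b 1) -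
      (Q.f ε₁ ε₂ b 0 * Q.f ε₁ ε₂ b 1 - Q.f ε₁ ε₂ b 1 * Q.f ε₁ ε₂ b 0) =
      -(Q.sigma ε₁ ε₂ b b • (Q.f ε₁ ε₂ b 0 * Q.f ε₁ ε₂ b 0)) -
      Q.sigma ε₁ ε₂ b b • (Q.f ε₁ ε₂ b 0 * Q.f ε₁ ε₂ b 0) at h
    refine sub_eq_zero.1 (eq_zero_of_add_self ?_)
    rw [← sub_eq_zero] at h
    rw [← h]
    abel

theorem cartan_self_of_isEven {b : Q.Node} (hb : Q.IsEven b) :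
    Q.cartan b b = 2 ∨ Q.cartan b b = -2 := by
  unfold cartan
  unfold IsEven at hb
  rw [if_pos rfl, ← hb]
  rcases Q.sign_cases b with h | h <;> simp [h]

end Relations

end Conifold
end QuiverYangian
end

noncomputable section
open scoped LaurentPolynomial
namespace QuiverYangian
namespace Conifold

variable (Q : Conifold)

/-! ### Commutation relations of the `J` generators -/

section JRelations

variable {Q} (X : Q.DualRootBases) (ε₁ ε₂ : ℂ)

open UniformSpace.Completion

theorem iota_e (a : Q.Node) : Q.iota ε₁ ε₂ (Q.uGen (.e a)) = Q.e ε₁ ε₂ a 0 := Q.iota_uGen ε₁ ε₂ _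

theorem iota_f (a : Q.Node) : Q.iota ε₁ ε₂ (Q.uGen (.f a)) = Q.f ε₁ ε₂ a 0 := Q.iota_uGen ε₁ ε₂ _

theorem iota_h (a : Q.Node) : Q.iota ε₁ ε₂ (Q.uGen (.h a)) = Q.psi ε₁ ε₂ a 0 :=
  Q.iota_uGen ε₁ ε₂ _

/-- `∑_α (α, α⁽ᵃ⁾) ∑_k f⁽ᵅ'ᵏ⁾ e⁽ᵅ'ᵏ⁾` -/
def omegaSum (a : Q.Node) : Q.Completed ε₁ ε₂ :=
  ∑' α : Q.Lattice, (Q.rootForm α (Q.simpleRoot a) : ℂ) •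
    (casimir X ε₁ ε₂ α .id .id : Q.Completed ε₁ ε₂)

/-- `∑_α ∑_k f⁽ᵅ'ᵏ⁾ [e⁽ᵅ'ᵏ⁾, e⁽ᵇ⁾₀]` -/
def eSum (b : Q.Node) : Q.Completed ε₁ ε₂ :=
  ∑' α : Q.Lattice, (casimir X ε₁ ε₂ α .id (Q.adR α b (Q.uGen (.e b))) : Q.Completed ε₁ ε₂)

/-- `-∑_α ∑_k [f⁽ᵇ⁾₀, f⁽ᵅ'ᵏ⁾] e⁽ᵅ'ᵏ⁾` -/
def fSum (b : Q.Node) : Q.Completed ε₁ ε₂ :=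
  ∑' α : Q.Lattice, ((sg (Q.rootPar α) (Q.par b) •
    casimir X ε₁ ε₂ α (Q.adR α b (Q.uGen (.f b))) .id : Q.Yangian ε₁ ε₂) : Q.Completed ε₁ ε₂)

theorem coe_zsmul_casimir (k : ℤ) (x : Q.Yangian ε₁ ε₂) :
    ((k • x : Q.Yangian ε₁ ε₂) : Q.Completed ε₁ ε₂) = (k : ℂ) • (x : Q.Completed ε₁ ε₂) := by
  rw [← Int.cast_smul_eq_zsmul ℂ, UniformSpace.Completion.coe_smul]

theorem summable_omega (a : Q.Node) : Summable fun α : Q.Lattice =>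
    (Q.rootForm α (Q.simpleRoot a) : ℂ) •
      (casimir X ε₁ ε₂ α .id .id : Q.Completed ε₁ ε₂) :=
  summable_casimir X ε₁ ε₂ (vanishing_id X) (fun _ => .id) _

theorem summable_e (b : Q.Node) (c : Q.Lattice → ℂ) : Summable fun α : Q.Lattice =>
    c α • (casimir X ε₁ ε₂ α .id (Q.adR α b (Q.uGen (.e b))) : Q.Completed ε₁ ε₂) :=
  summable_casimir X ε₁ ε₂ ((vanishing_id X).adR (fun α => α) b _) (fun _ => .id) _

theorem summable_f (b : Q.Node) (c : Q.Lattice → ℂ) : Summable fun α : Q.Lattice =>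
    c α • ((sg (Q.rootPar α) (Q.par b) •
      casimir X ε₁ ε₂ α (Q.adR α b (Q.uGen (.f b))) .id : Q.Yangian ε₁ ε₂) :
        Q.Completed ε₁ ε₂) := by
  simp only [coe_zsmul_casimir, smul_smul]
  exact summable_casimir X ε₁ ε₂ (vanishing_id X) (fun α => Q.adR α b (Q.uGen (.f b))) _

theorem v_eq (a : Q.Node) : Q.v ε₁ ε₂ X a = ((ε₁ + ε₂) / 2) • omegaSum X ε₁ ε₂ a -
    ((ε₁ + ε₂) / 2) • ((Q.psi ε₁ ε₂ a 0 : Q.Completed ε₁ ε₂) * (Q.psi ε₁ ε₂ a 0)) := by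
  rw [v, pow_two, coe_mul, omegaSum, ← tsum_posRoot_casimir X ε₁ ε₂ (fun _ => .id) fun _ => .id]
  congr 3
  ext α
  rw [vTerm, casimir_posRoot, ← UniformSpace.Completion.coe_smul]
  rfl

theorem wPos_eq (b : Q.Node) : Q.wPos ε₁ ε₂ X b = -(((ε₁ + ε₂) / 2) • eSum X ε₁ ε₂ b) -
    ((ε₁ + ε₂) / 2) • ((Q.psi ε₁ ε₂ b 0 : Q.Completed ε₁ ε₂) * (Q.e ε₁ ε₂ b 0)) := by
  have h := tsum_posRoot_casimir X ε₁ ε₂ (fun _ => .id)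
    (fun α => Q.adR α b (Q.uGen (.e b))) fun _ => 1
  simp only [one_smul] at h
  rw [wPos, coe_mul, eSum, ← h]
  congr 4
  ext α
  rw [wPosTerm, casimir_posRoot]
  congr 1
  refine Finset.sum_congr rfl fun k _ => ?_
  rw [adR_apply, map_sbr, iota_e]
  rfl

theorem wNeg_eq (b : Q.Node) : Q.wNeg ε₁ ε₂ X b = ((ε₁ + ε₂) / 2) • fSum X ε₁ ε₂ b -
    ((ε₁ + ε₂) / 2) • ((Q.f ε₁ ε₂ b 0 : Q.Completed ε₁ ε₂) * (Q.psi ε₁ ε₂ b 0)) := by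
  have h := tsum_posRoot_casimir X ε₁ ε₂ (fun α => Q.adR α b (Q.uGen (.f b))) (fun _ => .id)
    fun α => (sg (Q.rootPar α) (Q.par b) : ℂ)
  simp only [← coe_zsmul_casimir] at h
  rw [wNeg, coe_mul, fSum, ← h, ← smul_neg, ← tsum_neg]
  congr 3
  ext α
  rw [wNegTerm, casimir_posRoot, ← coe_neg, Finset.smul_sum, ← Finset.sum_neg_distrib]
  congr 1
  refine Finset.sum_congr rfl fun k _ => ?_
  rw [adR_apply, map_sbr, iota_f, sbr_symm, neg_mul, neg_neg, smul_mul_assoc, sg_comm]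
  rfl

theorem rootForm_add_simpleRoot (a b : Q.Node) (α : Q.Lattice) :
    (Q.rootForm (α + Q.simpleRoot b) (Q.simpleRoot a) : ℂ) =
      (Q.rootForm α (Q.simpleRoot a) : ℂ) + (Q.cartan a b : ℂ) := by
  rw [rootForm_add_left, rootForm_simpleRoot, Q.cartan_comm b a]
  push_cast
  rfl

/-- The α-term contributes f[e, e⁽ᵇ⁾₀] and [f, e⁽ᵇ⁾₀]e. The second at α + α⁽ᵇ⁾ is minus the first at
α, except for the boundary term [f⁽ᵇ⁾₀, e⁽ᵇ⁾₀]e⁽ᵇ⁾₀. What remains is exactly what w₊⁽ᵇ⁾ is made of.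
-/
theorem omegaSum_e (a b : Q.Node) :
    omegaSum X ε₁ ε₂ a * (Q.e ε₁ ε₂ b 0 : Q.Completed ε₁ ε₂) -
      (Q.e ε₁ ε₂ b 0 : Q.Completed ε₁ ε₂) * omegaSum X ε₁ ε₂ a =
    -((Q.cartan a b : ℂ) • (eSum X ε₁ ε₂ b +
      (Q.psi ε₁ ε₂ b 0 : Q.Completed ε₁ ε₂) * (Q.e ε₁ ε₂ b 0))) := by
  have hF := summable_e X ε₁ ε₂ b fun _ => 1
  simp only [one_smul] at hF
  have hcF := summable_e X ε₁ ε₂ b fun α => (Q.rootForm α (Q.simpleRoot a) : ℂ)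
  set H : Q.Lattice → Q.Completed ε₁ ε₂ := fun α => ((sg (Q.rootPar α) (Q.par b) •
    casimir X ε₁ ε₂ α (Q.adR α b (Q.uGen (.e b))) .id : Q.Yangian ε₁ ε₂) :
      Q.Completed ε₁ ε₂) with hHdef
  have hcH : Summable fun α => (Q.rootForm α (Q.simpleRoot a) : ℂ) • H α := by
    simp only [hHdef, coe_zsmul_casimir, smul_smul]
    exact summable_casimir X ε₁ ε₂ (vanishing_id X) (fun α => Q.adR α b (Q.uGen (.e b))) _
  have hH : ∀ α, H (α + Q.simpleRoot b) =
      -(casimir X ε₁ ε₂ α .id (Q.adR α b (Q.uGen (.e b))) : Q.Completed ε₁ ε₂) +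
      if α = 0 then -((Q.psi ε₁ ε₂ b 0 : Q.Completed ε₁ ε₂) * (Q.e ε₁ ε₂ b 0)) else 0 := by
    intro α
    have h := casimir_adR_e X ε₁ ε₂ b α .id .id
    rw [LinearMap.id_comp, LinearMap.id_comp] at h
    simp only [hHdef]
    rw [h, coe_add, coe_neg]
    congr 1
    split_ifs
    · rw [adR_apply, rootPar_simpleRoot, sbr_symm, u_ef, if_pos rfl]
      simp only [LinearMap.id_apply]
      rw [map_neg, map_zsmul, neg_mul, smul_mul_assoc, smul_neg, smul_smul, sg_mul_self, one_smul,
        iota_h, iota_e, coe_neg, coe_mul]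
    · rfl
  have ht := tsum_telescope hF hcF hcH hH (rootForm_add_simpleRoot a b)
  -- The weight vanishes at α = 0, so the boundary term is counted with the increment (α⁽ᵃ⁾, α⁽ᵇ⁾)
  -- alone.
  have h0 : (Q.rootForm 0 (Q.simpleRoot a) : ℂ) = 0 := by
    rw [rootForm_comm, rootForm_zero_right, Int.cast_zero]
  rw [h0, zero_add] at ht
  rw [omegaSum, tsum_commutator (summable_omega X ε₁ ε₂ a), eSum, smul_add, neg_add,
    ← smul_neg _ (_ * _), ← ht]
  refine tsum_congr fun α => ?_
  rw [smul_mul_assoc, mul_smul_comm, ← smul_sub, ← coe_mul, ← coe_mul, ← coe_sub, ← iota_e,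
    casimir_commutator X ε₁ ε₂ α α b, LinearMap.comp_id, coe_add]

/-- Mirror image of `omegaSum_e`: the bracket on the left factor survives, with boundary term
f⁽ᵇ⁾₀[e⁽ᵇ⁾₀, f⁽ᵇ⁾₀]. -/
theorem omegaSum_f (a b : Q.Node) :
    omegaSum X ε₁ ε₂ a * (Q.f ε₁ ε₂ b 0 : Q.Completed ε₁ ε₂) -
      (Q.f ε₁ ε₂ b 0 : Q.Completed ε₁ ε₂) * omegaSum X ε₁ ε₂ a =
    (Q.cartan a b : ℂ) • (-fSum X ε₁ ε₂ b +
      (Q.f ε₁ ε₂ b 0 : Q.Completed ε₁ ε₂) * (Q.psi ε₁ ε₂ b 0)) := by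
  have hF := summable_f X ε₁ ε₂ b fun _ => 1
  simp only [one_smul] at hF
  have hcF := summable_f X ε₁ ε₂ b fun α => (Q.rootForm α (Q.simpleRoot a) : ℂ)
  set H : Q.Lattice → Q.Completed ε₁ ε₂ := fun α =>
    (casimir X ε₁ ε₂ α .id (Q.adR α b (Q.uGen (.f b))) : Q.Completed ε₁ ε₂) with hHdef
  have hcH : Summable fun α => (Q.rootForm α (Q.simpleRoot a) : ℂ) • H α :=
    summable_casimir X ε₁ ε₂ ((vanishing_id X).adR (fun α => α) b _) (fun _ => .id) _
  have hH : ∀ α, H (α + Q.simpleRoot b) = -((sg (Q.rootPar α) (Q.par b) •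
      casimir X ε₁ ε₂ α (Q.adR α b (Q.uGen (.f b))) .id : Q.Yangian ε₁ ε₂) :
        Q.Completed ε₁ ε₂) +
      if α = 0 then (Q.f ε₁ ε₂ b 0 : Q.Completed ε₁ ε₂) * (Q.psi ε₁ ε₂ b 0) else 0 := by
    intro α
    have h := casimir_adR_f X ε₁ ε₂ b α .id .id
    rw [LinearMap.id_comp, LinearMap.id_comp] at h
    simp only [hHdef]
    rw [h, coe_add, coe_neg]
    congr 1
    split_ifs
    · rw [adR_apply, rootPar_simpleRoot, u_ef, if_pos rfl]
      simp only [LinearMap.id_apply]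
      rw [iota_h, iota_f, coe_mul]
    · rfl
  have ht := tsum_telescope hF hcF hcH hH (rootForm_add_simpleRoot a b)
  have h0 : (Q.rootForm 0 (Q.simpleRoot a) : ℂ) = 0 := by
    rw [rootForm_comm, rootForm_zero_right, Int.cast_zero]
  rw [h0, zero_add] at ht
  rw [omegaSum, tsum_commutator (summable_omega X ε₁ ε₂ a), fSum, smul_add, smul_neg, ← ht]
  refine tsum_congr fun α => ?_
  rw [smul_mul_assoc, mul_smul_comm, ← smul_sub, ← coe_mul, ← coe_mul, ← coe_sub, ← iota_f,
    casimir_commutator X ε₁ ε₂ α α b, LinearMap.comp_id, add_comm, coe_add]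

theorem adR_of_isEven {b : Q.Node} (hb : Q.IsEven b) (α : Q.Lattice) (z x : Q.UEnv) :
    Q.adR α b z x = x * z - z * x := by
  rw [adR_apply, Q.par_of_isEven hb, sbr_zero_right]

theorem adR_eq_of_isEven {b : Q.Node} (hb : Q.IsEven b) (α β : Q.Lattice) (z : Q.UEnv) :
    Q.adR α b z = Q.adR β b z := by
  ext x
  rw [adR_of_isEven hb, adR_of_isEven hb]

/-- This sum carries no weights, so it telescopes completely; the boundary term contains [e⁽ᵇ⁾₀,
e⁽ᵇ⁾₀] = 0 because `b` is even. -/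
theorem eSum_e {b : Q.Node} (hb : Q.IsEven b) :
    eSum X ε₁ ε₂ b * (Q.e ε₁ ε₂ b 0 : Q.Completed ε₁ ε₂) -
      (Q.e ε₁ ε₂ b 0 : Q.Completed ε₁ ε₂) * eSum X ε₁ ε₂ b = 0 := by
  have hs := summable_e X ε₁ ε₂ b fun _ => 1
  set E := Q.adR 0 b (Q.uGen (.e b)) with hE
  have hE' : ∀ α, Q.adR α b (Q.uGen (.e b)) = E := fun α => adR_eq_of_isEven hb _ _ _
  have hF := summable_casimir X ε₁ ε₂ (((vanishing_id X).adR (fun α => α) b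
    (Q.uGen (.e b))).adR (fun α => α) b (Q.uGen (.e b))) (fun _ => .id) fun _ => 1
  have hH := summable_casimir X ε₁ ε₂ ((vanishing_id X).adR (fun α => α) b
    (Q.uGen (.e b))) (fun α => Q.adR α b (Q.uGen (.e b))) fun _ => 1
  simp only [LinearMap.comp_id, hE', one_smul] at hs hF hH
  have ht := tsum_telescope (c := fun _ => (1 : ℂ)) (d := 0) (D := 0) (b := Q.simpleRoot b) hF
    (by simpa only [one_smul] using hF) (by simpa only [one_smul] using hH) (fun α => by
      have h := casimir_adR_e X ε₁ ε₂ b α .id E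
      simp only [hE', Q.par_of_isEven hb, sg_zero_right, one_smul, LinearMap.id_comp] at h
      rw [h, coe_add, coe_neg]
      congr 1
      split_ifs
      · rw [hE, adR_of_isEven hb 0 _ (Q.uGen (.e b)), sub_self, map_zero, mul_zero, coe_zero]
      · rfl) (by simp)
  simp only [zero_smul, neg_zero, smul_zero, add_zero, one_smul] at ht
  rw [eSum]
  simp only [hE']
  rw [tsum_commutator hs, ← ht]
  refine tsum_congr fun α => ?_
  rw [← coe_mul, ← coe_mul, ← coe_sub, ← iota_e, casimir_commutator X ε₁ ε₂ α 0 b, ← hE,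
    LinearMap.comp_id, Q.par_of_isEven hb, sg_zero_right, one_smul, coe_add]

theorem fSum_f {b : Q.Node} (hb : Q.IsEven b) :
    fSum X ε₁ ε₂ b * (Q.f ε₁ ε₂ b 0 : Q.Completed ε₁ ε₂) -
      (Q.f ε₁ ε₂ b 0 : Q.Completed ε₁ ε₂) * fSum X ε₁ ε₂ b = 0 := by
  have hs := summable_f X ε₁ ε₂ b fun _ => 1
  set E := Q.adR 0 b (Q.uGen (.f b)) with hE
  have hE' : ∀ α, Q.adR α b (Q.uGen (.f b)) = E := fun α => adR_eq_of_isEven hb _ _ _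
  have hF := summable_casimir X ε₁ ε₂ (vanishing_id X) (fun α =>
    Q.adR α b (Q.uGen (.f b)) ∘ₗ Q.adR α b (Q.uGen (.f b))) fun _ => 1
  have hH := summable_casimir X ε₁ ε₂ ((vanishing_id X).adR (fun α => α) b
    (Q.uGen (.f b))) (fun α => Q.adR α b (Q.uGen (.f b))) fun _ => 1
  simp only [LinearMap.comp_id, hE', one_smul, Q.par_of_isEven hb, sg_zero_right] at hs hF hH
  have ht := tsum_telescope (c := fun _ => (1 : ℂ)) (d := 0) (D := 0) (b := Q.simpleRoot b) hF
    (by simpa only [one_smul] using hF) (by simpa only [one_smul] using hH) (fun α => by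
      have h := casimir_adR_f X ε₁ ε₂ b α E .id
      simp only [hE', Q.par_of_isEven hb, sg_zero_right, one_smul, LinearMap.id_comp] at h
      rw [h, coe_add, coe_neg]
      congr 1
      split_ifs
      · rw [hE, adR_of_isEven hb 0 _ (Q.uGen (.f b)), sub_self, map_zero, zero_mul, coe_zero]
      · rfl) (by simp)
  simp only [zero_smul, neg_zero, smul_zero, add_zero, one_smul] at ht
  rw [fSum]
  simp only [hE', Q.par_of_isEven hb, sg_zero_right, one_smul]
  rw [tsum_commutator hs, ← ht]
  refine tsum_congr fun α => ?_
  rw [← coe_mul, ← coe_mul, ← coe_sub, ← iota_f, casimir_commutator X ε₁ ε₂ α 0 b, ← hE,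
    LinearMap.comp_id, Q.par_of_isEven hb, sg_zero_right, one_smul, add_comm, coe_add]

theorem commutator_jacobi {R : Type*} [Ring R] (x y z : R) :
    (x * y - y * x) * z - z * (x * y - y * x) = ((x * z - z * x) * y - y * (x * z - z * x)) -
      ((y * z - z * y) * x - x * (y * z - z * y)) := by
  noncomm_ring

/-- On the right factor, bracketing with e⁽ᵇ⁾₀ and then f⁽ᵇ⁾₀ differs from the opposite order by the
weight (α, α⁽ᵇ⁾), which produces the sum `omegaSum`. The rest telescopes to a boundary term coming
from [[e⁽ᵇ⁾₀, f⁽ᵇ⁾₀], e⁽ᵇ⁾₀]. -/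
theorem eSum_f {b : Q.Node} (hb : Q.IsEven b) :
    eSum X ε₁ ε₂ b * (Q.f ε₁ ε₂ b 0 : Q.Completed ε₁ ε₂) -
      (Q.f ε₁ ε₂ b 0 : Q.Completed ε₁ ε₂) * eSum X ε₁ ε₂ b =
    -omegaSum X ε₁ ε₂ b + (Q.cartan b b : ℂ) •
      ((Q.f ε₁ ε₂ b 0 : Q.Completed ε₁ ε₂) * (Q.e ε₁ ε₂ b 0)) := by
  have hs := summable_e X ε₁ ε₂ b fun _ => 1
  set E := Q.adR 0 b (Q.uGen (.e b)) with hE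
  set F := Q.adR 0 b (Q.uGen (.f b)) with hF
  have hE' : ∀ α, Q.adR α b (Q.uGen (.e b)) = E := fun α => adR_eq_of_isEven hb _ _ _
  have hF' : ∀ α, Q.adR α b (Q.uGen (.f b)) = F := fun α => adR_eq_of_isEven hb _ _ _
  have hs1 := summable_casimir X ε₁ ε₂ ((vanishing_id X).adR (fun α => α) b
    (Q.uGen (.e b))) (fun α => Q.adR α b (Q.uGen (.f b))) fun _ => 1
  have hs2 := summable_casimir X ε₁ ε₂ (((vanishing_id X).adR (fun α => α) b
    (Q.uGen (.f b))).adR (fun α => α) b (Q.uGen (.e b))) (fun _ => .id) fun _ => 1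
  simp only [LinearMap.comp_id, hE', hF', one_smul] at hs hs1 hs2
  have ht := tsum_telescope (c := fun _ => (1 : ℂ)) (d := 0) (b := Q.simpleRoot b)
    (D := (Q.cartan b b : ℂ) • ((Q.f ε₁ ε₂ b 0 : Q.Completed ε₁ ε₂) * (Q.e ε₁ ε₂ b 0))) hs1
    (by simpa only [one_smul] using hs1) (by simpa only [one_smul] using hs2) (fun α => by
      have h := casimir_adR_f X ε₁ ε₂ b α .id E
      simp only [hF', Q.par_of_isEven hb, sg_zero_right, one_smul, LinearMap.id_comp] at h
      rw [h, coe_add, coe_neg]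
      congr 1
      split_ifs
      · have h1 : F (Q.uGen (.e b)) = Q.uGen (.h b) := by
          have := Q.u_ef b b
          rw [if_pos rfl, Q.par_of_isEven hb, sbr_zero_left] at this
          rw [hF, adR_of_isEven hb, this]
        rw [h1, hE, adR_of_isEven hb, u_he, map_smul, LinearMap.id_apply, iota_f, iota_e,
          mul_smul_comm, UniformSpace.Completion.coe_smul, coe_mul]
      · rfl) (by simp)
  simp only [zero_smul, neg_zero, zero_add, add_zero, one_smul] at ht
  have hΩ := summable_omega X ε₁ ε₂ b
  rw [eSum]
  simp only [hE']
  rw [tsum_commutator hs, ← ht, omegaSum, ← tsum_neg, ← hΩ.neg.tsum_add (hs1.add hs2)]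
  refine tsum_congr fun α => ?_
  -- Jacobi identity with [e⁽ᵇ⁾₀, f⁽ᵇ⁾₀] = ψ⁽ᵇ⁾₀, which acts on the root space of α by a scalar; the
  -- sign is that of a bracket taken from the right.
  have hEF : casimir X ε₁ ε₂ α .id (F ∘ₗ E) = casimir X ε₁ ε₂ α .id (E ∘ₗ F) +
      (-(Q.rootForm α (Q.simpleRoot b) : ℂ)) • casimir X ε₁ ε₂ α .id .id := by
    rw [← casimir_smul_right, ← casimir_add_right]
    refine casimir_congr X ε₁ ε₂ (fun _ _ => rfl) fun x hx => ?_
    have h1 := Q.h_rootSpacePos b hx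
    have h2 := Q.u_ef b b
    rw [if_pos rfl, Q.par_of_isEven hb, sbr_zero_left] at h2
    rw [LinearMap.add_apply, LinearMap.smul_apply, LinearMap.comp_apply, LinearMap.comp_apply,
      LinearMap.id_apply, neg_smul, rootForm_comm, ← h1, ← h2, hE, hF, adR_of_isEven hb,
      adR_of_isEven hb, adR_of_isEven hb, adR_of_isEven hb, ← sub_eq_add_neg]
    exact commutator_jacobi _ _ _
  rw [← coe_mul, ← coe_mul, ← coe_sub, ← iota_f, casimir_commutator X ε₁ ε₂ α 0 b, ← hF,
    LinearMap.comp_id, Q.par_of_isEven hb, sg_zero_right, one_smul, hEF, coe_add, coe_add,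
    UniformSpace.Completion.coe_smul, neg_smul]
  abel

theorem psi_omegaSum (a b : Q.Node) :
    omegaSum X ε₁ ε₂ a * (Q.psi ε₁ ε₂ b 0 : Q.Completed ε₁ ε₂) -
      (Q.psi ε₁ ε₂ b 0 : Q.Completed ε₁ ε₂) * omegaSum X ε₁ ε₂ a = 0 := by
  rw [omegaSum, tsum_commutator (summable_omega X ε₁ ε₂ a)]
  refine (tsum_congr fun α => ?_).trans tsum_zero
  rw [smul_mul_assoc, mul_smul_comm, ← coe_mul, ← coe_mul, casimir_commute_h, sub_self]

end JRelations

end Conifold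
end QuiverYangian
end

noncomputable section
open scoped LaurentPolynomial
namespace QuiverYangian
namespace Conifold

variable (Q : Conifold)

/-! ### Ring identities behind the brackets of the J generators -/

section Algebra

variable {A : Type*} [Ring A] [Algebra ℂ A]

/-- Since `s + t = ħ κ`, subtracting `(ħ / 2) • (p₀ * p₀)` replaces the quadratic terms by (s - t)/2
times the commutator of `p₀` and `e₀`, a multiple of `e₀`. This is the origin of the constant
`shift`. -/
theorem commutator_J_e {p₁ p₀ q₀ e₀ e₁ Ω S : A} {κ s t ħ : ℂ}
    (h1 : p₁ * e₀ - e₀ * p₁ = κ • e₁ + (s • (p₀ * e₀) + t • (e₀ * p₀)))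
    (h2 : Ω * e₀ - e₀ * Ω = -(κ • (S + q₀ * e₀))) (h3 : p₀ * e₀ - e₀ * p₀ = κ • e₀)
    (hst : t + s = ħ * κ) :
    (p₁ + ((ħ / 2) • Ω - (ħ / 2) • (p₀ * p₀))) * e₀ -
      e₀ * (p₁ + ((ħ / 2) • Ω - (ħ / 2) • (p₀ * p₀))) =
    κ • (e₁ + (-((ħ / 2) • S) - (ħ / 2) • (q₀ * e₀))) + (κ * (s - t) / 2) • e₀ := by
  have h4 : p₀ * p₀ * e₀ - e₀ * (p₀ * p₀) = κ • (p₀ * e₀) + κ • (e₀ * p₀) := by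
    rw [← mul_smul_comm, ← smul_mul_assoc, ← h3]
    noncomm_ring
  have h5 : e₀ * p₀ = p₀ * e₀ - κ • e₀ := by rw [← h3]; abel
  have h6 : (p₁ + ((ħ / 2) • Ω - (ħ / 2) • (p₀ * p₀))) * e₀ -
      e₀ * (p₁ + ((ħ / 2) • Ω - (ħ / 2) • (p₀ * p₀))) = (p₁ * e₀ - e₀ * p₁) +
      (ħ / 2) • (Ω * e₀ - e₀ * Ω) - (ħ / 2) • (p₀ * p₀ * e₀ - e₀ * (p₀ * p₀)) := by
    simp only [add_mul, sub_mul, mul_add, mul_sub, smul_mul_assoc, mul_smul_comm, smul_sub]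
    abel
  obtain rfl : s = ħ * κ - t := by linear_combination hst
  rw [h6, h1, h2, h4, h5]
  module

theorem commutator_J_f {p₁ p₀ q₀ f₀ f₁ Ω S : A} {κ s t ħ : ℂ}
    (h1 : p₁ * f₀ - f₀ * p₁ = -(κ • f₁) + (-(t • (p₀ * f₀)) - s • (f₀ * p₀)))
    (h2 : Ω * f₀ - f₀ * Ω = κ • (-S + f₀ * q₀)) (h3 : p₀ * f₀ - f₀ * p₀ = -(κ • f₀))
    (hst : t + s = ħ * κ) :
    (p₁ + ((ħ / 2) • Ω - (ħ / 2) • (p₀ * p₀))) * f₀ -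
      f₀ * (p₁ + ((ħ / 2) • Ω - (ħ / 2) • (p₀ * p₀))) =
    -(κ • (f₁ + ((ħ / 2) • S - (ħ / 2) • (f₀ * q₀)))) - (κ * (s - t) / 2) • f₀ := by
  have h4 : p₀ * p₀ * f₀ - f₀ * (p₀ * p₀) = -(κ • (p₀ * f₀)) - κ • (f₀ * p₀) := by
    rw [← mul_smul_comm, ← smul_mul_assoc, ← neg_neg (κ • f₀), ← h3]
    noncomm_ring
  have h5 : p₀ * f₀ = f₀ * p₀ - κ • f₀ := by rw [sub_eq_add_neg, ← h3]; abel
  have h6 : (p₁ + ((ħ / 2) • Ω - (ħ / 2) • (p₀ * p₀))) * f₀ -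
      f₀ * (p₁ + ((ħ / 2) • Ω - (ħ / 2) • (p₀ * p₀))) = (p₁ * f₀ - f₀ * p₁) +
      (ħ / 2) • (Ω * f₀ - f₀ * Ω) - (ħ / 2) • (p₀ * p₀ * f₀ - f₀ * (p₀ * p₀)) := by
    simp only [add_mul, sub_mul, mul_add, mul_sub, smul_mul_assoc, mul_smul_comm, smul_sub]
    abel
  obtain rfl : s = ħ * κ - t := by linear_combination hst
  rw [h6, h1, h2, h4, h5]
  module

/-- The square of `e₀` coming from `e₁` cancels the one coming from `q₀ * e₀`; this fixes the
coefficient of the last term of w₊. -/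
theorem commutator_Je_e {q₀ e₀ e₁ S : A} {κ σ ħ : ℂ}
    (h1 : e₁ * e₀ - e₀ * e₁ = σ • (e₀ * e₀)) (h2 : S * e₀ - e₀ * S = 0)
    (h3 : q₀ * e₀ - e₀ * q₀ = κ • e₀) (hσ : σ + σ = ħ * κ) :
    e₀ * (e₁ + (-((ħ / 2) • S) - (ħ / 2) • (q₀ * e₀))) -
      (e₁ + (-((ħ / 2) • S) - (ħ / 2) • (q₀ * e₀))) * e₀ = 0 := by
  have h6 : e₀ * (e₁ + (-((ħ / 2) • S) - (ħ / 2) • (q₀ * e₀))) -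
      (e₁ + (-((ħ / 2) • S) - (ħ / 2) • (q₀ * e₀))) * e₀ =
      -(e₁ * e₀ - e₀ * e₁) + (ħ / 2) • (S * e₀ - e₀ * S) +
        (ħ / 2) • ((q₀ * e₀ - e₀ * q₀) * e₀) := by
    simp only [add_mul, sub_mul, mul_add, mul_sub, smul_mul_assoc, mul_smul_comm, smul_sub,
      mul_neg, neg_mul, mul_assoc]
    abel
  obtain rfl : σ = ħ * κ / 2 := by linear_combination hσ / 2
  rw [h6, h1, h2, h3, smul_mul_assoc]
  module

theorem commutator_Jf_f {q₀ f₀ f₁ S : A} {κ σ ħ : ℂ}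
    (h1 : f₁ * f₀ - f₀ * f₁ = -(σ • (f₀ * f₀))) (h2 : S * f₀ - f₀ * S = 0)
    (h3 : q₀ * f₀ - f₀ * q₀ = -(κ • f₀)) (hσ : σ + σ = ħ * κ) :
    f₀ * (f₁ + ((ħ / 2) • S - (ħ / 2) • (f₀ * q₀))) -
      (f₁ + ((ħ / 2) • S - (ħ / 2) • (f₀ * q₀))) * f₀ = 0 := by
  have h6 : f₀ * (f₁ + ((ħ / 2) • S - (ħ / 2) • (f₀ * q₀))) -
      (f₁ + ((ħ / 2) • S - (ħ / 2) • (f₀ * q₀))) * f₀ =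
      -(f₁ * f₀ - f₀ * f₁) - (ħ / 2) • (S * f₀ - f₀ * S) +
        (ħ / 2) • (f₀ * (q₀ * f₀ - f₀ * q₀)) := by
    simp only [add_mul, sub_mul, mul_add, mul_sub, smul_mul_assoc, mul_smul_comm, smul_sub,
      mul_assoc]
    abel
  obtain rfl : σ = ħ * κ / 2 := by linear_combination hσ / 2
  rw [h6, h1, h2, h3, mul_neg, mul_smul_comm]
  module

/-- The product `f₀ * e₀` left over from the telescoping cancels against the commutator of `q₀` with
`f₀`, leaving the square of `q₀` required by J(ψ). -/
theorem commutator_Je_f {q₁ q₀ e₀ e₁ f₀ Ω S : A} {κ ħ : ℂ}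
    (h1 : e₁ * f₀ - f₀ * e₁ = q₁) (h2 : S * f₀ - f₀ * S = -Ω + κ • (f₀ * e₀))
    (h3 : q₀ * f₀ - f₀ * q₀ = -(κ • f₀)) (h4 : e₀ * f₀ - f₀ * e₀ = q₀) :
    f₀ * (e₁ + (-((ħ / 2) • S) - (ħ / 2) • (q₀ * e₀))) -
      (e₁ + (-((ħ / 2) • S) - (ħ / 2) • (q₀ * e₀))) * f₀ =
    -(q₁ + ((ħ / 2) • Ω - (ħ / 2) • (q₀ * q₀))) := by
  have h6 : f₀ * (e₁ + (-((ħ / 2) • S) - (ħ / 2) • (q₀ * e₀))) -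
      (e₁ + (-((ħ / 2) • S) - (ħ / 2) • (q₀ * e₀))) * f₀ =
      -(e₁ * f₀ - f₀ * e₁) + (ħ / 2) • (S * f₀ - f₀ * S) +
        (ħ / 2) • (q₀ * (e₀ * f₀ - f₀ * e₀) + (q₀ * f₀ - f₀ * q₀) * e₀) := by
    simp only [add_mul, sub_mul, mul_add, mul_sub, smul_mul_assoc, mul_smul_comm, smul_sub,
      smul_add, mul_neg, neg_mul, mul_assoc]
    abel
  rw [h6, h1, h2, h3, h4, neg_mul, smul_mul_assoc]
  module

end Algebra

/-! ### Brackets of the J generators with the zero modes -/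

section JCommutators

variable {Q} (X : Q.DualRootBases) (ε₁ ε₂ : ℂ)

attribute [local instance] LieRing.ofAssociativeRing

open UniformSpace.Completion

theorem coe_commutator {x y z : Q.Yangian ε₁ ε₂} (h : x * y - y * x = z) :
    ⁅(x : Q.Completed ε₁ ε₂), (y : Q.Completed ε₁ ε₂)⁆ = (z : Q.Completed ε₁ ε₂) := by
  rw [LieRing.of_associative_ring_bracket, ← coe_mul, ← coe_mul, ← coe_sub, h]

theorem lie_psi_e (a b : Q.Node) :
    ⁅(Q.psi ε₁ ε₂ a 0 : Q.Completed ε₁ ε₂), (Q.e ε₁ ε₂ b 0 : Q.Completed ε₁ ε₂)⁆ =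
      (Q.cartan a b : ℂ) • (Q.e ε₁ ε₂ b 0 : Q.Completed ε₁ ε₂) := by
  rw [coe_commutator _ _ (Q.psi_zero_e ε₁ ε₂ a b 0), UniformSpace.Completion.coe_smul]

theorem lie_psi_f (a b : Q.Node) :
    ⁅(Q.psi ε₁ ε₂ a 0 : Q.Completed ε₁ ε₂), (Q.f ε₁ ε₂ b 0 : Q.Completed ε₁ ε₂)⁆ =
      -((Q.cartan a b : ℂ) • (Q.f ε₁ ε₂ b 0 : Q.Completed ε₁ ε₂)) := by
  rw [coe_commutator _ _ (Q.psi_zero_f ε₁ ε₂ a b 0), coe_neg, UniformSpace.Completion.coe_smul]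

theorem lie_psi_psi (a b : Q.Node) (n m : ℕ) :
    ⁅(Q.psi ε₁ ε₂ a n : Q.Completed ε₁ ε₂), (Q.psi ε₁ ε₂ b m : Q.Completed ε₁ ε₂)⁆ = 0 := by
  rw [coe_commutator _ _ (sub_eq_zero.2 (Q.psi_psi ε₁ ε₂ a b n m)), coe_zero]

theorem lie_e_f {b : Q.Node} (hb : Q.IsEven b) (n m : ℕ) :
    ⁅(Q.e ε₁ ε₂ b n : Q.Completed ε₁ ε₂), (Q.f ε₁ ε₂ b m : Q.Completed ε₁ ε₂)⁆ =
      (Q.psi ε₁ ε₂ b (m + n) : Q.Completed ε₁ ε₂) :=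
  coe_commutator _ _ (Q.e_f_self ε₁ ε₂ hb n m)

theorem lie_Jpsi_e (a b : Q.Node) :
    ⁅Q.Jpsi ε₁ ε₂ X a, (Q.e ε₁ ε₂ b 0 : Q.Completed ε₁ ε₂)⁆ =
      (Q.cartan a b : ℂ) • Q.Je ε₁ ε₂ X b +
        Q.shift ε₁ ε₂ a b • (Q.e ε₁ ε₂ b 0 : Q.Completed ε₁ ε₂) := by
  rw [LieRing.of_associative_ring_bracket, Jpsi, Je, v_eq, wPos_eq]
  refine commutator_J_e ?_ (omegaSum_e X ε₁ ε₂ a b) (lie_psi_e ε₁ ε₂ a b)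
    (Q.sigma_add_sigma ε₁ ε₂ a b)
  have h := congrArg (fun x : Q.Yangian ε₁ ε₂ => (x : Q.Completed ε₁ ε₂)) (Q.psi_one_e ε₁ ε₂ a b)
  simpa only [coe_sub, coe_add, coe_mul, UniformSpace.Completion.coe_smul] using h

theorem lie_Jpsi_f (a b : Q.Node) :
    ⁅Q.Jpsi ε₁ ε₂ X a, (Q.f ε₁ ε₂ b 0 : Q.Completed ε₁ ε₂)⁆ =
      -((Q.cartan a b : ℂ) • Q.Jf ε₁ ε₂ X b) -
        Q.shift ε₁ ε₂ a b • (Q.f ε₁ ε₂ b 0 : Q.Completed ε₁ ε₂) := by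
  rw [LieRing.of_associative_ring_bracket, Jpsi, Jf, v_eq, wNeg_eq]
  refine commutator_J_f ?_ (omegaSum_f X ε₁ ε₂ a b) (lie_psi_f ε₁ ε₂ a b)
    (Q.sigma_add_sigma ε₁ ε₂ a b)
  have h := congrArg (fun x : Q.Yangian ε₁ ε₂ => (x : Q.Completed ε₁ ε₂)) (Q.psi_one_f ε₁ ε₂ a b)
  simpa only [coe_sub, coe_add, coe_neg, coe_mul, UniformSpace.Completion.coe_smul] using h

theorem lie_e_Je {b : Q.Node} (hb : Q.IsEven b) :
    ⁅(Q.e ε₁ ε₂ b 0 : Q.Completed ε₁ ε₂), Q.Je ε₁ ε₂ X b⁆ = 0 := by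
  rw [LieRing.of_associative_ring_bracket, Je, wPos_eq]
  refine commutator_Je_e ?_ (eSum_e X ε₁ ε₂ hb) (lie_psi_e ε₁ ε₂ b b)
    (Q.sigma_add_sigma ε₁ ε₂ b b)
  have h := congrArg (fun x : Q.Yangian ε₁ ε₂ => (x : Q.Completed ε₁ ε₂)) (Q.e_one_e_zero ε₁ ε₂ hb)
  simpa only [coe_sub, coe_mul, UniformSpace.Completion.coe_smul] using h

theorem lie_f_Jf {b : Q.Node} (hb : Q.IsEven b) :
    ⁅(Q.f ε₁ ε₂ b 0 : Q.Completed ε₁ ε₂), Q.Jf ε₁ ε₂ X b⁆ = 0 := by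
  rw [LieRing.of_associative_ring_bracket, Jf, wNeg_eq]
  refine commutator_Jf_f ?_ (fSum_f X ε₁ ε₂ hb) (lie_psi_f ε₁ ε₂ b b)
    (Q.sigma_add_sigma ε₁ ε₂ b b)
  have h := congrArg (fun x : Q.Yangian ε₁ ε₂ => (x : Q.Completed ε₁ ε₂)) (Q.f_one_f_zero ε₁ ε₂ hb)
  simpa only [coe_sub, coe_neg, coe_mul, UniformSpace.Completion.coe_smul] using h

theorem lie_f_Je {b : Q.Node} (hb : Q.IsEven b) :
    ⁅(Q.f ε₁ ε₂ b 0 : Q.Completed ε₁ ε₂), Q.Je ε₁ ε₂ X b⁆ = -Q.Jpsi ε₁ ε₂ X b := by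
  rw [LieRing.of_associative_ring_bracket, Je, wPos_eq, Jpsi, v_eq]
  exact commutator_Je_f (lie_e_f ε₁ ε₂ hb 1 0) (eSum_f X ε₁ ε₂ hb) (lie_psi_f ε₁ ε₂ b b)
    (lie_e_f ε₁ ε₂ hb 0 0)

theorem lie_psi_Jpsi (a b : Q.Node) :
    ⁅(Q.psi ε₁ ε₂ a 0 : Q.Completed ε₁ ε₂), Q.Jpsi ε₁ ε₂ X b⁆ = 0 := by
  have h1 : ⁅(Q.psi ε₁ ε₂ a 0 : Q.Completed ε₁ ε₂), omegaSum X ε₁ ε₂ b⁆ = 0 := by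
    rw [← lie_skew, LieRing.of_associative_ring_bracket, psi_omegaSum, neg_zero]
  have h2 : ⁅(Q.psi ε₁ ε₂ a 0 : Q.Completed ε₁ ε₂),
      (Q.psi ε₁ ε₂ b 0 : Q.Completed ε₁ ε₂) * (Q.psi ε₁ ε₂ b 0)⁆ = 0 := by
    have h := lie_psi_psi ε₁ ε₂ a b 0 0
    rw [LieRing.of_associative_ring_bracket, sub_eq_zero] at h ⊢
    rw [← mul_assoc, h, mul_assoc, h, mul_assoc]
  rw [Jpsi, v_eq, lie_add, lie_sub, lie_smul, lie_smul, h1, h2, lie_psi_psi]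
  simp

theorem exists_cartan_ne_zero (i : Q.Node) : ∃ a, Q.cartan a i ≠ 0 := by
  -- A neighbour is used because the diagonal entry vanishes at an odd node.
  refine ⟨i + 1, ?_⟩
  rw [cartan_comm, cartan, if_neg (Q.node_ne i).1.symm, if_pos rfl]
  rcases Q.sign_cases (i + 1) with h | h <;> simp [h]

/-- Expressing J(e) through J(ψ) and e lets its weight and its integrability follow from closure
under brackets, with no Serre relation for J(e) itself. -/
theorem Je_eq {a i : Q.Node} (h : Q.cartan a i ≠ 0) : Q.Je ε₁ ε₂ X i =
    (Q.cartan a i : ℂ)⁻¹ • (⁅Q.Jpsi ε₁ ε₂ X a, (Q.e ε₁ ε₂ i 0 : Q.Completed ε₁ ε₂)⁆ -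
      Q.shift ε₁ ε₂ a i • (Q.e ε₁ ε₂ i 0 : Q.Completed ε₁ ε₂)) := by
  rw [lie_Jpsi_e, add_sub_cancel_right, inv_smul_smul₀ (by exact_mod_cast h)]

theorem Jf_eq {a i : Q.Node} (h : Q.cartan a i ≠ 0) : Q.Jf ε₁ ε₂ X i =
    -((Q.cartan a i : ℂ)⁻¹ • (⁅Q.Jpsi ε₁ ε₂ X a, (Q.f ε₁ ε₂ i 0 : Q.Completed ε₁ ε₂)⁆ +
      Q.shift ε₁ ε₂ a i • (Q.f ε₁ ε₂ i 0 : Q.Completed ε₁ ε₂))) := by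
  rw [lie_Jpsi_f, sub_add_cancel, smul_neg, neg_neg, inv_smul_smul₀ (by exact_mod_cast h)]

theorem lie_psi_Je (a i : Q.Node) :
    ⁅(Q.psi ε₁ ε₂ a 0 : Q.Completed ε₁ ε₂), Q.Je ε₁ ε₂ X i⁆ =
      (Q.cartan a i : ℂ) • Q.Je ε₁ ε₂ X i := by
  obtain ⟨b, hb⟩ := Q.exists_cartan_ne_zero i
  rw [Je_eq X ε₁ ε₂ hb, lie_smul, lie_sub, lie_smul, leibniz_lie, lie_psi_Jpsi, lie_psi_e,
    zero_lie, zero_add, lie_smul]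
  module

theorem lie_psi_Jf (a i : Q.Node) :
    ⁅(Q.psi ε₁ ε₂ a 0 : Q.Completed ε₁ ε₂), Q.Jf ε₁ ε₂ X i⁆ =
      -((Q.cartan a i : ℂ) • Q.Jf ε₁ ε₂ X i) := by
  obtain ⟨b, hb⟩ := Q.exists_cartan_ne_zero i
  rw [Jf_eq X ε₁ ε₂ hb, lie_neg, lie_smul, lie_add, lie_smul, leibniz_lie, lie_psi_Jpsi, lie_psi_f,
    zero_lie, zero_add, lie_neg, lie_smul]
  module

end JCommutators

end Conifold
end QuiverYangian
end

noncomputable section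
open scoped LaurentPolynomial
namespace QuiverYangian
namespace Conifold

variable (Q : Conifold)

section Reflections

variable {Q} (X : Q.DualRootBases) (ε₁ ε₂ : ℂ)

attribute [local instance] LieRing.ofAssociativeRing

/-! ### Integrable elements -/

theorem AdNilpotent.smul_left {A : Type*} [Ring A] [Algebra ℂ A] (c : ℂ) {x y : A}
    (h : AdNilpotent x y) : AdNilpotent (c • x) y := by
  obtain ⟨n, hn⟩ := h
  refine ⟨n, ?_⟩
  rw [iterate_ad_eq] at hn ⊢
  rw [map_smul, smul_pow, LinearMap.smul_apply, hn, smul_zero]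

variable (Q) in
/-- The elements on which all `ad e⁽ᵇ⁾₀` and `ad f⁽ᵇ⁾₀`, for `b` even, act nilpotently. -/
def integrable : LieSubalgebra ℂ (Q.Completed ε₁ ε₂) where
  carrier := {y | ∀ b, Q.IsEven b →
    AdNilpotent (Q.tauE ε₁ ε₂ b) y ∧ AdNilpotent (Q.tauF ε₁ ε₂ b) y}
  zero_mem' _ _ := ⟨(adNilpotents _).zero_mem, (adNilpotents _).zero_mem⟩
  add_mem' hy hz b hb := ⟨(adNilpotents _).add_mem (hy b hb).1 (hz b hb).1,
    (adNilpotents _).add_mem (hy b hb).2 (hz b hb).2⟩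
  smul_mem' c _ hy b hb := ⟨(adNilpotents _).smul_mem c (hy b hb).1,
    (adNilpotents _).smul_mem c (hy b hb).2⟩
  lie_mem' hy hz b hb := ⟨(adNilpotents _).lie_mem (hy b hb).1 (hz b hb).1,
    (adNilpotents _).lie_mem (hy b hb).2 (hz b hb).2⟩

theorem lie_e_ne {a b : Q.Node} (hb : Q.IsEven b) (h : a ≠ b) :
    ⁅(Q.e ε₁ ε₂ b 0 : Q.Completed ε₁ ε₂), (Q.f ε₁ ε₂ a 0 : Q.Completed ε₁ ε₂)⁆ = 0 := by
  rw [coe_commutator _ _ (Q.f_e_ne ε₁ ε₂ hb h 0 0), UniformSpace.Completion.coe_zero]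

theorem lie_f_ne {a b : Q.Node} (hb : Q.IsEven b) (h : a ≠ b) :
    ⁅(Q.f ε₁ ε₂ b 0 : Q.Completed ε₁ ε₂), (Q.e ε₁ ε₂ a 0 : Q.Completed ε₁ ε₂)⁆ = 0 := by
  rw [← lie_skew, coe_commutator _ _ (Q.e_f_ne ε₁ ε₂ hb h 0 0), UniformSpace.Completion.coe_zero,
    neg_zero]

theorem lie_e_psi (a b : Q.Node) :
    ⁅(Q.e ε₁ ε₂ b 0 : Q.Completed ε₁ ε₂), (Q.psi ε₁ ε₂ a 0 : Q.Completed ε₁ ε₂)⁆ =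
      -((Q.cartan a b : ℂ) • (Q.e ε₁ ε₂ b 0 : Q.Completed ε₁ ε₂)) := by
  rw [← lie_skew, lie_psi_e]

theorem lie_f_psi (a b : Q.Node) :
    ⁅(Q.f ε₁ ε₂ b 0 : Q.Completed ε₁ ε₂), (Q.psi ε₁ ε₂ a 0 : Q.Completed ε₁ ε₂)⁆ =
      (Q.cartan a b : ℂ) • (Q.f ε₁ ε₂ b 0 : Q.Completed ε₁ ε₂) := by
  rw [← lie_skew, lie_psi_f, neg_neg]

theorem cartan_eq_zero_of_ne {a b : Q.Node} (h : a ≠ b) (h1 : b ≠ a + 1) (h2 : b ≠ a - 1) :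
    Q.cartan a b = 0 := by
  rw [cartan, if_neg h, if_neg h1, if_neg fun h3 => h2 (by rw [h3]; ring)]

/-- At zero modes the symmetrized Serre relation is twice this double bracket. Equal or non-adjacent
nodes already commute at the first bracket. -/
theorem lie_e_e {a b : Q.Node} (hb : Q.IsEven b) :
    ⁅(Q.e ε₁ ε₂ b 0 : Q.Completed ε₁ ε₂), ⁅(Q.e ε₁ ε₂ b 0 : Q.Completed ε₁ ε₂),
      (Q.e ε₁ ε₂ a 0 : Q.Completed ε₁ ε₂)⁆⁆ = 0 := by
  by_cases hab : b = a
  · subst hab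
    rw [lie_self, lie_zero]
  by_cases hn : a = b + 1 ∨ a = b - 1
  · have h := Q.mkY_rel (ε₁ := ε₁) (ε₂ := ε₂) (.serreE b a 0 0 0 hb hn)
    rw [map_add, map_zero] at h
    have h' := eq_zero_of_add_self h
    rw [map_sbr, map_sbr, Q.par_of_isEven hb, sbr_zero_left, sbr_zero_left] at h'
    have h'' : Q.e ε₁ ε₂ b 0 * (Q.e ε₁ ε₂ b 0 * Q.e ε₁ ε₂ a 0 - Q.e ε₁ ε₂ a 0 * Q.e ε₁ ε₂ b 0) -
        (Q.e ε₁ ε₂ b 0 * Q.e ε₁ ε₂ a 0 - Q.e ε₁ ε₂ a 0 * Q.e ε₁ ε₂ b 0) * Q.e ε₁ ε₂ b 0 = 0 := h'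
    rw [coe_commutator _ _ rfl, coe_commutator _ _ h'', UniformSpace.Completion.coe_zero]
  · push Not at hn
    have hσ := Q.sigma_eq_zero ε₁ ε₂ (cartan_eq_zero_of_ne hab hn.1 hn.2)
    have h := Q.mkY_rel (.ee₀ b a 0 0 hσ)
    rw [map_sbr, map_zero, Q.par_of_isEven hb, sbr_zero_left] at h
    have h' : Q.e ε₁ ε₂ b 0 * Q.e ε₁ ε₂ a 0 - Q.e ε₁ ε₂ a 0 * Q.e ε₁ ε₂ b 0 = 0 := h
    rw [coe_commutator _ _ h', UniformSpace.Completion.coe_zero, lie_zero]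

theorem lie_f_f {a b : Q.Node} (hb : Q.IsEven b) :
    ⁅(Q.f ε₁ ε₂ b 0 : Q.Completed ε₁ ε₂), ⁅(Q.f ε₁ ε₂ b 0 : Q.Completed ε₁ ε₂),
      (Q.f ε₁ ε₂ a 0 : Q.Completed ε₁ ε₂)⁆⁆ = 0 := by
  by_cases hab : b = a
  · subst hab
    rw [lie_self, lie_zero]
  by_cases hn : a = b + 1 ∨ a = b - 1
  · have h := Q.mkY_rel (ε₁ := ε₁) (ε₂ := ε₂) (.serreF b a 0 0 0 hb hn)
    rw [map_add, map_zero] at h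
    have h' := eq_zero_of_add_self h
    rw [map_sbr, map_sbr, Q.par_of_isEven hb, sbr_zero_left, sbr_zero_left] at h'
    have h'' : Q.f ε₁ ε₂ b 0 * (Q.f ε₁ ε₂ b 0 * Q.f ε₁ ε₂ a 0 - Q.f ε₁ ε₂ a 0 * Q.f ε₁ ε₂ b 0) -
        (Q.f ε₁ ε₂ b 0 * Q.f ε₁ ε₂ a 0 - Q.f ε₁ ε₂ a 0 * Q.f ε₁ ε₂ b 0) * Q.f ε₁ ε₂ b 0 = 0 := h'
    rw [coe_commutator _ _ rfl, coe_commutator _ _ h'', UniformSpace.Completion.coe_zero]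
  · push Not at hn
    have hσ := Q.sigma_eq_zero ε₁ ε₂ (cartan_eq_zero_of_ne hab hn.1 hn.2)
    have h := Q.mkY_rel (.ff₀ b a 0 0 hσ)
    rw [map_sbr, map_zero, Q.par_of_isEven hb, sbr_zero_left] at h
    have h' : Q.f ε₁ ε₂ b 0 * Q.f ε₁ ε₂ a 0 - Q.f ε₁ ε₂ a 0 * Q.f ε₁ ε₂ b 0 = 0 := h
    rw [coe_commutator _ _ h', UniformSpace.Completion.coe_zero, lie_zero]

theorem psi_mem_integrable (a : Q.Node) :
    (Q.psi ε₁ ε₂ a 0 : Q.Completed ε₁ ε₂) ∈ Q.integrable ε₁ ε₂ := fun b _ =>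
  ⟨adNilpotent_of_lie_lie_eq_zero (by
      rw [tauE, lie_e_psi, lie_neg, lie_smul, lie_self, smul_zero, neg_zero]),
    (adNilpotent_of_lie_lie_eq_zero (by
      rw [lie_f_psi, lie_smul, lie_self, smul_zero])).smul_left _⟩

theorem e_mem_integrable (a : Q.Node) :
    (Q.e ε₁ ε₂ a 0 : Q.Completed ε₁ ε₂) ∈ Q.integrable ε₁ ε₂ := fun b hb =>
  ⟨adNilpotent_of_lie_lie_eq_zero (lie_e_e ε₁ ε₂ hb), by
    refine AdNilpotent.smul_left _ ?_
    by_cases h : a = b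
    · subst h
      refine adNilpotent_of_lie_lie_lie_eq_zero ?_
      rw [← lie_skew _ (Q.e ε₁ ε₂ a 0 : Q.Completed ε₁ ε₂), lie_e_f ε₁ ε₂ hb, lie_neg, lie_f_psi,
        lie_neg, lie_smul, lie_self, smul_zero, neg_zero]
    · exact adNilpotent_of_lie_eq_zero (lie_f_ne ε₁ ε₂ hb h)⟩

theorem f_mem_integrable (a : Q.Node) :
    (Q.f ε₁ ε₂ a 0 : Q.Completed ε₁ ε₂) ∈ Q.integrable ε₁ ε₂ := fun b hb =>
  ⟨by
    by_cases h : a = b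
    · subst h
      refine adNilpotent_of_lie_lie_lie_eq_zero ?_
      rw [tauE, lie_e_f ε₁ ε₂ hb, lie_e_psi, lie_neg, lie_smul, lie_self, smul_zero, neg_zero]
    · exact adNilpotent_of_lie_eq_zero (lie_e_ne ε₁ ε₂ hb h),
    (adNilpotent_of_lie_lie_eq_zero (lie_f_f ε₁ ε₂ hb)).smul_left _⟩

theorem lie_e_Jpsi (a b : Q.Node) :
    ⁅(Q.e ε₁ ε₂ b 0 : Q.Completed ε₁ ε₂), Q.Jpsi ε₁ ε₂ X a⁆ =
      -((Q.cartan a b : ℂ) • Q.Je ε₁ ε₂ X b +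
        Q.shift ε₁ ε₂ a b • (Q.e ε₁ ε₂ b 0 : Q.Completed ε₁ ε₂)) := by
  rw [← lie_skew, lie_Jpsi_e]

theorem lie_f_Jpsi (a b : Q.Node) :
    ⁅(Q.f ε₁ ε₂ b 0 : Q.Completed ε₁ ε₂), Q.Jpsi ε₁ ε₂ X a⁆ =
      (Q.cartan a b : ℂ) • Q.Jf ε₁ ε₂ X b +
        Q.shift ε₁ ε₂ a b • (Q.f ε₁ ε₂ b 0 : Q.Completed ε₁ ε₂) := by
  rw [← lie_skew, lie_Jpsi_f]
  abel

/-- One bracket leads to a combination of J(e⁽ᵇ⁾₀) and e⁽ᵇ⁾₀, both of which commute with e⁽ᵇ⁾₀;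
similarly for f. -/
theorem Jpsi_mem_integrable (a : Q.Node) : Q.Jpsi ε₁ ε₂ X a ∈ Q.integrable ε₁ ε₂ := fun b hb =>
  ⟨adNilpotent_of_lie_lie_eq_zero (by
      rw [tauE, lie_e_Jpsi, lie_neg, lie_add, lie_smul, lie_smul, lie_self, lie_e_Je X ε₁ ε₂ hb]
      simp),
    (adNilpotent_of_lie_lie_eq_zero (by
      rw [lie_f_Jpsi, lie_add, lie_smul, lie_smul, lie_self, lie_f_Jf X ε₁ ε₂ hb]
      simp)).smul_left _⟩

theorem Je_mem_integrable (i : Q.Node) : Q.Je ε₁ ε₂ X i ∈ Q.integrable ε₁ ε₂ := by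
  obtain ⟨a, ha⟩ := Q.exists_cartan_ne_zero i
  rw [Je_eq X ε₁ ε₂ ha]
  exact (Q.integrable ε₁ ε₂).smul_mem _ (sub_mem ((Q.integrable ε₁ ε₂).lie_mem
    (Jpsi_mem_integrable X ε₁ ε₂ a) (e_mem_integrable ε₁ ε₂ i))
    ((Q.integrable ε₁ ε₂).smul_mem _ (e_mem_integrable ε₁ ε₂ i)))

theorem Jf_mem_integrable (i : Q.Node) : Q.Jf ε₁ ε₂ X i ∈ Q.integrable ε₁ ε₂ := by
  obtain ⟨a, ha⟩ := Q.exists_cartan_ne_zero i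
  rw [Jf_eq X ε₁ ε₂ ha]
  exact neg_mem ((Q.integrable ε₁ ε₂).smul_mem _ (add_mem ((Q.integrable ε₁ ε₂).lie_mem
    (Jpsi_mem_integrable X ε₁ ε₂ a) (f_mem_integrable ε₁ ε₂ i))
    ((Q.integrable ε₁ ε₂).smul_mem _ (f_mem_integrable ε₁ ε₂ i))))

/-! ### The automorphisms `τ⁽ᵇ⁾` -/

variable {ε₁ ε₂} {b : Q.Node} {y z : Q.Completed ε₁ ε₂}

theorem expAd_tauE_mem (hb : Q.IsEven b) (hy : y ∈ Q.integrable ε₁ ε₂) :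
    expAd (Q.tauE ε₁ ε₂ b) y ∈ Q.integrable ε₁ ε₂ :=
  expAd_mem (e_mem_integrable ε₁ ε₂ b) hy (hy b hb).1

theorem expAd_tauF_mem (hb : Q.IsEven b) (hy : y ∈ Q.integrable ε₁ ε₂) :
    expAd (Q.tauF ε₁ ε₂ b) y ∈ Q.integrable ε₁ ε₂ :=
  expAd_mem ((Q.integrable ε₁ ε₂).smul_mem _ (f_mem_integrable ε₁ ε₂ b)) hy (hy b hb).2

theorem tau_mem_integrable (hb : Q.IsEven b) (hy : y ∈ Q.integrable ε₁ ε₂) :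
    Q.tau ε₁ ε₂ b y ∈ Q.integrable ε₁ ε₂ :=
  expAd_tauE_mem hb (expAd_tauF_mem hb (expAd_tauE_mem hb hy))

theorem tauDefined_of_mem (hb : Q.IsEven b) (hy : y ∈ Q.integrable ε₁ ε₂) :
    Q.TauDefined ε₁ ε₂ b y :=
  ⟨(hy b hb).1, (expAd_tauE_mem hb hy b hb).2,
    (expAd_tauF_mem hb (expAd_tauE_mem hb hy) b hb).1⟩

theorem tau_add (hb : Q.IsEven b) (hy : y ∈ Q.integrable ε₁ ε₂) (hz : z ∈ Q.integrable ε₁ ε₂) :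
    Q.tau ε₁ ε₂ b (y + z) = Q.tau ε₁ ε₂ b y + Q.tau ε₁ ε₂ b z := by
  obtain ⟨h1, h2, h3⟩ := tauDefined_of_mem hb hy
  obtain ⟨k1, k2, k3⟩ := tauDefined_of_mem hb hz
  rw [tau, expAd_add h1 k1, expAd_add h2 k2, expAd_add h3 k3]
  rfl

theorem tau_smul (hb : Q.IsEven b) (c : ℂ) (hy : y ∈ Q.integrable ε₁ ε₂) :
    Q.tau ε₁ ε₂ b (c • y) = c • Q.tau ε₁ ε₂ b y := by
  obtain ⟨h1, h2, h3⟩ := tauDefined_of_mem hb hy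
  rw [tau, expAd_smul c h1, expAd_smul c h2, expAd_smul c h3]
  rfl

theorem tau_lie (hb : Q.IsEven b) (hy : y ∈ Q.integrable ε₁ ε₂) (hz : z ∈ Q.integrable ε₁ ε₂) :
    Q.tau ε₁ ε₂ b ⁅y, z⁆ = ⁅Q.tau ε₁ ε₂ b y, Q.tau ε₁ ε₂ b z⁆ := by
  obtain ⟨h1, h2, h3⟩ := tauDefined_of_mem hb hy
  obtain ⟨k1, k2, k3⟩ := tauDefined_of_mem hb hz
  rw [tau, expAd_lie h1 k1, expAd_lie h2 k2, expAd_lie h3 k3]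
  rfl

theorem tau_of_lie_eq_zero (he : ⁅(Q.e ε₁ ε₂ b 0 : Q.Completed ε₁ ε₂), y⁆ = 0)
    (hf : ⁅(Q.f ε₁ ε₂ b 0 : Q.Completed ε₁ ε₂), y⁆ = 0) : Q.tau ε₁ ε₂ b y = y := by
  have hf' : ⁅Q.tauF ε₁ ε₂ b, y⁆ = 0 := by rw [tauF, smul_lie, hf, smul_zero]
  have he' : ⁅Q.tauE ε₁ ε₂ b, y⁆ = 0 := he
  rw [tau, expAd_of_lie_eq_zero he', expAd_of_lie_eq_zero hf', expAd_of_lie_eq_zero he']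

theorem cartan_self_ne_zero (hb : Q.IsEven b) : (Q.cartan b b : ℂ) ≠ 0 := by
  rcases Q.cartan_self_of_isEven hb with h | h <;> simp [h]

theorem shift_self (ε₁ ε₂ : ℂ) (b : Q.Node) : Q.shift ε₁ ε₂ b b = 0 := by simp [shift]

theorem tau_psi_self (hb : Q.IsEven b) :
    Q.tau ε₁ ε₂ b (Q.psi ε₁ ε₂ b 0 : Q.Completed ε₁ ε₂) = -(Q.psi ε₁ ε₂ b 0 : Q.Completed ε₁ ε₂) :=
  expAd_reflection (cartan_self_ne_zero hb) (lie_e_psi ε₁ ε₂ b b) (lie_self _)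
    (lie_f_psi ε₁ ε₂ b b) (lie_self _) (by rw [← lie_skew, lie_e_f ε₁ ε₂ hb])

/-- The antisymmetric charge vanishes at equal nodes, so no constant spoils the relations of the
three-dimensional module. -/
theorem tau_Jpsi_self (hb : Q.IsEven b) :
    Q.tau ε₁ ε₂ b (Q.Jpsi ε₁ ε₂ X b) = -Q.Jpsi ε₁ ε₂ X b :=
  expAd_reflection (cartan_self_ne_zero hb)
    (by rw [tauE, lie_e_Jpsi, shift_self, zero_smul, add_zero]) (lie_e_Je X ε₁ ε₂ hb)
    (by rw [lie_f_Jpsi, shift_self, zero_smul, add_zero]) (lie_f_Jf X ε₁ ε₂ hb)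
    (lie_f_Je X ε₁ ε₂ hb)

/-- ψ⁽ᵃ⁾₀ is the sum of an element commuting with e⁽ᵇ⁾₀ and f⁽ᵇ⁾₀, hence fixed, and a multiple of
ψ⁽ᵇ⁾₀, which changes sign. -/
theorem tau_psi (hb : Q.IsEven b) (a : Q.Node) :
    Q.tau ε₁ ε₂ b (Q.psi ε₁ ε₂ a 0 : Q.Completed ε₁ ε₂) = (Q.psi ε₁ ε₂ a 0 : Q.Completed ε₁ ε₂) -
      (2 * (Q.cartan a b : ℂ) / (Q.cartan b b : ℂ)) • (Q.psi ε₁ ε₂ b 0 : Q.Completed ε₁ ε₂) := by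
  have hκ := cartan_self_ne_zero hb
  set r : ℂ := (Q.cartan a b : ℂ) / (Q.cartan b b : ℂ) with hr
  have hrκ : r * (Q.cartan b b : ℂ) = Q.cartan a b := div_mul_cancel₀ _ hκ
  have hfix : Q.tau ε₁ ε₂ b ((Q.psi ε₁ ε₂ a 0 : Q.Completed ε₁ ε₂) +
      (-r) • (Q.psi ε₁ ε₂ b 0 : Q.Completed ε₁ ε₂)) = _ := tau_of_lie_eq_zero
    (by rw [lie_add, lie_smul, lie_e_psi, lie_e_psi, ← hrκ]; module)
    (by rw [lie_add, lie_smul, lie_f_psi, lie_f_psi, ← hrκ]; module)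
  have hm := psi_mem_integrable (Q := Q) ε₁ ε₂
  rw [tau_add hb (hm a) ((Q.integrable ε₁ ε₂).smul_mem _ (hm b)), tau_smul hb _ (hm b),
    tau_psi_self hb, ← eq_sub_iff_add_eq] at hfix
  rw [hfix, mul_div_assoc, ← hr]
  module

theorem tau_Jpsi (hb : Q.IsEven b) (a : Q.Node) :
    Q.tau ε₁ ε₂ b (Q.Jpsi ε₁ ε₂ X a) = Q.Jpsi ε₁ ε₂ X a -
      (2 * (Q.cartan a b : ℂ) / (Q.cartan b b : ℂ)) • Q.Jpsi ε₁ ε₂ X b -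
      (2 * Q.shift ε₁ ε₂ a b / (Q.cartan b b : ℂ)) •
        (Q.psi ε₁ ε₂ b 0 : Q.Completed ε₁ ε₂) := by
  have hκ := cartan_self_ne_zero hb
  set r : ℂ := (Q.cartan a b : ℂ) / (Q.cartan b b : ℂ) with hr
  have hrκ : r * (Q.cartan b b : ℂ) = Q.cartan a b := div_mul_cancel₀ _ hκ
  set s : ℂ := Q.shift ε₁ ε₂ a b / (Q.cartan b b : ℂ) with hs
  have hsκ : s * (Q.cartan b b : ℂ) = Q.shift ε₁ ε₂ a b := div_mul_cancel₀ _ hκ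
  -- The multiple of J(ψ⁽ᵇ⁾₀) removes the J(e⁽ᵇ⁾₀) and J(f⁽ᵇ⁾₀) parts of the brackets, and the
  -- multiple of ψ⁽ᵇ⁾₀ removes the shift; the combination is therefore fixed.
  have hfix : Q.tau ε₁ ε₂ b (Q.Jpsi ε₁ ε₂ X a + ((-r) • Q.Jpsi ε₁ ε₂ X b +
      (-s) • (Q.psi ε₁ ε₂ b 0 : Q.Completed ε₁ ε₂))) = _ := tau_of_lie_eq_zero
    (by
      rw [lie_add, lie_add, lie_smul, lie_smul, lie_e_psi, lie_e_Jpsi, lie_e_Jpsi, shift_self,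
        ← hrκ, ← hsκ]
      module)
    (by
      rw [lie_add, lie_add, lie_smul, lie_smul, lie_f_psi, lie_f_Jpsi, lie_f_Jpsi, shift_self,
        ← hrκ, ← hsκ]
      module)
  have hm := psi_mem_integrable (Q := Q) ε₁ ε₂ b
  have hJ := Jpsi_mem_integrable X ε₁ ε₂
  have h1 := (Q.integrable ε₁ ε₂).smul_mem (-r) (hJ b)
  have h2 := (Q.integrable ε₁ ε₂).smul_mem (-s) hm
  rw [tau_add hb (hJ a) (add_mem h1 h2), tau_add hb h1 h2, tau_smul hb _ (hJ b),
    tau_smul hb _ hm, tau_psi_self hb, tau_Jpsi_self X hb, ← eq_sub_iff_add_eq] at hfix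
  rw [hfix, mul_div_assoc, mul_div_assoc, ← hr, ← hs]
  module

/-! ### Reflections of root vectors -/

variable (Q) in
/-- `y` is an integrable vector of weight `γ`, and `Jy` plays the role of `J(y)`, with the
constants `c`. -/
structure IsRootPair (γ : Q.Lattice) (c : Q.Node → ℂ) (y Jy : Q.Completed ε₁ ε₂) : Prop where
  mem : y ∈ Q.integrable ε₁ ε₂
  memJ : Jy ∈ Q.integrable ε₁ ε₂
  psi (a : Q.Node) : ⁅(Q.psi ε₁ ε₂ a 0 : Q.Completed ε₁ ε₂), y⁆ =
    (Q.rootForm (Q.simpleRoot a) γ : ℂ) • y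
  psiJ (a : Q.Node) : ⁅(Q.psi ε₁ ε₂ a 0 : Q.Completed ε₁ ε₂), Jy⁆ =
    (Q.rootForm (Q.simpleRoot a) γ : ℂ) • Jy
  Jpsi (a : Q.Node) : ⁅Q.Jpsi ε₁ ε₂ X a, y⁆ =
    (Q.rootForm (Q.simpleRoot a) γ : ℂ) • Jy + c a • y

variable (Q ε₁ ε₂) in
/-- The constants of a reflected root vector. -/
def reflectShift (b : Q.Node) (γ : Q.Lattice) (c : Q.Node → ℂ) (a : Q.Node) : ℂ :=
  c a - 2 * (Q.cartan a b : ℂ) / (Q.cartan b b : ℂ) * c b -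
    2 * Q.shift ε₁ ε₂ a b / (Q.cartan b b : ℂ) * (Q.rootForm (Q.simpleRoot b) γ : ℂ)

theorem rootForm_reflect (hb : Q.IsEven b) (a : Q.Node) (γ : Q.Lattice) :
    (Q.rootForm (Q.simpleRoot a) (Q.reflect b γ) : ℂ) = (Q.rootForm (Q.simpleRoot a) γ : ℂ) -
      2 * (Q.cartan a b : ℂ) / (Q.cartan b b : ℂ) * (Q.rootForm (Q.simpleRoot b) γ : ℂ) := by
  have h1 : Q.rootForm (Q.simpleRoot a) (Q.reflect b γ) = Q.rootForm (Q.simpleRoot a) γ -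
      (2 * Q.rootForm (Q.simpleRoot b) γ / Q.cartan b b) * Q.cartan a b := by
    rw [reflect, sub_eq_add_neg, ← neg_smul, rootForm_add_right, rootForm_smul_right,
      rootForm_simpleRoot]
    ring
  have h2 : ((2 * Q.rootForm (Q.simpleRoot b) γ / Q.cartan b b : ℤ) : ℂ) =
      2 * (Q.rootForm (Q.simpleRoot b) γ : ℂ) / (Q.cartan b b : ℂ) := by
    -- The integer division in `reflect` is exact, as the diagonal entry is 2 or -2.
    have hd : Q.cartan b b ∣ 2 * Q.rootForm (Q.simpleRoot b) γ := by
      rcases Q.cartan_self_of_isEven hb with h | h <;> rw [h]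
      · exact dvd_mul_right _ _
      · exact (neg_dvd.2 dvd_rfl).mul_right _
    rw [Int.cast_div hd (cartan_self_ne_zero hb)]
    push_cast
    rfl
  rw [h1]
  push_cast
  rw [h2]
  ring

/-- Applying `tau b` to each relation gives one for the reflected ψ or J(ψ). The case `a = b`, where
these merely change sign, is used to solve for the original ones. -/
theorem IsRootPair.tau {γ : Q.Lattice} {c : Q.Node → ℂ} (hb : Q.IsEven b)
    (h : Q.IsRootPair X γ c y z) :
    Q.IsRootPair X (Q.reflect b γ) (Q.reflectShift ε₁ ε₂ b γ c) (Q.tau ε₁ ε₂ b y)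
      (Q.tau ε₁ ε₂ b z) := by
  have hsmul := fun (k : ℂ) {x : Q.Completed ε₁ ε₂} (hx : x ∈ Q.integrable ε₁ ε₂) =>
    (Q.integrable ε₁ ε₂).smul_mem k hx
  have hκ := cartan_self_ne_zero hb
  have hpsi : ∀ {x : Q.Completed ε₁ ε₂}, x ∈ Q.integrable ε₁ ε₂ →
      (∀ a, ⁅(Q.psi ε₁ ε₂ a 0 : Q.Completed ε₁ ε₂), x⁆ =
        (Q.rootForm (Q.simpleRoot a) γ : ℂ) • x) → ∀ a,
      ⁅(Q.psi ε₁ ε₂ a 0 : Q.Completed ε₁ ε₂), Q.tau ε₁ ε₂ b x⁆ =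
        (Q.rootForm (Q.simpleRoot a) (Q.reflect b γ) : ℂ) • Q.tau ε₁ ε₂ b x := by
    intro x hx hw a
    have key : ∀ a, ⁅Q.tau ε₁ ε₂ b (Q.psi ε₁ ε₂ a 0 : Q.Completed ε₁ ε₂), Q.tau ε₁ ε₂ b x⁆ =
        (Q.rootForm (Q.simpleRoot a) γ : ℂ) • Q.tau ε₁ ε₂ b x := fun a => by
      rw [← tau_lie hb (psi_mem_integrable ε₁ ε₂ a) hx, hw, tau_smul hb _ hx]
    have kb := key b
    rw [tau_psi_self hb, neg_lie, neg_eq_iff_eq_neg] at kb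
    have ka := key a
    rw [tau_psi hb, sub_lie, smul_lie, kb, sub_eq_iff_eq_add] at ka
    rw [ka, rootForm_reflect hb]
    module
  refine ⟨tau_mem_integrable hb h.mem, tau_mem_integrable hb h.memJ, hpsi h.mem h.psi,
    hpsi h.memJ h.psiJ, fun a => ?_⟩
  have key : ∀ a, ⁅Q.tau ε₁ ε₂ b (Q.Jpsi ε₁ ε₂ X a), Q.tau ε₁ ε₂ b y⁆ =
      (Q.rootForm (Q.simpleRoot a) γ : ℂ) • Q.tau ε₁ ε₂ b z + c a • Q.tau ε₁ ε₂ b y := fun a => by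
    rw [← tau_lie hb (Jpsi_mem_integrable X ε₁ ε₂ a) h.mem, h.Jpsi,
      tau_add hb (hsmul _ h.memJ) (hsmul _ h.mem), tau_smul hb _ h.memJ, tau_smul hb _ h.mem]
  have kb := key b
  rw [tau_Jpsi_self X hb, neg_lie, neg_eq_iff_eq_neg] at kb
  have ka := key a
  rw [tau_Jpsi X hb, sub_lie, sub_lie, smul_lie, smul_lie, kb, hpsi h.mem h.psi b,
    sub_eq_iff_eq_add, sub_eq_iff_eq_add] at ka
  rw [ka, rootForm_reflect hb, rootForm_reflect hb, reflectShift,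
    mul_div_cancel_right₀ (2 : ℂ) hκ]
  module

theorem isRootPair_e (ε₁ ε₂ : ℂ) (i : Q.Node) :
    Q.IsRootPair X (Q.simpleRoot i) (fun a => Q.shift ε₁ ε₂ a i)
      (Q.e ε₁ ε₂ i 0 : Q.Completed ε₁ ε₂) (Q.Je ε₁ ε₂ X i) where
  mem := e_mem_integrable ε₁ ε₂ i
  memJ := Je_mem_integrable X ε₁ ε₂ i
  psi a := by rw [rootForm_simpleRoot, lie_psi_e]
  psiJ a := by rw [rootForm_simpleRoot, lie_psi_Je]
  Jpsi a := by rw [rootForm_simpleRoot, lie_Jpsi_e]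

theorem rootForm_neg_right (α β : Q.Lattice) : Q.rootForm α (-β) = -Q.rootForm α β := by
  have := Q.rootForm_smul_right (-1) α β
  rwa [neg_one_smul, neg_one_mul] at this

theorem isRootPair_f (ε₁ ε₂ : ℂ) (i : Q.Node) :
    Q.IsRootPair X (-Q.simpleRoot i) (-fun a => Q.shift ε₁ ε₂ a i)
      (Q.f ε₁ ε₂ i 0 : Q.Completed ε₁ ε₂) (Q.Jf ε₁ ε₂ X i) where
  mem := f_mem_integrable ε₁ ε₂ i
  memJ := Jf_mem_integrable X ε₁ ε₂ i
  psi a := by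
    rw [rootForm_neg_right, rootForm_simpleRoot, lie_psi_f, Int.cast_neg, neg_smul]
  psiJ a := by
    rw [rootForm_neg_right, rootForm_simpleRoot, lie_psi_Jf, Int.cast_neg, neg_smul]
  Jpsi a := by
    rw [rootForm_neg_right, rootForm_simpleRoot, lie_Jpsi_f, Int.cast_neg, neg_smul,
      Pi.neg_apply, neg_smul, ← sub_eq_add_neg]

theorem reflect_neg (hb : Q.IsEven b) (γ : Q.Lattice) : Q.reflect b (-γ) = -Q.reflect b γ := by
  have hd : Q.cartan b b ∣ 2 * Q.rootForm (Q.simpleRoot b) γ := by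
    rcases Q.cartan_self_of_isEven hb with h | h <;> rw [h]
    · exact dvd_mul_right _ _
    · exact (neg_dvd.2 dvd_rfl).mul_right _
  rw [reflect, reflect, rootForm_neg_right, mul_neg, Int.neg_ediv_of_dvd hd, neg_smul]
  abel

/-- The new constants are jointly linear in the weight and the old constants, so vectors of opposite
weights keep opposite constants under every reflection. -/
theorem reflectShift_neg (ε₁ ε₂ : ℂ) (b : Q.Node) (γ : Q.Lattice) (c : Q.Node → ℂ) :
    Q.reflectShift ε₁ ε₂ b (-γ) (-c) = -Q.reflectShift ε₁ ε₂ b γ c := by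
  ext a
  simp only [reflectShift, rootForm_neg_right, Pi.neg_apply, Int.cast_neg]
  ring

/-- The denominators are harmless because 2/(α⁽ᵇ⁾, α⁽ᵇ⁾) = ±1. -/
theorem reflectShift_integral (hb : Q.IsEven b) (γ : Q.Lattice) {c : Q.Node → ℂ}
    (hc : ∀ a, ∃ k : ℤ, c a = (ε₁ - ε₂) / 2 * k) (a : Q.Node) :
    ∃ k : ℤ, Q.reflectShift ε₁ ε₂ b γ c a = (ε₁ - ε₂) / 2 * k := by
  obtain ⟨k, hk⟩ := hc a
  obtain ⟨l, hl⟩ := hc b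
  obtain ⟨m, hm⟩ := Q.shift_eq ε₁ ε₂ a b
  rw [reflectShift, hk, hl, hm]
  rcases Q.cartan_self_of_isEven hb with h | h <;> rw [h]
  · refine ⟨k - Q.cartan a b * l - m * Q.rootForm (Q.simpleRoot b) γ, ?_⟩
    push_cast
    ring
  · refine ⟨k + Q.cartan a b * l + m * Q.rootForm (Q.simpleRoot b) γ, ?_⟩
    push_cast
    ring

/-- The e and f sides are carried through one induction so that the same constants, up to sign,
serve both. -/
theorem exists_isRootPair_tauWord (ε₁ ε₂ : ℂ) (i : Q.Node) (bs : List Q.Node)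
    (hbs : ∀ b ∈ bs, Q.IsEven b) :
    ∃ c : Q.Node → ℂ, (∀ a, ∃ k : ℤ, c a = (ε₁ - ε₂) / 2 * k) ∧
      Q.IsRootPair X (Q.reflectWord bs (Q.simpleRoot i)) c
        (Q.tauWord ε₁ ε₂ bs (Q.e ε₁ ε₂ i 0 : Q.Completed ε₁ ε₂))
        (Q.tauWord ε₁ ε₂ bs (Q.Je ε₁ ε₂ X i)) ∧
      Q.IsRootPair X (-Q.reflectWord bs (Q.simpleRoot i)) (-c)
        (Q.tauWord ε₁ ε₂ bs (Q.f ε₁ ε₂ i 0 : Q.Completed ε₁ ε₂))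
        (Q.tauWord ε₁ ε₂ bs (Q.Jf ε₁ ε₂ X i)) := by
  induction bs with
  | nil => exact ⟨_, fun a => Q.shift_eq ε₁ ε₂ a i, isRootPair_e X ε₁ ε₂ i, isRootPair_f X ε₁ ε₂ i⟩
  | cons b bs ih =>
    obtain ⟨c, hc, he, hf⟩ := ih fun b hb => hbs b (List.mem_cons_of_mem _ hb)
    have hb : Q.IsEven b := hbs b List.mem_cons_self
    refine ⟨_, reflectShift_integral hb (Q.reflectWord bs (Q.simpleRoot i)) hc, he.tau X hb, ?_⟩
    have h := hf.tau X hb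
    rwa [reflect_neg hb, reflectShift_neg] at h

theorem tauWord_mem_integrable {bs : List Q.Node} (hbs : ∀ b ∈ bs, Q.IsEven b)
    (hy : y ∈ Q.integrable ε₁ ε₂) : Q.tauWord ε₁ ε₂ bs y ∈ Q.integrable ε₁ ε₂ := by
  induction bs with
  | nil => exact hy
  | cons b bs ih =>
    exact tau_mem_integrable (hbs b List.mem_cons_self)
      (ih fun b hb => hbs b (List.mem_cons_of_mem _ hb))

theorem tauWordDefined_of_mem {bs : List Q.Node} (hbs : ∀ b ∈ bs, Q.IsEven b)
    (hy : y ∈ Q.integrable ε₁ ε₂) : Q.TauWordDefined ε₁ ε₂ bs y := by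
  induction bs with
  | nil => trivial
  | cons b bs ih =>
    have hbs' : ∀ b ∈ bs, Q.IsEven b := fun b hb => hbs b (List.mem_cons_of_mem _ hb)
    exact ⟨ih hbs', tauDefined_of_mem (hbs b List.mem_cons_self) (tauWord_mem_integrable hbs' hy)⟩

end Reflections

end Conifold
end QuiverYangian
end

/-! ### The proposition for positive real roots -/

open QuiverYangian in
theorem proposition3p1 (Q : Conifold) (ε₁ ε₂ : ℂ) (hε : ε₁ + ε₂ ≠ 0) (X : Q.DualRootBases)
    (i : Q.Node) (bs : List Q.Node) (hbs : ∀ b ∈ bs, Q.IsEven b)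
    (α : Q.Lattice) (hα : α ∈ Q.posRealRoots) (hw : α = Q.reflectWord bs (Q.simpleRoot i))
    (eα fα Jeα Jfα : Q.Completed ε₁ ε₂)
    (heα : eα = Q.tauWord ε₁ ε₂ bs (Q.e ε₁ ε₂ i 0 : Q.Completed ε₁ ε₂))
    (hfα : fα = Q.tauWord ε₁ ε₂ bs (Q.f ε₁ ε₂ i 0 : Q.Completed ε₁ ε₂))
    (hJeα : Jeα = Q.tauWord ε₁ ε₂ bs (Q.Je ε₁ ε₂ X i))
    (hJfα : Jfα = Q.tauWord ε₁ ε₂ bs (Q.Jf ε₁ ε₂ X i)) :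
    (Q.TauWordDefined ε₁ ε₂ bs (Q.e ε₁ ε₂ i 0 : Q.Completed ε₁ ε₂) ∧
      Q.TauWordDefined ε₁ ε₂ bs (Q.f ε₁ ε₂ i 0 : Q.Completed ε₁ ε₂) ∧
      Q.TauWordDefined ε₁ ε₂ bs (Q.Je ε₁ ε₂ X i) ∧
      Q.TauWordDefined ε₁ ε₂ bs (Q.Jf ε₁ ε₂ X i)) ∧
    ∀ a : Q.Node, ∃ c : ℂ, (∃ k : ℤ, c = (ε₁ - ε₂) / 2 * k) ∧
      (⁅Q.Jpsi ε₁ ε₂ X a, eα⁆ = ⁅(Q.psi ε₁ ε₂ a 0 : Q.Completed ε₁ ε₂), Jeα⁆ + c • eα ∧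
        ⁅(Q.psi ε₁ ε₂ a 0 : Q.Completed ε₁ ε₂), Jeα⁆ + c • eα =
          (Q.rootForm (Q.simpleRoot a) α : ℂ) • Jeα + c • eα) ∧
      (⁅Q.Jpsi ε₁ ε₂ X a, fα⁆ = ⁅(Q.psi ε₁ ε₂ a 0 : Q.Completed ε₁ ε₂), Jfα⁆ - c • fα ∧
        ⁅(Q.psi ε₁ ε₂ a 0 : Q.Completed ε₁ ε₂), Jfα⁆ - c • fα =
          -((Q.rootForm (Q.simpleRoot a) α : ℂ) • Jfα) - c • fα) := by
  subst hw heα hfα hJeα hJfα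
  refine ⟨⟨Conifold.tauWordDefined_of_mem hbs (Conifold.e_mem_integrable ε₁ ε₂ i),
    Conifold.tauWordDefined_of_mem hbs (Conifold.f_mem_integrable ε₁ ε₂ i),
    Conifold.tauWordDefined_of_mem hbs (Conifold.Je_mem_integrable X ε₁ ε₂ i),
    Conifold.tauWordDefined_of_mem hbs (Conifold.Jf_mem_integrable X ε₁ ε₂ i)⟩, fun a => ?_⟩
  obtain ⟨c, hc, he, hf⟩ := Conifold.exists_isRootPair_tauWord X ε₁ ε₂ i bs hbs
  have he₁ := he.psiJ a
  have he₂ := he.Jpsi a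
  have hf₁ := hf.psiJ a
  have hf₂ := hf.Jpsi a
  -- The f vectors form a pair of weight -α with constants `-c`; pulling out these signs gives the
  -- stated relations.
  rw [Conifold.rootForm_neg_right, Int.cast_neg, neg_smul] at hf₁ hf₂
  rw [Pi.neg_apply, neg_smul, ← sub_eq_add_neg] at hf₂
  exact ⟨c a, hc a, ⟨he₂.trans (congrArg (· + _) he₁.symm), congrArg (· + _) he₁⟩,
    ⟨hf₂.trans (congrArg (· - _) hf₁.symm), congrArg (· - _) hf₁⟩⟩
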